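/- **Setting.** Let $N=2p+1$ be an odd positive integer, $\omega=e^{2\pi i/N}$, and let $\tfrac12$ stand for $p+1$ in $\mathbb Z/N$. *Decorated distinguished triangulations.* Let $T$ be a singular triangulation (self- and multiple adjacencies allowed) of a closed oriented 3-manifold, with $r_0$ vertices, and let $H$ be a Hamiltonian set of edges: at every vertex of $T$ there are exactly two germs of edges of $H$. A decoration consists of: * a *branching*: an orientation of the edges that is acyclic on each abstract tetrahedron; it orders the vertices of each abstract tetrahedron $\Delta$ as $0<1<2<3$. The index of $\Delta$ is $-1$ if the orientation given by this order is that of the manifold, and $+1$ otherwise; * a *full cocycle*: to each edge $e$ an upper triangular matrix $z(e)\in SL(2,\mathbb C)$ with upper-diagonal entry $x(e)\neq0$, such that $z(02)=z(01)z(12)$ on each triangle with ordered vertices $0<1<2$; * an *integral charge* $c'$: an integer for each edge of each abstract tetrahedron, with sum $1$ on the three edges of each face of each abstract tetrahedron, sum $0$ around each edge of $H$ and sum $2$ around each other edge. Put $c=\tfrac12c'\in\mathbb Z/N$. (No further, homological condition on charges is needed.) Write $\mathcal T$ for these data. *The symbols.* Let $d$ be a determination of the $N$-th root holding for $\mathcal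 T$, i.e. $d(w)^N=w$ for all non-zero entries $w$ of all $z(e)$; put $y(e)=d(x(e))$. Define $$\omega(X,Y,Z|n)=\prod_{j=1}^{n}\frac{Y}{Z-X\omega^j}\quad(0\le n<N,\ \text{extended periodically mod }N),\qquad \omega(X,Y,Z|m,n)=\omega(X,Y,Z|m-n)\,\omega^{n^2/2},$$ $$g(x)=\prod_{j=1}^{N-1}(1-x\omega^{-j})^{j/N},\qquad h(x)=\frac{g(x)}{g(1)},\qquad [x]=\frac{1-x^N}{N(1-x)},$$ (principal powers in $g$), and $$R_{\alpha,\beta}^{\gamma,\delta}=\delta_{\gamma+\delta,\beta}\,h(X/Z)\,\omega^{\alpha\delta}\,\omega(X,Y,Z|\gamma,\alpha),\qquad \bar R^{\alpha,\beta}_{\gamma,\delta}=\delta_{\gamma+\delta,\beta}\,\frac{[X/Z]}{h(X/Z)}\,\frac{\omega^{-\alpha\delta}}{\omega(X\omega^{-1},Y,Z|\gamma,\alpha)} .$$ For a tetrahedron $\Delta$ put $X=y(03)y(12)$, $Y=y(01)y(23)$, $Z=y(02)y(13)$, let $a$ and $c$ be the values of $\tfrac12c'$ on its edges $01$ and $12$,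 and for a state $\alpha:\{\text{2-faces of }T\}\to\mathbb Z/N$ let $\alpha_0,\beta_0,\gamma_0,\delta_0$ be its values on the faces $012,023,013,123$. The quantum-dilogarithm c-$6j$-symbol is $$t^\Delta(\alpha)=Z^p\,\omega^{c(\gamma_0-\alpha_0)-ac/2}\,R_{\alpha_0,\beta_0-a}^{\gamma_0-a,\delta_0}\quad\text{or}\quad t^\Delta(\alpha)=Z^p\,\omega^{c(\gamma_0-\alpha_0)+ac/2}\,\bar R^{\alpha_0,\beta_0+a}_{\gamma_0+a,\delta_0}$$ according as the index of $\Delta$ is $1$ or $-1$. The state sum is $$K_N(\mathcal T,d)=\Big(N^{-r_0}\sum_{\alpha}\prod_{\Delta}t^{\Delta}(\alpha)\prod_{e\notin H}y(e)^{-2p}\Big)^N .$$ *Transits $\mathcal T\to\mathcal T'$.* The triangulation is changed by one of the following moves. The branchings and cocycles agree on the common edges, and the charges agree on the tetrahedra not involved. * $2\to3$: two distinct tetrahedra with a common face are replaced by three tetrahedra around a new edge joining the two opposite vertices. $H'=H$. For each boundary edge of the bipyramid (identifications outside disregarded), the sum of the charges at this edge over the two old tetrahedra equals the sum over the three new ones.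 * $0\to2$: two triangles $abc$, $abd$ with a common edge $ab$ are opened up and the hole is filled with two tetrahedra with vertices $a,b,c,d$, glued to each other along $acd$ and $bcd$. The edge $ab$ is doubled and a new edge $cd$ appears. $H'$ consists of the edges of $H$ other than $ab$, together with exactly one of the two copies of $ab$ if $ab\in H$. On each of the edges $ac,bc,ad,bd$ the charges of the two new tetrahedra add up to $0$. * $1\to4$: a tetrahedron $\Delta$ having an edge $e_0\in H$ is replaced by the cone over its boundary from a new interior vertex $v$. $H'$ is obtained from $H$ by replacing $e_0$ by the two edges joining its ends to $v$. For each edge of $\Delta$ (identifications disregarded), the sum of the charges over the new tetrahedra containing it is its charge in $\Delta$, plus $2$ for the chosen edge $e_0$. **Proposition.** Let $\mathcal T\to\mathcal T'$ be a $2\to3$, $0\to2$ or $1\to4$ transit of decorated distinguished triangulations (both being decorated as above, with full cocycles and integral charges), and let $d$ be a determination of the $N$-th root which holds for both $\mathcal T$ and $\mathcal T'$. Then $$K_N(\mathcal T,d)=K_N(\mathcal T',d).$$ -/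

import Mathlib

open scoped BigOperators

noncomputable section

namespace QHyp

/-! ### Branched triangulations of closed oriented 3-manifolds -/

/-- The ordered pair `i < j` of vertices of a simplex, as a one-dimensional face. -/
def pair {n : ℕ} (i j : Fin n) (h : i < j) : Fin 2 ↪o Fin n :=
  OrderEmbedding.ofStrictMono ![i, j] (by
    intro a b hab
    fin_cases a <;> fin_cases b <;> simp_all)

/-- The face opposite to the vertex `i`. -/
def opp {n : ℕ} (i : Fin (n + 1)) : Fin n ↪o Fin (n + 1) := Fin.succAboveOrderEmb i

/-- A finite singular triangulated complex of dimension at most three with a branching.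

Self-adjacencies and multiple adjacencies are allowed.  A branching is a system of orientations of
the edges which is acyclic on every abstract tetrahedron (equivalently, on every abstract
triangle), and is the same thing as a total order of the vertices of every abstract simplex which
is respected by all face identifications.  So the complex is a semi-simplicial set:
`cell k` is the set of `k`-simplices and, for an increasing map `φ` from `{0, …, k}` to
`{0, …, m}`, `res φ c` is the `k`-dimensional face of the `m`-simplex `c` spanned by the vertices
with numbers `φ 0 < ⋯ < φ k`.  An edge `e` is oriented from its vertex `0` to its vertex `1`. -/
structure BranchedComplex where
  cell : ℕ → Type
  [fin : ∀ k, Fintype (cell k)]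
  res : ∀ {m k : ℕ}, (Fin (k + 1) ↪o Fin (m + 1)) → cell m → cell k
  res_id : ∀ {m : ℕ} (c : cell m), res (RelEmbedding.refl _) c = c
  res_comp : ∀ {m l k : ℕ} (φ : Fin (k + 1) ↪o Fin (l + 1)) (ψ : Fin (l + 1) ↪o Fin (m + 1))
    (c : cell m), res (φ.trans ψ) c = res φ (res ψ c)
  dim_le : ∀ k, 3 < k → IsEmpty (cell k)

attribute [instance] BranchedComplex.fin

namespace BranchedComplex

variable (X : BranchedComplex)

/-- The abstract tetrahedra of the star of `c`, each with the position at which `c` occurs in it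
(these are the top-dimensional cells of the link of `c`). -/
def Corner {k : ℕ} (c : X.cell k) : Type :=
  {p : X.cell 3 × (Fin (k + 1) ↪o Fin 4) // X.res p.2 p.1 = c}

/-- Two corners at `c` are adjacent if they share an abstract triangle that contains `c`. -/
def CornerAdj {k : ℕ} (c : X.cell k) (p q : X.Corner c) : Prop :=
  ∃ (θ : Fin (k + 1) ↪o Fin 3) (ψ ψ' : Fin 3 ↪o Fin 4),
    θ.trans ψ = p.1.2 ∧ θ.trans ψ' = q.1.2 ∧ X.res ψ p.1.1 = X.res ψ' q.1.1

/-- The number of `m`-dimensional abstract simplices having `v` as a vertex, counted with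
multiplicity; this is the number of `(m-1)`-cells in the link of `v`. -/
def linkCount (m : ℕ) (v : X.cell 0) : ℕ :=
  Nat.card {p : X.cell m × (Fin 1 ↪o Fin (m + 1)) // X.res p.2 p.1 = v}

end BranchedComplex

/-- A branched singular triangulation of a closed oriented 3-manifold.

`index t = -1` if the orientation of the tetrahedron `t` given by its ordered vertices is the
orientation of the manifold and `index t = 1` otherwise.  `closed` says that every triangle is a
face of exactly two abstract tetrahedra, which induce opposite orientations on it.  The last three
fields say that the link of every edge is a circle and the link of every vertex is a 2-sphere
(a connected closed surface of Euler characteristic two). -/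
structure BranchedTriangulation extends BranchedComplex where
  index : cell 3 → ℤˣ
  closed : ∀ (f : cell 2) (s : ℤˣ),
    ∃! p : cell 3 × Fin 4, res (opp p.2) p.1 = f ∧ index p.1 * (-1) ^ (p.2 : ℕ) = s
  pure : ∀ k, k ≤ 3 → ∀ c : cell k, ∃ (t : cell 3) (φ : Fin (k + 1) ↪o Fin 4), res φ t = c
  edge_link : ∀ (e : cell 1) (p q : toBranchedComplex.Corner e),
    Relation.EqvGen (toBranchedComplex.CornerAdj e) p q
  vertex_link : ∀ (v : cell 0) (p q : toBranchedComplex.Corner v),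
    Relation.EqvGen (toBranchedComplex.CornerAdj v) p q
  vertex_euler : ∀ v : cell 0,
    toBranchedComplex.linkCount 1 v + toBranchedComplex.linkCount 3 v =
      toBranchedComplex.linkCount 2 v + 2

/-! ### Decorated distinguished triangulations -/

open Classical in
/-- A decorated distinguished triangulation.

* `H` is a set of edges with exactly two germs of edges at every vertex (a Hamiltonian link).
* `z` is a full 1-cocycle with values in the Borel subgroup of upper triangular matrices of
  `SL(2, ℂ)`.
* `charge` is a function on the edges of all abstract tetrahedra, with integer values, which has
  sum `1` on every face of every abstract tetrahedron, sum `0` around every edge of `H` and sum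
  `2` around every other edge. -/
structure DecoratedTriangulation extends BranchedTriangulation where
  H : Set (cell 1)
  hamiltonian : ∀ v : cell 0,
    Nat.card {p : cell 1 × (Fin 1 ↪o Fin 2) // p.1 ∈ H ∧ res p.2 p.1 = v} = 2
  z : cell 1 → Matrix.SpecialLinearGroup (Fin 2) ℂ
  z_upper : ∀ e, z e 1 0 = 0
  z_cocycle : ∀ f : cell 2,
    z (res (pair 0 2 (by decide)) f) =
      z (res (pair 0 1 (by decide)) f) * z (res (pair 1 2 (by decide)) f)
  z_full : ∀ e, z e 0 1 ≠ 0
  charge : cell 3 → (Fin 2 ↪o Fin 4) → ℤ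
  charge_face : ∀ (t : cell 3) (ψ : Fin 3 ↪o Fin 4),
    ∑ θ : Fin 2 ↪o Fin 3, charge t (θ.trans ψ) = 1
  charge_edge : ∀ e : cell 1,
    (∑ t : cell 3, ∑ φ : Fin 2 ↪o Fin 4, if res φ t = e then charge t φ else 0) =
      if e ∈ H then 0 else 2

namespace DecoratedTriangulation

variable (T : DecoratedTriangulation)

/-- The upper diagonal entry of the cocycle. -/
def x (e : T.cell 1) : ℂ := T.z e 0 1

/-- `d` is a determination of the `N`-th root on all (non-zero) entries of the cocycle. -/
def RootHolds (N : ℕ) (d : ℂ → ℂ) : Prop :=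
  ∀ (e : T.cell 1) (i j : Fin 2), T.z e i j ≠ 0 → d (T.z e i j) ^ N = T.z e i j

end DecoratedTriangulation

/-! ### The quantum-dilogarithm c-6j-symbols -/

section Symbols

variable (N : ℕ) [NeZero N]

/-- `ω ^ k` for `ω = exp (2πi / N)` and `k` an integer modulo `N`. -/
def omegaPow (k : ZMod N) : ℂ := ZMod.stdAddChar k

/-- `1/2 = p + 1` modulo `N = 2 p + 1`. -/
def half : ZMod N := (((N - 1) / 2 + 1 : ℕ) : ZMod N)

/-- `ω(x, y, z | n) = ∏_{j=1}^n y / (z - x ω ^ j)`, which is periodic in `n` modulo `N` when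
`x ^ N + y ^ N = z ^ N`. -/
def omegaFun (x y z : ℂ) (n : ZMod N) : ℂ :=
  ∏ j ∈ Finset.Icc 1 n.val, y / (z - x * omegaPow N (j : ZMod N))

/-- `ω(x, y, z | m, n) = ω(x, y, z | m - n) ω ^ (n² / 2)`. -/
def omegaFun₂ (x y z : ℂ) (m n : ZMod N) : ℂ :=
  omegaFun N x y z (m - n) * omegaPow N (n ^ 2 * half N)

/-- `g(x) = ∏_{j=1}^{N-1} (1 - x ω ^ (-j)) ^ (j / N)`, with the principal powers. -/
def gFun (x : ℂ) : ℂ :=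
  ∏ j ∈ Finset.Icc 1 (N - 1), (1 - x * omegaPow N (-(j : ZMod N))) ^ ((j : ℂ) / (N : ℂ))

/-- `h(x) = g(x) / g(1)`. -/
def hFun (x : ℂ) : ℂ := gFun N x / gFun N 1

/-- `[x] = (1 - x ^ N) / (N (1 - x))`. -/
def bracket (x : ℂ) : ℂ := (1 - x ^ N) / ((N : ℂ) * (1 - x))

/-- The 6j-symbol with lower indices `α, β` and upper indices `γ, δ`. -/
def sixJ (x y z : ℂ) (α β γ δ : ZMod N) : ℂ :=
  if γ + δ = β then
    hFun N (x / z) * omegaPow N (α * δ) * omegaFun₂ N x y z γ α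
  else 0

/-- The inverse 6j-symbol with upper indices `α, β` and lower indices `γ, δ`. -/
def sixJBar (x y z : ℂ) (α β γ δ : ZMod N) : ℂ :=
  if γ + δ = β then
    bracket N (x / z) / hFun N (x / z) * omegaPow N (-(α * δ)) /
      omegaFun₂ N (x * omegaPow N (-1)) y z γ α
  else 0

/-- The c-6j-symbol (the 6j-symbol with charges `a, c`) of a tetrahedron of index `1`. -/
def cSixJ (x y z : ℂ) (a c α β γ δ : ZMod N) : ℂ :=
  z ^ ((N - 1) / 2) * omegaPow N (c * (γ - α) - a * c * half N) *
    sixJ N x y z α (β - a) (γ - a) δ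

/-- The c-6j-symbol of a tetrahedron of index `-1`. -/
def cSixJBar (x y z : ℂ) (a c α β γ δ : ZMod N) : ℂ :=
  z ^ ((N - 1) / 2) * omegaPow N (c * (γ - α) + a * c * half N) *
    sixJBar N x y z α (β + a) (γ + a) δ

end Symbols

/-! ### The state sum -/

namespace DecoratedTriangulation

variable (T : DecoratedTriangulation) (N : ℕ) [NeZero N] (d : ℂ → ℂ)

/-- The `N`-th root of `x` on the edge `ij` of the tetrahedron `t`. -/
def yy (t : T.cell 3) (i j : Fin 4) (h : i < j) : ℂ := d (T.x (T.res (pair i j h) t))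

/-- The charge modulo `N` (one half of the integral charge) on the edge `ij` of `t`. -/
def chargeMod (t : T.cell 3) (i j : Fin 4) (h : i < j) : ZMod N :=
  (T.charge t (pair i j h) : ZMod N) * half N

/-- The c-6j-symbol of the tetrahedron `t` in the state `α`.  With vertices `0 < 1 < 2 < 3`,
the indices are the states of the faces `012`, `023`, `013`, `123`, and the charges are those of
the edges `01` and `12`. -/
def tetSymbol (α : T.cell 2 → ZMod N) (t : T.cell 3) : ℂ :=
  let X := T.yy d t 0 3 (by decide) * T.yy d t 1 2 (by decide)
  let Y := T.yy d t 0 1 (by decide) * T.yy d t 2 3 (by decide)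
  let Z := T.yy d t 0 2 (by decide) * T.yy d t 1 3 (by decide)
  let a := T.chargeMod N t 0 1 (by decide)
  let c := T.chargeMod N t 1 2 (by decide)
  if T.index t = 1 then
    cSixJ N X Y Z a c
      (α (T.res (opp 3) t)) (α (T.res (opp 1) t)) (α (T.res (opp 2) t)) (α (T.res (opp 0) t))
  else
    cSixJBar N X Y Z a c
      (α (T.res (opp 3) t)) (α (T.res (opp 1) t)) (α (T.res (opp 2) t)) (α (T.res (opp 0) t))

open Classical in
/-- The state sum `K_N(T, d)`, where `N = 2 p + 1`:
`(N ^ (-r₀) ∑_α ∏_Δ t^Δ(α) ∏_{e ∉ H} (x(e) ^ (1/N)) ^ (-2p)) ^ N`. -/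
def stateSum : ℂ :=
  (((N : ℂ) ^ Fintype.card (T.cell 0))⁻¹ *
    (∑ α : T.cell 2 → ZMod N, ∏ t : T.cell 3, T.tetSymbol N d α t) *
    ∏ e : T.cell 1, if e ∈ T.H then 1 else (d (T.x e) ^ (2 * ((N - 1) / 2)))⁻¹) ^ N

end DecoratedTriangulation

/-! ### Decorated moves -/

/-- The simplex `φ` of the standard 4-simplex lies in one of the facets opposite to the vertices
in `S`.  These facets form a triangulated ball, and the facets opposite to the vertices not in `S`
form another one with the same boundary. -/
def InBall (S : Finset (Fin 5)) {k : ℕ} (φ : Fin (k + 1) ↪o Fin 5) : Prop :=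
  ∃ i ∈ S, i ∉ Set.range φ

/-- `φ` is in the ball of `S` and not on its boundary. -/
def IsInner (S : Finset (Fin 5)) {k : ℕ} (φ : Fin (k + 1) ↪o Fin 5) : Prop :=
  InBall S φ ∧ ¬ InBall Sᶜ φ

/-- The cell `c` is the image of the simplex `φ` of the ball of `S`, when the facet opposite to
`i` is mapped to the tetrahedron `τ i`. -/
def IsImage (X : BranchedComplex) (S : Finset (Fin 5)) (τ : S → X.cell 3) {k : ℕ}
    (φ : Fin (k + 1) ↪o Fin 5) (c : X.cell k) : Prop :=
  ∃ (i : S) (ψ : Fin (k + 1) ↪o Fin 4), ψ.trans (opp i.1) = φ ∧ X.res ψ (τ i) = c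

/-- `τ` maps the ball of `S` to the complex, and is injective on the interior of the ball. -/
structure IsBall (X : BranchedComplex) (S : Finset (Fin 5)) (τ : S → X.cell 3) : Prop where
  wellDefined : ∀ {k : ℕ} (φ : Fin (k + 1) ↪o Fin 5) (c c' : X.cell k),
    IsImage X S τ φ c → IsImage X S τ φ c' → c = c'
  inner_injective : ∀ {k : ℕ} (φ ψ : Fin (k + 1) ↪o Fin 5) (c : X.cell k), IsInner S φ →
    IsImage X S τ φ c → IsImage X S τ ψ c → φ = ψ

/-- `c` is an inner cell of the ball. -/
def InnerCell (X : BranchedComplex) (S : Finset (Fin 5)) (τ : S → X.cell 3) {k : ℕ}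
    (c : X.cell k) : Prop :=
  ∃ φ : Fin (k + 1) ↪o Fin 5, IsInner S φ ∧ IsImage X S τ φ c

/-- A branched move which replaces the ball `τ` of `T`, made of the facets of a 4-simplex opposite
to the vertices in `S`, by the ball `τ'` made of the other facets.  It is a `2 → 3` move if `S` has
two elements and a `1 → 4` move if `S` has one element.

The branchings of the two triangulations agree on the common edges and orient all ten edges of the
4-simplex without cycles on any of its facets, so they are given by a total order of its five
vertices; these are numbered accordingly.

`common c c'` says that the cell `c` of `T` and the cell `c'` of `T'` are the same cell, which is
not in the interior of the ball. -/
structure IsBallMove (T T' : BranchedTriangulation) (S : Finset (Fin 5))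
    (τ : S → T.cell 3) (τ' : (Sᶜ : Finset (Fin 5)) → T'.cell 3)
    (common : ∀ k, T.cell k → T'.cell k → Prop) : Prop where
  ball : IsBall T.toBranchedComplex S τ
  ball' : IsBall T'.toBranchedComplex Sᶜ τ'
  common_inner : ∀ {k : ℕ} (c : T.cell k) (c' : T'.cell k), common k c c' →
    ¬ InnerCell T.toBranchedComplex S τ c ∧ ¬ InnerCell T'.toBranchedComplex Sᶜ τ' c'
  common_left : ∀ {k : ℕ} (c : T.cell k), ¬ InnerCell T.toBranchedComplex S τ c →
    ∃! c', common k c c'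
  common_right : ∀ {k : ℕ} (c' : T'.cell k), ¬ InnerCell T'.toBranchedComplex Sᶜ τ' c' →
    ∃! c, common k c c'
  common_res : ∀ {m k : ℕ} (θ : Fin (k + 1) ↪o Fin (m + 1)) (c : T.cell m) (c' : T'.cell m),
    common m c c' → common k (T.res θ c) (T'.res θ c')
  common_boundary : ∀ {k : ℕ} (φ : Fin (k + 1) ↪o Fin 5) (c : T.cell k) (c' : T'.cell k),
    IsImage T.toBranchedComplex S τ φ c → IsImage T'.toBranchedComplex Sᶜ τ' φ c' → common k c c'
  common_index : ∀ (t : T.cell 3) (t' : T'.cell 3), common 3 t t' → T.index t = T'.index t'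
  ball_index : ∃ ε : ℤˣ, (∀ i : S, T.index (τ i) = ε * (-1) ^ (i.1 : ℕ)) ∧
    ∀ i : (Sᶜ : Finset (Fin 5)), T'.index (τ' i) = -ε * (-1) ^ (i.1 : ℕ)

/-- The cocycles agree on the common edges, and the charges agree on the edges of the abstract
tetrahedra which are not involved in the move. -/
structure AgreeOnCommon (T T' : DecoratedTriangulation)
    (common : ∀ k, T.cell k → T'.cell k → Prop) : Prop where
  cocycle : ∀ (e : T.cell 1) (e' : T'.cell 1), common 1 e e' → T.z e = T'.z e'
  charge : ∀ (t : T.cell 3) (t' : T'.cell 3), common 3 t t' → T.charge t = T'.charge t'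

open Classical in
/-- The sum of the charges at the edge `φ` of the 4-simplex, over the tetrahedra of the ball. -/
def ballCharge (T : DecoratedTriangulation) (S : Finset (Fin 5)) (τ : S → T.cell 3)
    (φ : Fin 2 ↪o Fin 5) : ℤ :=
  ∑ i : S, ∑ ψ : Fin 2 ↪o Fin 4, if ψ.trans (opp i.1) = φ then T.charge (τ i) ψ else 0

/-- `T → T'` is a decorated `2 → 3` transit. -/
def Transit23 (T T' : DecoratedTriangulation) : Prop :=
  ∃ (S : Finset (Fin 5)) (τ : S → T.cell 3) (τ' : (Sᶜ : Finset (Fin 5)) → T'.cell 3)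
    (common : ∀ k, T.cell k → T'.cell k → Prop),
    S.card = 2 ∧
    IsBallMove T.toBranchedTriangulation T'.toBranchedTriangulation S τ τ' common ∧
    AgreeOnCommon T T' common ∧
    (∀ (e : T.cell 1) (e' : T'.cell 1), common 1 e e' → (e ∈ T.H ↔ e' ∈ T'.H)) ∧
    (∀ e' : T'.cell 1, InnerCell T'.toBranchedComplex Sᶜ τ' e' → e' ∉ T'.H) ∧
    (∀ φ : Fin 2 ↪o Fin 5, InBall S φ → InBall Sᶜ φ →
      ballCharge T S τ φ = ballCharge T' Sᶜ τ' φ)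

open Classical in
/-- `T → T'` is a decorated `1 → 4` transit.  Here `i` is the number of the new vertex among the
vertices of the 4-simplex, `φ₀` is an edge of the subdivided tetrahedron, and the corresponding
edge `e₀` of `H` is replaced by the two edges from its ends to the new vertex. -/
def Transit14 (T T' : DecoratedTriangulation) : Prop :=
  ∃ (i : Fin 5) (τ : ({i} : Finset (Fin 5)) → T.cell 3)
    (τ' : (({i} : Finset (Fin 5))ᶜ : Finset (Fin 5)) → T'.cell 3)
    (common : ∀ k, T.cell k → T'.cell k → Prop) (φ₀ : Fin 2 ↪o Fin 5) (e₀ : T.cell 1),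
    IsBallMove T.toBranchedTriangulation T'.toBranchedTriangulation {i} τ τ' common ∧
    AgreeOnCommon T T' common ∧
    IsImage T.toBranchedComplex {i} τ φ₀ e₀ ∧ e₀ ∈ T.H ∧
    (∀ (e : T.cell 1) (e' : T'.cell 1), common 1 e e' → (e' ∈ T'.H ↔ e ∈ T.H ∧ e ≠ e₀)) ∧
    (∀ (φ : Fin 2 ↪o Fin 5) (e' : T'.cell 1), i ∈ Set.range φ →
      IsImage T'.toBranchedComplex {i}ᶜ τ' φ e' →
      (e' ∈ T'.H ↔ ∀ v ∈ Set.range φ, v = i ∨ v ∈ Set.range φ₀)) ∧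
    (∀ φ : Fin 2 ↪o Fin 5, i ∉ Set.range φ →
      ballCharge T' {i}ᶜ τ' φ = ballCharge T {i} τ φ + if φ = φ₀ then 2 else 0)

/-- `c` is an inner cell of the pillow formed by the tetrahedra `t₁` and `t₂` of `X`, which are
glued to each other along their faces opposite to the vertices `i` and `j`: it is one of the two
tetrahedra, one of the two common faces, or the edge opposite to the edge `ij`. -/
def PillowInner (X : BranchedComplex) (i j : Fin 4) (t₁ t₂ : X.cell 3) {k : ℕ}
    (c : X.cell k) : Prop :=
  ∃ φ : Fin (k + 1) ↪o Fin 4, (∀ v, v ≠ i → v ≠ j → v ∈ Set.range φ) ∧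
    (X.res φ t₁ = c ∨ X.res φ t₂ = c)

/-- A branched `0 → 2` (lune) move from `T` to `T'`: two triangles of `T` which share an edge
are opened up, and the resulting hole is filled by a pillow of two tetrahedra `t₁` and `t₂`,
glued to each other along their faces opposite to the vertices `i` and `j`.  The shared edge of
the two triangles is doubled and becomes the edge `ij` of `t₁` and the edge `ij` of `t₂`.

`common c c'` says that the cell `c'` of `T'` is not inside the pillow and becomes the cell `c` of
`T` when the pillow is flattened, that is, when `t₁` and `t₂` are identified with each other. -/
structure IsLuneMove (T T' : BranchedTriangulation) (i j : Fin 4) (t₁ t₂ : T'.cell 3)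
    (common : ∀ k, T.cell k → T'.cell k → Prop) : Prop where
  lt : i < j
  ne : t₁ ≠ t₂
  glue_i : T'.res (opp i) t₁ = T'.res (opp i) t₂
  glue_j : T'.res (opp j) t₁ = T'.res (opp j) t₂
  edge_ne : T'.res (pair i j lt) t₁ ≠ T'.res (pair i j lt) t₂
  common_inner : ∀ {k : ℕ} (c : T.cell k) (c' : T'.cell k), common k c c' →
    ¬ PillowInner T'.toBranchedComplex i j t₁ t₂ c'
  common_left : ∀ {k : ℕ} (c : T.cell k), ∃ c', common k c c'
  common_right : ∀ {k : ℕ} (c' : T'.cell k),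
    ¬ PillowInner T'.toBranchedComplex i j t₁ t₂ c' → ∃! c, common k c c'
  common_fibre : ∀ {k : ℕ} (c : T.cell k) (c' c'' : T'.cell k), common k c c' →
    (common k c c'' ↔ ¬ PillowInner T'.toBranchedComplex i j t₁ t₂ c'' ∧
      Relation.EqvGen (fun a b => ∃ φ : Fin (k + 1) ↪o Fin 4,
        T'.res φ t₁ = a ∧ T'.res φ t₂ = b) c' c'')
  common_res : ∀ {m k : ℕ} (θ : Fin (k + 1) ↪o Fin (m + 1)) (c : T.cell m) (c' : T'.cell m),
    common m c c' → common k (T.res θ c) (T'.res θ c')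
  common_index : ∀ (t : T.cell 3) (t' : T'.cell 3), common 3 t t' → T.index t = T'.index t'

/-- `T → T'` is a decorated `0 → 2` transit.  If the doubled edge is in `H`, then exactly one of
its two copies is in the new `H`. -/
def Transit02 (T T' : DecoratedTriangulation) : Prop :=
  ∃ (i j : Fin 4) (t₁ t₂ : T'.cell 3) (common : ∀ k, T.cell k → T'.cell k → Prop),
    IsLuneMove T.toBranchedTriangulation T'.toBranchedTriangulation i j t₁ t₂ common ∧
    AgreeOnCommon T T' common ∧
    (∀ (e : T.cell 1) (e' : T'.cell 1), common 1 e e' → e' ∈ T'.H → e ∈ T.H) ∧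
    (∀ e ∈ T.H, ∃! e', common 1 e e' ∧ e' ∈ T'.H) ∧
    (∀ e' : T'.cell 1, PillowInner T'.toBranchedComplex i j t₁ t₂ e' → e' ∉ T'.H) ∧
    (∀ φ : Fin 2 ↪o Fin 4, (i ∈ Set.range φ ↔ j ∉ Set.range φ) →
      T'.charge t₁ φ + T'.charge t₂ φ = 0)

/-- A transit between decorated distinguished triangulations. -/
def Transit (T T' : DecoratedTriangulation) : Prop :=
  Transit23 T T' ∨ Transit02 T T' ∨ Transit14 T T'

end QHyp

end

namespace QHyp

section Dilogarithm

variable {N : ℕ} [NeZero N]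

theorem omegaPow_add (a b : ZMod N) : omegaPow N (a + b) = omegaPow N a * omegaPow N b :=
  AddChar.map_add_eq_mul _ a b

theorem omegaPow_zero : omegaPow N 0 = 1 := AddChar.map_zero_eq_one _

theorem omegaPow_mul_neg (a : ZMod N) : omegaPow N a * omegaPow N (-a) = 1 := by
  rw [← omegaPow_add, add_neg_cancel, omegaPow_zero]

theorem omegaPow_ne_zero (a : ZMod N) : omegaPow N a ≠ 0 :=
  left_ne_zero_of_mul_eq_one (omegaPow_mul_neg a)

theorem omegaPow_neg (a : ZMod N) : omegaPow N (-a) = (omegaPow N a)⁻¹ :=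
  eq_inv_of_mul_eq_one_right (omegaPow_mul_neg a)

theorem omegaPow_nsmul (k : ℕ) (a : ZMod N) : omegaPow N (k * a) = omegaPow N a ^ k := by
  have h := AddChar.map_nsmul_eq_pow (ZMod.stdAddChar (N := N)) k a
  rwa [nsmul_eq_mul] at h

theorem omegaPow_pow_card (a : ZMod N) : omegaPow N a ^ N = 1 := by
  rw [← omegaPow_nsmul, ZMod.natCast_self, zero_mul, omegaPow_zero]

theorem omegaPow_injective : Function.Injective (omegaPow N) := ZMod.injective_stdAddChar

theorem sum_omegaPow_mul (t : ZMod N) :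
    ∑ m : ZMod N, omegaPow N (t * m) = if t = 0 then (N : ℂ) else 0 := by
  have h := AddChar.sum_mulShift t (ZMod.isPrimitive_stdAddChar N)
  simpa [omegaPow, mul_comm] using h

theorem prod_sub_mul_omegaPow (x z : ℂ) :
    ∏ m : ZMod N, (z - x * omegaPow N m) = z ^ N - x ^ N := by
  have hinj : Function.Injective (omegaPow N) := omegaPow_injective
  have hprim : IsPrimitiveRoot (omegaPow N 1) N := by
    refine IsPrimitiveRoot.mk_of_lt _ (NeZero.pos N) (omegaPow_pow_card _) ?_
    intro l hl hlN h
    rw [← omegaPow_nsmul, mul_one, ← omegaPow_zero (N := N)] at h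
    have := (ZMod.natCast_eq_zero_iff _ _).1 (hinj h)
    exact absurd (Nat.le_of_dvd hl this) (by omega)
  rw [hprim.pow_sub_pow_eq_prod_sub_mul _ _ (NeZero.pos N)]
  refine Finset.prod_bij (fun m _ => omegaPow N m) ?_ ?_ ?_ ?_
  · intro m _
    rw [Polynomial.mem_nthRootsFinset (NeZero.pos N)]
    exact omegaPow_pow_card m
  · intro a _ b _ h
    exact hinj h
  · intro b hb
    rw [Polynomial.mem_nthRootsFinset (NeZero.pos N)] at hb
    obtain ⟨i, -, hi⟩ := hprim.eq_pow_of_pow_eq_one hb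
    exact ⟨(i : ZMod N), Finset.mem_univ _, by rw [← hi, ← omegaPow_nsmul, mul_one]⟩
  · intro m _
    rw [mul_comm]

theorem eq_apply_zero_of_sub_one {A : Type*} (g : ZMod N → A) (h : ∀ n, g (n - 1) = g n)
    (n : ZMod N) : g n = g 0 := by
  have key : ∀ k : ℕ, g (k : ZMod N) = g 0 := by
    intro k
    induction k with
    | zero => simp
    | succ k ih => rw [← ih, ← h]; congr 1; push_cast; ring
  rw [← ZMod.natCast_zmod_val n]
  exact key _

/-- A cyclic quantum dilogarithm: a nowhere vanishing solution on `ZMod N` of the first order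
difference equation of `omegaFun`. -/
structure IsDilog (x y : ℂ) (f : ZMod N → ℂ) : Prop where
  ne_zero : ∀ n, f n ≠ 0
  param_ne_zero : y ≠ 0
  step : ∀ n, f n * (1 - x * omegaPow N n) = y * f (n - 1)

namespace IsDilog

variable {x y : ℂ} {f : ZMod N → ℂ}

theorem factor_ne_zero (hf : IsDilog x y f) (n : ZMod N) : 1 - x * omegaPow N n ≠ 0 := by
  intro h
  have := hf.step n
  rw [h, mul_zero] at this
  exact mul_ne_zero hf.param_ne_zero (hf.ne_zero _) this.symm

theorem pow_add_pow (hf : IsDilog x y f) : y ^ N = 1 - x ^ N := by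
  have h : ∏ n : ZMod N, (f n * (1 - x * omegaPow N n)) = ∏ n : ZMod N, (y * f (n - 1)) :=
    Finset.prod_congr rfl fun n _ => hf.step n
  rw [Finset.prod_mul_distrib, Finset.prod_mul_distrib, prod_sub_mul_omegaPow, one_pow,
    Finset.prod_const, Finset.card_univ, ZMod.card,
    Fintype.prod_equiv (Equiv.subRight (1 : ZMod N)) (fun n => f (n - 1)) f (fun n => rfl),
    mul_comm] at h
  exact (mul_right_cancel₀ (Finset.prod_ne_zero_iff.2 fun n _ => hf.ne_zero n) h).symm

theorem twist (hf : IsDilog x y f) (κ : ℂ) (hκ : κ ≠ 0) (a c : ZMod N) :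
    IsDilog (x * omegaPow N (-a)) (y * omegaPow N c)
      (fun n => κ * omegaPow N (c * n) * f (n - a)) where
  ne_zero n := mul_ne_zero (mul_ne_zero hκ (omegaPow_ne_zero _)) (hf.ne_zero _)
  param_ne_zero := mul_ne_zero hf.param_ne_zero (omegaPow_ne_zero _)
  step n := by
    have h := hf.step (n - a)
    have h1 : omegaPow N (c * n) = omegaPow N c * omegaPow N (c * (n - 1)) := by
      rw [← omegaPow_add]; congr 1; ring
    have h2 : omegaPow N (n - a) = omegaPow N (-a) * omegaPow N n := by
      rw [← omegaPow_add]; congr 1; ring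
    have h3 : n - 1 - a = n - a - 1 := by ring
    rw [h2] at h
    simp only [h1, h3]
    linear_combination κ * omegaPow N c * omegaPow N (c * (n - 1)) * h

/-- `f m / f (m + r)` is a polynomial in `ω ^ m`. -/
theorem ratio (hf : IsDilog x y f) (m : ZMod N) (r : ℕ) :
    f m * y ^ r = f (m + r) * ∏ l ∈ Finset.range r, (1 - x * omegaPow N (m + 1 + l)) := by
  induction r with
  | zero => simp
  | succ r ih =>
    have h := hf.step (m + r + 1)
    rw [add_sub_cancel_right] at h
    rw [Finset.prod_range_succ, pow_succ, ← mul_assoc, ih, Nat.cast_succ, ← add_assoc,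
      show m + 1 + (r : ZMod N) = m + r + 1 by ring]
    linear_combination (-∏ l ∈ Finset.range r, (1 - x * omegaPow N (m + 1 + l))) * h

end IsDilog

theorem sum_omegaPow_mul_prod (x : ℂ) (t : ZMod N) (r : ℕ)
    (h : ∀ l : ℕ, l ≤ r → t + l ≠ 0) :
    ∑ m : ZMod N, omegaPow N (t * m) *
      ∏ l ∈ Finset.range r, (1 - x * omegaPow N (m + 1 + l)) = 0 := by
  induction r generalizing t with
  | zero =>
    have h0 : t ≠ 0 := by simpa using h 0 le_rfl
    simpa [h0] using sum_omegaPow_mul t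
  | succ r ih =>
    have h1 := ih t fun l hl => h l (by omega)
    have h2 := ih (t + 1) fun l hl => by
      have := h (l + 1) (by omega)
      push_cast at this
      rwa [show t + 1 + (l : ZMod N) = t + (l + 1) by ring]
    have h3 : ∀ m : ZMod N, omegaPow N (t * m) *
        ∏ l ∈ Finset.range (r + 1), (1 - x * omegaPow N (m + 1 + l)) =
        omegaPow N (t * m) * ∏ l ∈ Finset.range r, (1 - x * omegaPow N (m + 1 + l)) -
        x * omegaPow N (1 + r) * (omegaPow N ((t + 1) * m) *
          ∏ l ∈ Finset.range r, (1 - x * omegaPow N (m + 1 + l))) := by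
      intro m
      have e1 : omegaPow N (m + 1 + r) = omegaPow N (1 + r) * omegaPow N m := by
        rw [← omegaPow_add]; congr 1; ring
      have e2 : omegaPow N ((t + 1) * m) = omegaPow N (t * m) * omegaPow N m := by
        rw [← omegaPow_add]; congr 1; ring
      rw [Finset.prod_range_succ, e1, e2]
      ring
    simp only [h3, Finset.sum_sub_distrib, ← Finset.mul_sum, h1, h2, mul_zero, sub_zero]

theorem sum_omegaPow_div (x : ℂ) (hx : ∀ m : ZMod N, 1 - x * omegaPow N m ≠ 0) (t : ℕ)
    (ht : t < N) :
    (∑ m : ZMod N, omegaPow N (-(t * m)) / (1 - x * omegaPow N m)) * (1 - x ^ N) =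
      N * x ^ t := by
  have h1 : ∀ m : ZMod N, omegaPow N (-(t * m)) / (1 - x * omegaPow N m) * (1 - x ^ N) =
      ∑ l ∈ Finset.range N, x ^ l * omegaPow N ((l - t) * m) := by
    intro m
    have h2 := mul_neg_geom_sum (x * omegaPow N m) N
    rw [mul_pow, omegaPow_pow_card, mul_one] at h2
    rw [← h2, div_mul_eq_mul_div, mul_div_assoc, mul_div_cancel_left₀ _ (hx m), Finset.mul_sum]
    refine Finset.sum_congr rfl fun l _ => ?_
    rw [mul_pow, ← omegaPow_nsmul, sub_mul, sub_eq_add_neg, omegaPow_add]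
    ring
  rw [Finset.sum_mul, Finset.sum_congr rfl fun m _ => h1 m, Finset.sum_comm]
  simp only [← Finset.mul_sum, sum_omegaPow_mul]
  rw [Finset.sum_eq_single_of_mem t (Finset.mem_range.2 ht)]
  · simp [mul_comm]
  · intro l hl hlt
    rw [if_neg, mul_zero]
    rw [sub_eq_zero, ZMod.natCast_eq_natCast_iff]
    intro h
    exact hlt (Nat.ModEq.eq_of_lt_of_lt h (Finset.mem_range.1 hl) ht)

end Dilogarithm

section Determinants

section Aux

variable {N : ℕ}

theorem prod_pow_val (y : ℂ) : ∏ i : Fin N, y ^ (i : ℕ) = y ^ (N * (N - 1) / 2) := by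
  rw [Fin.prod_univ_eq_prod_range (fun i => y ^ i), Finset.prod_pow_eq_pow_sum,
    Finset.sum_range_id]

theorem natDegree_prod_range_X_sub_C (r : ℕ → ℂ) (e : ℕ) :
    (∏ l ∈ Finset.range e, (Polynomial.X - Polynomial.C (r l))).natDegree = e := by
  rw [Polynomial.natDegree_finsetProd_X_sub_C_eq_card, Finset.card_range]

theorem det_prod_range_sub (v : Fin N → ℂ) (r : ℕ → ℕ → ℂ) :
    (Matrix.of fun b e : Fin N => ∏ l ∈ Finset.range e, (v b - r e l)).det =
      (Matrix.vandermonde v).det := by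
  rw [Matrix.det_eval_matrixOfPolynomials_eq_det_vandermonde v
    (fun e => ∏ l ∈ Finset.range e, (Polynomial.X - Polynomial.C (r e l)))
    (fun e => natDegree_prod_range_X_sub_C _ _)
    (fun e => Polynomial.monic_prod_of_monic _ _ fun l _ => Polynomial.monic_X_sub_C _)]
  congr 1
  ext b e
  simp [Polynomial.eval_prod]

theorem det_mul_row_column (A B : Fin N → ℂ) (F : Matrix (Fin N) (Fin N) ℂ) :
    (Matrix.of fun b e => A b * (B e * F b e)).det = (∏ b, A b) * ((∏ e, B e) * F.det) := by
  rw [← Matrix.det_mul_row B F, ← Matrix.det_mul_column A]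
  rfl

end Aux

variable {N : ℕ} [NeZero N]

namespace IsDilog

variable {x y : ℂ} {f : ZMod N → ℂ}

theorem one_sub_pow_ne_zero (hf : IsDilog x y f) : 1 - x ^ N ≠ 0 := by
  rw [← hf.pow_add_pow]
  exact pow_ne_zero _ hf.param_ne_zero

theorem div_pred (hf : IsDilog x y f) (m : ZMod N) :
    f m / f (m - 1) = y / (1 - x * omegaPow N m) := by
  rw [div_eq_div_iff (hf.ne_zero _) (hf.factor_ne_zero _), hf.step]

theorem div_add (hf : IsDilog x y f) (m : ZMod N) (r : ℕ) :
    f m / f (m + r) = (∏ l ∈ Finset.range r, (1 - x * omegaPow N (m + 1 + l))) / y ^ r := by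
  rw [div_eq_div_iff (hf.ne_zero _) (pow_ne_zero _ hf.param_ne_zero), hf.ratio, mul_comm]

theorem sum_div_pred (hf : IsDilog x y f) (t : ℕ) (ht : t < N) :
    ∑ m : ZMod N, omegaPow N (-(t * m)) * (f m / f (m - 1)) = N * y * x ^ t / (1 - x ^ N) := by
  rw [eq_div_iff hf.one_sub_pow_ne_zero]
  have h := sum_omegaPow_div x hf.factor_ne_zero t ht
  simp only [hf.div_pred]
  have h2 : ∑ m : ZMod N, omegaPow N (-(t * m)) * (y / (1 - x * omegaPow N m)) =
      y * ∑ m : ZMod N, omegaPow N (-(t * m)) / (1 - x * omegaPow N m) := by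
    rw [Finset.mul_sum]
    exact Finset.sum_congr rfl fun m _ => by ring
  rw [h2]
  linear_combination y * h

theorem sum_mul_div_eq_zero (hf : IsDilog x y f) (t k : ZMod N) (hk : k ≠ 0)
    (h : ∀ l : ℕ, l < k.val → t + l ≠ 0) :
    ∑ m : ZMod N, omegaPow N (t * m) * (f m / f (m + k - 1)) = 0 := by
  have hpos : 0 < k.val := Nat.pos_of_ne_zero fun h0 => hk ((ZMod.val_eq_zero k).1 h0)
  have hk' : k - 1 = ((k.val - 1 : ℕ) : ZMod N) := by
    rw [Nat.cast_sub hpos, ZMod.natCast_zmod_val, Nat.cast_one]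
  have h0 := sum_omegaPow_mul_prod x t (k.val - 1) fun l hl => h l (by omega)
  simp only [add_sub_assoc, hk', hf.div_add, mul_div_assoc']
  rw [← Finset.sum_div, h0, zero_div]

/-- The convolution inverse of a cyclic dilogarithm, up to a twist. -/
theorem sum_omegaPow_mul_div (hf : IsDilog x y f) (k : ZMod N) :
    ∑ m : ZMod N, omegaPow N m * (f m / f (m + k - 1)) =
      if k = 0 then N * y * x ^ (N - 1) / (1 - x ^ N) else 0 := by
  split_ifs with hk
  · subst hk
    rw [← hf.sum_div_pred (N - 1) (Nat.sub_lt (NeZero.pos N) one_pos)]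
    refine Finset.sum_congr rfl fun m _ => ?_
    rw [Nat.cast_sub (NeZero.one_le), ZMod.natCast_self]
    simp
  · have := hf.sum_mul_div_eq_zero 1 k hk fun l hl h0 => by
      have h1 : ((l + 1 : ℕ) : ZMod N) = 0 := by push_cast; rw [add_comm]; exact h0
      rw [ZMod.natCast_eq_zero_iff] at h1
      have := Nat.le_of_dvd (by omega) h1
      have := ZMod.val_lt k
      have h2 : l + 1 = N := by omega
      omega
    simpa using this

theorem sum_omegaPow_neg_mul_div (hf : IsDilog x y f) (k : ZMod N) :
    ∑ m : ZMod N, omegaPow N (-k * m) * (f m / f (m + k - 1)) =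
      if k = 0 then N * y / (1 - x ^ N) else 0 := by
  split_ifs with hk
  · subst hk
    have h := hf.sum_div_pred 0 (NeZero.pos N)
    simpa using h
  · refine hf.sum_mul_div_eq_zero (-k) k hk fun l hl h0 => ?_
    have h1 : k = (l : ZMod N) := by linear_combination -h0
    have h2 : k.val = l := by
      rw [h1, ZMod.val_natCast, Nat.mod_eq_of_lt (hl.trans (ZMod.val_lt k))]
    omega

end IsDilog

/-- Natural numbers below `N` as residues modulo `N`. -/
def finZMod (N : ℕ) [NeZero N] : Fin N ≃ ZMod N where
  toFun i := (i.val : ZMod N)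
  invFun n := ⟨n.val, ZMod.val_lt n⟩
  left_inv i := Fin.ext (by simp [ZMod.val_natCast, Nat.mod_eq_of_lt i.2])
  right_inv n := by simp

theorem prod_zmod_eq (g : ZMod N → ℂ) : ∏ n : ZMod N, g n = ∏ i : Fin N, g (i.val : ZMod N) :=
  (Fintype.prod_equiv (finZMod N) _ _ fun _ => rfl).symm

theorem prod_range_prod_range (g : ℕ → ℂ) (n : ℕ) :
    ∏ b ∈ Finset.range n, ∏ l ∈ Finset.range b, g l =
      ∏ l ∈ Finset.range n, g l ^ (n - 1 - l) := by
  induction n with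
  | zero => simp
  | succ n ih =>
    rw [Finset.prod_range_succ, ih, Finset.prod_range_succ, ← Finset.prod_mul_distrib]
    simp only [Nat.add_sub_cancel, Nat.sub_self, pow_zero, mul_one]
    refine Finset.prod_congr rfl fun l hl => ?_
    rw [Finset.mem_range] at hl
    rw [← pow_succ, show n - 1 - l + 1 = n - l by omega]

/-- The `N`-th power of `gFun`. -/
noncomputable def gPow (N : ℕ) [NeZero N] (x : ℂ) : ℂ :=
  ∏ j ∈ Finset.range N, (1 - x * omegaPow N (-(j : ZMod N))) ^ j

theorem prod_prod_factor (x : ℂ) :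
    ∏ b ∈ Finset.range N, ∏ l ∈ Finset.range b, (1 - x * omegaPow N (1 + (l : ZMod N))) =
      gPow N x := by
  rw [prod_range_prod_range, gPow, ← Finset.prod_range_reflect]
  refine Finset.prod_congr rfl fun j hj => ?_
  rw [Finset.mem_range] at hj
  have h : (1 : ZMod N) + ((N - 1 - j : ℕ) : ZMod N) = -j := by
    rw [Nat.cast_sub (by omega), Nat.cast_sub (by omega), ZMod.natCast_self]
    push_cast
    ring
  rw [h, show N - 1 - (N - 1 - j) = j by omega]

theorem gFun_pow (x : ℂ) : gFun N x ^ N = gPow N x := by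
  rw [gFun, gPow, ← Finset.prod_pow]
  have h : Finset.range N = insert 0 (Finset.Icc 1 (N - 1)) := by
    have := NeZero.pos N
    ext j
    simp only [Finset.mem_range, Finset.mem_insert, Finset.mem_Icc]
    omega
  rw [h, Finset.prod_insert (by simp)]
  simp only [pow_zero, one_mul]
  refine Finset.prod_congr rfl fun j hj => ?_
  rw [← Complex.cpow_nat_mul, mul_div_cancel₀ _ (NeZero.ne (N : ℂ)), Complex.cpow_natCast]

theorem gPow_one_ne_zero : gPow N 1 ≠ 0 := by
  refine Finset.prod_ne_zero_iff.2 fun j hj => ?_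
  rw [Finset.mem_range] at hj
  rcases Nat.eq_zero_or_pos j with rfl | hpos
  · simp
  · refine pow_ne_zero _ fun h => ?_
    rw [one_mul, sub_eq_zero, ← omegaPow_zero (N := N)] at h
    have h2 := omegaPow_injective h
    rw [eq_comm, neg_eq_zero, ZMod.natCast_eq_zero_iff] at h2
    exact absurd (Nat.le_of_dvd hpos h2) (by omega)

theorem IsDilog.gPow_ne_zero {x y : ℂ} {f : ZMod N → ℂ} (hf : IsDilog x y f) :
    gPow N x ≠ 0 :=
  Finset.prod_ne_zero_iff.2 fun _ _ => pow_ne_zero _ (hf.factor_ne_zero _)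

theorem IsDilog.prod_mul_gPow {x y : ℂ} {f : ZMod N → ℂ} (hf : IsDilog x y f) :
    (∏ n, f n) * gPow N x = f 0 ^ N * y ^ (N * (N - 1) / 2) := by
  rw [prod_zmod_eq, ← prod_pow_val, ← prod_prod_factor x,
    ← Fin.prod_univ_eq_prod_range
      (fun b => ∏ l ∈ Finset.range b, (1 - x * omegaPow N (1 + (l : ZMod N)))),
    ← Finset.prod_mul_distrib]
  have h : ∀ i : Fin N, f (i.val : ZMod N) *
      ∏ l ∈ Finset.range i, (1 - x * omegaPow N (1 + (l : ZMod N))) = f 0 * y ^ (i : ℕ) := by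
    intro i
    have := hf.ratio 0 i
    simp only [zero_add] at this
    exact this.symm
  rw [Finset.prod_congr rfl fun i _ => h i, Finset.prod_mul_distrib, Finset.prod_const,
    Finset.card_univ, Fintype.card_fin]

theorem det_zmod (F : ZMod N → ZMod N → ℂ) :
    (Matrix.of F).det = (Matrix.of fun b e : Fin N => F (b.val : ZMod N) (e.val : ZMod N)).det := by
  rw [← Matrix.det_submatrix_equiv_self (finZMod N) (Matrix.of F)]
  rfl

/-- The value of the determinant of the circulant matrix of a dilogarithm, apart from the
factors which depend on the dilogarithm. -/
noncomputable def circulantConst (N : ℕ) [NeZero N] : ℂ :=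
  (∏ e : Fin N, ∏ l ∈ Finset.range e, (-omegaPow N (1 - ((e.val : ℕ) : ZMod N) + (l : ZMod N)))) *
    (Matrix.vandermonde fun b : Fin N => omegaPow N (b.val : ZMod N)).det

theorem circulantConst_ne_zero : circulantConst N ≠ 0 := by
  refine mul_ne_zero ?_ ?_
  · exact Finset.prod_ne_zero_iff.2 fun e _ => Finset.prod_ne_zero_iff.2 fun l _ =>
      neg_ne_zero.2 (omegaPow_ne_zero _)
  · rw [Matrix.det_vandermonde_ne_zero_iff]
    exact omegaPow_injective.comp (finZMod N).injective

theorem IsDilog.det_circulant {x y : ℂ} {f : ZMod N → ℂ} (hf : IsDilog x y f) (hx : x ≠ 0) :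
    (Matrix.of fun b e : ZMod N => f (b - e)).det * y ^ (N * (N - 1) / 2) =
      (∏ n, f n) * x ^ (N * (N - 1) / 2) * circulantConst N := by
  rw [det_zmod, prod_zmod_eq, ← prod_pow_val, ← prod_pow_val, mul_comm,
    ← Matrix.det_mul_row (fun e : Fin N => y ^ (e : ℕ))]
  have h : (Matrix.of fun b e : Fin N => y ^ (e : ℕ) *
      (Matrix.of fun b e : Fin N => f ((b.val : ZMod N) - (e.val : ZMod N))) b e) =
      Matrix.of fun b e : Fin N => f (b.val : ZMod N) *
        ((x ^ (e : ℕ) *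
          ∏ l ∈ Finset.range e, (-omegaPow N (1 - ((e.val : ℕ) : ZMod N) + (l : ZMod N)))) *
        (Matrix.of fun b e : Fin N => ∏ l ∈ Finset.range e,
          (omegaPow N (b.val : ZMod N) -
            x⁻¹ * omegaPow N (-(1 - ((e.val : ℕ) : ZMod N) + (l : ZMod N))))) b e) := by
    ext b e
    simp only [Matrix.of_apply]
    have h1 := hf.ratio ((b.val : ZMod N) - (e.val : ZMod N)) e
    rw [sub_add_cancel] at h1
    rw [mul_comm, h1, ← Finset.card_range (e : ℕ), ← Finset.prod_const, Finset.card_range,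
      ← Finset.prod_mul_distrib, ← Finset.prod_mul_distrib]
    congr 1
    refine Finset.prod_congr rfl fun l _ => ?_
    have h2 : omegaPow N ((b.val : ZMod N) - (e.val : ZMod N) + 1 + l) =
        omegaPow N (b.val : ZMod N) * omegaPow N (1 - ((e.val : ℕ) : ZMod N) + (l : ZMod N)) := by
      rw [← omegaPow_add]; congr 1; ring
    have h3 := omegaPow_mul_neg (1 - ((e.val : ℕ) : ZMod N) + (l : ZMod N))
    rw [h2]
    have h4 : x * x⁻¹ = 1 := mul_inv_cancel₀ hx
    linear_combination (-1 : ℂ) * h3 - omegaPow N (1 - ((e.val : ℕ) : ZMod N) + (l : ZMod N)) *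
      omegaPow N (-(1 - ((e.val : ℕ) : ZMod N) + (l : ZMod N))) * h4
  rw [h, det_mul_row_column, det_prod_range_sub _
    (fun e l => x⁻¹ * omegaPow N (-(1 - (e : ZMod N) + (l : ZMod N)))), Finset.prod_mul_distrib,
    circulantConst]
  ring

theorem prod_mul_det_vandermonde :
    (∏ n : ZMod N, omegaPow N (n * n)) *
      (Matrix.vandermonde fun b : Fin N => omegaPow N (-(b.val : ZMod N))).det = gPow N 1 := by
  rw [prod_zmod_eq, Matrix.det_vandermonde,
    Finset.prod_comm' (t' := Finset.univ) (s' := fun j : Fin N => Finset.Iio j) (by simp),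
    ← Finset.prod_mul_distrib, ← prod_prod_factor, ← Fin.prod_univ_eq_prod_range
      (fun b => ∏ l ∈ Finset.range b, (1 - 1 * omegaPow N (1 + (l : ZMod N))))]
  refine Finset.prod_congr rfl fun j _ => ?_
  have h1 : ∀ i ∈ Finset.Iio j, omegaPow N (-(j.val : ZMod N)) - omegaPow N (-(i.val : ZMod N)) =
      omegaPow N (-(j.val : ZMod N)) *
        (fun l : ℕ => 1 - omegaPow N ((j.val : ZMod N) - (l : ZMod N))) i.val := by
    intro i _
    have : omegaPow N (-(i.val : ZMod N)) =
        omegaPow N (-(j.val : ZMod N)) * omegaPow N ((j.val : ZMod N) - i.val) := by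
      rw [← omegaPow_add]; congr 1; ring
    rw [this]; ring
  rw [Finset.prod_congr rfl h1, Finset.prod_mul_distrib, Finset.prod_const, Fin.card_Iio,
    ← omegaPow_nsmul, ← mul_assoc, ← omegaPow_add, mul_neg, add_neg_cancel, omegaPow_zero, one_mul]
  have h2 := Finset.prod_map (Finset.Iio j) Fin.valEmbedding
    (fun l : ℕ => 1 - omegaPow N ((j.val : ZMod N) - (l : ZMod N)))
  rw [Fin.map_valEmbedding_Iio, Nat.Iio_eq_range] at h2
  refine h2.symm.trans ?_
  rw [← Finset.prod_range_reflect]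
  refine Finset.prod_congr rfl fun l hl => ?_
  rw [Finset.mem_range] at hl
  rw [one_mul]
  congr 2
  rw [Nat.cast_sub (by omega), Nat.cast_sub (by omega)]
  push_cast
  ring

theorem IsDilog.det_gauss {x y : ℂ} {f : ZMod N → ℂ} (hf : IsDilog x y f) :
    (Matrix.of fun n e : ZMod N => omegaPow N (n * (n - e)) * f (n - e)).det *
      y ^ (N * (N - 1) / 2) = (∏ n, f n) * gPow N 1 := by
  rw [det_zmod, ← prod_mul_det_vandermonde, ← mul_assoc, ← Finset.prod_mul_distrib,
    prod_zmod_eq, ← prod_pow_val, mul_comm, ← Matrix.det_mul_row (fun e : Fin N => y ^ (e : ℕ))]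
  have h : (Matrix.of fun b e : Fin N => y ^ (e : ℕ) *
      (Matrix.of fun b e : Fin N => omegaPow N ((b.val : ZMod N) * (b.val - e.val)) *
        f ((b.val : ZMod N) - (e.val : ZMod N))) b e) =
      Matrix.of fun b e : Fin N =>
        (f (b.val : ZMod N) * omegaPow N ((b.val : ZMod N) * b.val)) *
        (1 * (Matrix.of fun b e : Fin N => ∏ l ∈ Finset.range e,
          (omegaPow N (-(b.val : ZMod N)) -
            x * omegaPow N (1 - ((e.val : ℕ) : ZMod N) + (l : ZMod N)))) b e) := by
    ext b e
    simp only [Matrix.of_apply]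
    have h1 := hf.ratio ((b.val : ZMod N) - (e.val : ZMod N)) e
    rw [sub_add_cancel] at h1
    have h0 : omegaPow N ((b.val : ZMod N) * (b.val - e.val)) =
        omegaPow N ((b.val : ZMod N) * b.val) * ∏ l ∈ Finset.range e,
          omegaPow N (-(b.val : ZMod N)) := by
      rw [Finset.prod_const, Finset.card_range, ← omegaPow_nsmul, ← omegaPow_add]
      congr 1; ring
    rw [mul_comm, mul_assoc, h1, h0, one_mul]
    have h5 : ∀ A B C D : ℂ, A * B * (C * D) = C * A * (B * D) := by intros; ring
    rw [h5, ← Finset.prod_mul_distrib]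
    congr 1
    refine Finset.prod_congr rfl fun l _ => ?_
    have h2 : omegaPow N ((b.val : ZMod N) - (e.val : ZMod N) + 1 + l) =
        omegaPow N (b.val : ZMod N) * omegaPow N (1 - ((e.val : ℕ) : ZMod N) + (l : ZMod N)) := by
      rw [← omegaPow_add]; congr 1; ring
    have h3 := omegaPow_mul_neg (b.val : ZMod N)
    rw [h2]
    linear_combination -x * omegaPow N (1 - ((e.val : ℕ) : ZMod N) + (l : ZMod N)) * h3
  rw [h, det_mul_row_column, det_prod_range_sub _
    (fun e l => x * omegaPow N (1 - (e : ZMod N) + (l : ZMod N)))]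
  simp

end Determinants

section Pentagon

variable {N : ℕ} [NeZero N]

/-- The sum over the common state of the three tetrahedra on one side of the pentagon relation. -/
noncomputable def pentagonSum (f₀ f₂ f₄ : ZMod N → ℂ) (b e : ZMod N) : ℂ :=
  ∑ n : ZMod N, omegaPow N (n * (n + e)) * f₀ (n + e) * f₂ (b - n) * f₄ n

/-- The relations between the parameters of the five dilogarithms in the pentagon relation. -/
structure PentagonParams (x y : Fin 5 → ℂ) : Prop where
  rel₁ : y 2 * x 0 * x 4 = y 0 * y 4
  rel₂ : y 0 = y 1 * x 4
  rel₃ : y 4 = y 3 * x 0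
  rel₄ : x 2 * y 4 * y 1 = y 2 * x 1
  rel₅ : x 2 * y 0 * y 4 = y 2 * x 3 * x 0

variable {x y : Fin 5 → ℂ} {f : Fin 5 → ZMod N → ℂ}

theorem pentagonSum_contiguous (hf : ∀ i, IsDilog (x i) (y i) (f i)) (h : PentagonParams x y)
    (b e : ZMod N) :
    y 2 * omegaPow N (-e) * ∑ n : ZMod N,
        omegaPow N (n * (n + e)) * f 0 (n + e) * f 2 (b - n) * f 4 n * omegaPow N (-n) =
      (y 2 * x 0 + y 2 * x 4 * omegaPow N (-e) - y 0 * y 4 * x 2 * omegaPow N b) *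
        pentagonSum (f 0) (f 2) (f 4) b e := by
  set T : ZMod N → ℂ := fun n => omegaPow N (n * (n + e)) * f 0 (n + e) * f 2 (b - n) * f 4 n
    with hT
  have hstep : ∀ n, y 0 * y 4 * (T (n - 1) * (1 - x 2 * omegaPow N (b - (n - 1)))) *
      omegaPow N (n - 1) =
      y 2 * T n * omegaPow N (-n - e) * (1 - x 0 * omegaPow N (n + e)) *
        (1 - x 4 * omegaPow N n) := by
    intro n
    have h0 := (hf 0).step (n + e)
    have h4 := (hf 4).step n
    have h2 := (hf 2).step (b - (n - 1))
    rw [show b - (n - 1) - 1 = b - n by ring] at h2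
    simp only [hT, show n - 1 + e = n + e - 1 by ring]
    have hω : omegaPow N ((n - 1) * (n + e - 1)) * omegaPow N (n - 1) =
        omegaPow N (n * (n + e)) * omegaPow N (-n - e) := by
      rw [← omegaPow_add, ← omegaPow_add]; congr 1; ring
    calc _ = (omegaPow N ((n - 1) * (n + e - 1)) * omegaPow N (n - 1)) *
          (y 0 * f 0 (n + e - 1)) * (y 4 * f 4 (n - 1)) *
          (f 2 (b - (n - 1)) * (1 - x 2 * omegaPow N (b - (n - 1)))) := by ring
      _ = _ := by rw [hω, h2, ← h0, ← h4]; ring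
  have hshift : ∑ n, y 0 * y 4 * (T n * (1 - x 2 * omegaPow N (b - n))) * omegaPow N n =
      ∑ n, y 2 * T n * omegaPow N (-n - e) * (1 - x 0 * omegaPow N (n + e)) *
        (1 - x 4 * omegaPow N n) := by
    rw [← Finset.sum_congr rfl fun n _ => hstep n]
    exact (Fintype.sum_equiv (Equiv.subRight (1 : ZMod N)) _ _ fun n => rfl).symm
  have hl : ∀ n, y 0 * y 4 * (T n * (1 - x 2 * omegaPow N (b - n))) * omegaPow N n =
      y 0 * y 4 * (T n * omegaPow N n) - y 0 * y 4 * x 2 * omegaPow N b * T n := by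
    intro n
    have h1 : omegaPow N b = omegaPow N (b - n) * omegaPow N n := by
      rw [← omegaPow_add]; congr 1; ring
    rw [h1]; ring
  have hr : ∀ n, y 2 * T n * omegaPow N (-n - e) * (1 - x 0 * omegaPow N (n + e)) *
        (1 - x 4 * omegaPow N n) =
      y 2 * omegaPow N (-e) * (T n * omegaPow N (-n)) -
        (y 2 * x 0 + y 2 * x 4 * omegaPow N (-e)) * T n + y 0 * y 4 * (T n * omegaPow N n) := by
    intro n
    have h1 : omegaPow N (n + e) = omegaPow N n * omegaPow N e := omegaPow_add _ _
    have h2 : omegaPow N (-n - e) = omegaPow N (-n) * omegaPow N (-e) := by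
      rw [← omegaPow_add, sub_eq_add_neg]
    have h3 := omegaPow_mul_neg n
    have h4 := omegaPow_mul_neg e
    have hrel := h.rel₁
    rw [h1, h2, ← hrel]
    linear_combination (T n * (- y 2 * x 4 * omegaPow N (-e)
      - y 2 * x 0 * omegaPow N e * omegaPow N (-e)
      + y 2 * x 0 * x 4 * omegaPow N n * (omegaPow N e * omegaPow N (-e)))) * h3
      + (T n * (- y 2 * x 0 + y 2 * x 0 * x 4 * omegaPow N n)) * h4
  simp only [hl, hr, Finset.sum_add_distrib, Finset.sum_sub_distrib, ← Finset.mul_sum] at hshift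
  have hF : pentagonSum (f 0) (f 2) (f 4) b e = ∑ n, T n := rfl
  rw [hF]
  linear_combination -hshift

theorem pentagonSum_sub_one (hf : ∀ i, IsDilog (x i) (y i) (f i)) (h : PentagonParams x y)
    (b e : ZMod N) :
    y 1 * pentagonSum (f 0) (f 2) (f 4) b (e - 1) =
      (1 - x 1 * omegaPow N (b + e)) * pentagonSum (f 0) (f 2) (f 4) b e := by
  have hc := pentagonSum_contiguous hf h b e
  set S := ∑ n : ZMod N,
    omegaPow N (n * (n + e)) * f 0 (n + e) * f 2 (b - n) * f 4 n * omegaPow N (-n) with hS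
  have h1 : y 0 * pentagonSum (f 0) (f 2) (f 4) b (e - 1) =
      S - x 0 * omegaPow N e * pentagonSum (f 0) (f 2) (f 4) b e := by
    rw [hS, pentagonSum, pentagonSum, Finset.mul_sum, Finset.mul_sum, ← Finset.sum_sub_distrib]
    refine Finset.sum_congr rfl fun n _ => ?_
    have h0 := (hf 0).step (n + e)
    have e1 : omegaPow N (n * (n + (e - 1))) = omegaPow N (n * (n + e)) * omegaPow N (-n) := by
      rw [← omegaPow_add]; congr 1; ring
    have e2 : omegaPow N (n + e) = omegaPow N n * omegaPow N e := omegaPow_add _ _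
    have e3 := omegaPow_mul_neg n
    rw [e1, show n + (e - 1) = n + e - 1 by ring]
    rw [e2] at h0
    linear_combination (-omegaPow N (n * (n + e)) * omegaPow N (-n) * f 2 (b - n) * f 4 n) * h0 -
      (x 0 * omegaPow N (n * (n + e)) * f 0 (n + e) * f 2 (b - n) * f 4 n * omegaPow N e) * e3
  have h2 : omegaPow N (b + e) = omegaPow N b * omegaPow N e := omegaPow_add _ _
  have h3 := omegaPow_mul_neg e
  have hy : y 0 * y 2 ≠ 0 := mul_ne_zero (hf 0).param_ne_zero (hf 2).param_ne_zero
  refine mul_left_cancel₀ hy ?_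
  rw [h2]
  have r2 := h.rel₂
  have r4 := h.rel₄
  set F := pentagonSum (f 0) (f 2) (f 4) b e
  linear_combination (y 1 * y 2) * h1 + y 1 * omegaPow N e * hc -
    y 1 * (y 2 * S - y 2 * x 4 * F) * h3 - y 2 * F * r2 -
    y 0 * omegaPow N b * omegaPow N e * F * r4

theorem pentagonSum_sub_one_add_one (hf : ∀ i, IsDilog (x i) (y i) (f i))
    (h : PentagonParams x y) (b e : ZMod N) :
    y 3 * pentagonSum (f 0) (f 2) (f 4) (b - 1) (e + 1) =
      (1 - x 3 * omegaPow N b) * pentagonSum (f 0) (f 2) (f 4) b e := by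
  have hc := pentagonSum_contiguous hf h b e
  set S := ∑ n : ZMod N,
    omegaPow N (n * (n + e)) * f 0 (n + e) * f 2 (b - n) * f 4 n * omegaPow N (-n) with hS
  have h1 : y 4 * pentagonSum (f 0) (f 2) (f 4) (b - 1) (e + 1) =
      omegaPow N (-e) * S - x 4 * omegaPow N (-e) * pentagonSum (f 0) (f 2) (f 4) b e := by
    rw [hS, pentagonSum, pentagonSum, Finset.mul_sum, Finset.mul_sum, Finset.mul_sum,
      ← Finset.sum_sub_distrib]
    rw [← Fintype.sum_equiv (Equiv.subRight (1 : ZMod N)) (fun n => _) _ fun n => rfl]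
    refine Finset.sum_congr rfl fun n _ => ?_
    have h0 := (hf 4).step n
    have e1 : omegaPow N ((n - 1) * (n - 1 + (e + 1))) =
        omegaPow N (n * (n + e)) * (omegaPow N (-n) * omegaPow N (-e)) := by
      rw [← omegaPow_add, ← omegaPow_add]; congr 1; ring
    have e3 := omegaPow_mul_neg n
    simp only [Equiv.subRight_apply]
    rw [e1, show n - 1 + (e + 1) = n + e by ring, show b - 1 - (n - 1) = b - n by ring]
    linear_combination (-omegaPow N (n * (n + e)) * omegaPow N (-n) * omegaPow N (-e) *
      f 0 (n + e) * f 2 (b - n)) * h0 -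
      (x 4 * omegaPow N (n * (n + e)) * f 0 (n + e) * f 2 (b - n) * f 4 n * omegaPow N (-e)) * e3
  have hy : y 4 * y 2 ≠ 0 := mul_ne_zero (hf 4).param_ne_zero (hf 2).param_ne_zero
  refine mul_left_cancel₀ hy ?_
  have r3 := h.rel₃
  have r5 := h.rel₅
  set F := pentagonSum (f 0) (f 2) (f 4) b e
  linear_combination (y 3 * y 2) * h1 + y 3 * hc - y 2 * F * r3 + y 2 * x 3 * omegaPow N b * F * r3
    - y 3 * omegaPow N b * F * r5

/-- The pentagon relation for cyclic dilogarithms, with the `N`-th power of its constant. -/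
theorem exists_pentagon (hf : ∀ i, IsDilog (x i) (y i) (f i)) (hx : ∀ i, x i ≠ 0)
    (h : PentagonParams x y) :
    ∃ κ : ℂ, κ ≠ 0 ∧
      (∀ b e, pentagonSum (f 0) (f 2) (f 4) b e = κ * (f 1 (b + e) * f 3 b)) ∧
      κ ^ N * ((∏ n, f 3 n) * (∏ n, f 1 n) * (x 1 * y 2 * y 0) ^ (N * (N - 1) / 2)) =
        (∏ n, f 2 n) * (∏ n, f 4 n) * (∏ n, f 0 n) * (x 2 * y 1) ^ (N * (N - 1) / 2) *
          gPow N 1 := by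
  set F := pentagonSum (f 0) (f 2) (f 4) with hF
  set q : ZMod N → ZMod N → ℂ := fun b e => F b e / (f 1 (b + e) * f 3 b) with hq
  have hL : ∀ b e, f 1 (b + e) * f 3 b ≠ 0 := fun b e =>
    mul_ne_zero ((hf 1).ne_zero _) ((hf 3).ne_zero _)
  have hy1 := (hf 1).param_ne_zero
  have hy3 := (hf 3).param_ne_zero
  have q1 : ∀ b e, q b (e - 1) = q b e := by
    intro b e
    rw [hq]
    simp only
    rw [div_eq_div_iff (hL _ _) (hL _ _)]
    have s := (hf 1).step (b + e)
    have p := pentagonSum_sub_one hf h b e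
    refine mul_left_cancel₀ hy1 ?_
    rw [show b + (e - 1) = b + e - 1 by ring]
    linear_combination f 1 (b + e) * f 3 b * p + F b e * f 3 b * s
  have q2 : ∀ b e, q (b - 1) (e + 1) = q b e := by
    intro b e
    rw [hq]
    simp only
    rw [div_eq_div_iff (hL _ _) (hL _ _)]
    have s := (hf 3).step b
    have p := pentagonSum_sub_one_add_one hf h b e
    refine mul_left_cancel₀ hy3 ?_
    rw [show b - 1 + (e + 1) = b + e by ring]
    linear_combination f 1 (b + e) * f 3 b * p + F b e * f 1 (b + e) * s
  have q3 : ∀ b e, q b e = q 0 0 := by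
    intro b e
    rw [eq_apply_zero_of_sub_one (fun e => q b e) (fun e => q1 b e) e]
    refine eq_apply_zero_of_sub_one (fun b => q b 0) (fun b => ?_) b
    have := q2 b (-1)
    rw [neg_add_cancel] at this
    rw [this, ← zero_sub, q1]
  have hκ : ∀ b e, F b e = q 0 0 * (f 1 (b + e) * f 3 b) := by
    intro b e
    rw [← q3 b e, hq]
    simp only
    rw [div_mul_cancel₀ _ (hL _ _)]
  have hmat : (Matrix.of fun b n : ZMod N => f 2 (b - n)) *
      (Matrix.diagonal (f 4) *
        (Matrix.of fun n e : ZMod N => omegaPow N (n * (n - e)) * f 0 (n - e))) =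
      q 0 0 • (Matrix.diagonal (f 3) * (Matrix.of fun b e : ZMod N => f 1 (b - e))) := by
    ext b e
    rw [Matrix.smul_apply, Matrix.diagonal_mul, Matrix.mul_apply]
    simp only [Matrix.diagonal_mul, Matrix.of_apply, smul_eq_mul]
    have := hκ b (-e)
    rw [hF, pentagonSum] at this
    simp only [← sub_eq_add_neg] at this
    rw [mul_comm (f 3 b), ← this]
    exact Finset.sum_congr rfl fun n _ => by ring
  have hdet := congrArg Matrix.det hmat
  rw [Matrix.det_smul, Matrix.det_mul, Matrix.det_mul, Matrix.det_mul, Matrix.det_diagonal,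
    Matrix.det_diagonal, ZMod.card] at hdet
  have d1 := (hf 1).det_circulant (hx 1)
  have d2 := (hf 2).det_circulant (hx 2)
  have d0 := (hf 0).det_gauss
  have hfin : q 0 0 ^ N * ((∏ n, f 3 n) * (∏ n, f 1 n) *
      (x 1 * y 2 * y 0) ^ (N * (N - 1) / 2)) =
        (∏ n, f 2 n) * (∏ n, f 4 n) * (∏ n, f 0 n) * (x 2 * y 1) ^ (N * (N - 1) / 2) *
          gPow N 1 := by
    refine mul_right_cancel₀ (circulantConst_ne_zero (N := N)) ?_
    simp only [mul_pow]
    set P := N * (N - 1) / 2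
    calc _ = q 0 0 ^ N * (∏ n, f 3 n) * ((∏ n, f 1 n) * x 1 ^ P * circulantConst N) *
          y 2 ^ P * y 0 ^ P := by ring
      _ = (q 0 0 ^ N * ((∏ n, f 3 n) * (Matrix.of fun b e : ZMod N => f 1 (b - e)).det)) *
          y 1 ^ P * y 2 ^ P * y 0 ^ P := by rw [← d1]; ring
      _ = ((Matrix.of fun b e : ZMod N => f 2 (b - e)).det * y 2 ^ P) * (∏ n, f 4 n) *
          ((Matrix.of fun n e : ZMod N => omegaPow N (n * (n - e)) * f 0 (n - e)).det * y 0 ^ P) *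
          y 1 ^ P := by rw [← hdet]; ring
      _ = _ := by rw [d2, d0]; ring
  refine ⟨q 0 0, ?_, hκ, hfin⟩
  intro h0
  rw [h0, zero_pow (NeZero.ne N), zero_mul] at hfin
  have hp : ∀ i, ∏ n, f i n ≠ 0 := fun i => Finset.prod_ne_zero_iff.2 fun n _ => (hf i).ne_zero n
  exact mul_ne_zero (mul_ne_zero (mul_ne_zero (mul_ne_zero (hp 2) (hp 4)) (hp 0))
    (pow_ne_zero _ (mul_ne_zero (hx 2) hy1))) gPow_one_ne_zero hfin.symm

end Pentagon

section Symbol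

variable {N : ℕ} [NeZero N]

theorem prod_Icc_sub_mul_omegaPow (X Z : ℂ) :
    ∏ j ∈ Finset.Icc 1 N, (Z - X * omegaPow N (j : ZMod N)) = Z ^ N - X ^ N := by
  rw [← prod_sub_mul_omegaPow, ← Fintype.prod_equiv (Equiv.addRight (1 : ZMod N))
    (fun m => Z - X * omegaPow N (m + 1)) _ fun m => rfl, prod_zmod_eq,
    Fin.prod_univ_eq_prod_range (fun i => Z - X * omegaPow N ((i : ZMod N) + 1)),
    Finset.range_eq_Ico, ← Finset.Ico_add_one_right_eq_Icc]
  rw [Finset.prod_Ico_eq_prod_range, Finset.prod_Ico_eq_prod_range]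
  refine Finset.prod_congr (by simp) fun j _ => ?_
  push_cast
  rw [add_comm (1 : ZMod N), zero_add]

theorem isDilog_omegaFun {X Y Z : ℂ} (h : X ^ N + Y ^ N = Z ^ N) (hY : Y ≠ 0) (hZ : Z ≠ 0) :
    IsDilog (X / Z) (Y / Z) (omegaFun N X Y Z) := by
  have hfac : ∀ n : ZMod N, Z - X * omegaPow N n ≠ 0 := by
    have h1 := prod_sub_mul_omegaPow (N := N) X Z
    have h2 : Z ^ N - X ^ N ≠ 0 := by
      rw [← h, add_sub_cancel_left]
      exact pow_ne_zero _ hY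
    rw [← h1] at h2
    exact fun n => Finset.prod_ne_zero_iff.1 h2 n (Finset.mem_univ n)
  refine ⟨fun n => ?_, div_ne_zero hY hZ, fun n => ?_⟩
  · exact Finset.prod_ne_zero_iff.2 fun j _ => div_ne_zero hY (hfac _)
  · have hfac' : 1 - X / Z * omegaPow N n = (Z - X * omegaPow N n) / Z := by
      field_simp
    have key : omegaFun N X Y Z n * (Z - X * omegaPow N n) = Y * omegaFun N X Y Z (n - 1) := by
      rcases eq_or_ne n 0 with rfl | hn
      · have hval : (0 - 1 : ZMod N).val = N - 1 := by
          rw [zero_sub]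
          obtain ⟨k, hk⟩ : ∃ k, N = k + 1 := ⟨N - 1, (Nat.sub_add_cancel (NeZero.one_le)).symm⟩
          subst hk
          exact ZMod.val_neg_one k
        have h1 : ∏ j ∈ Finset.Icc 1 N, (Y / (Z - X * omegaPow N (j : ZMod N))) = 1 := by
          rw [Finset.prod_div_distrib, prod_Icc_sub_mul_omegaPow, Finset.prod_const,
            Nat.card_Icc, Nat.add_sub_cancel, ← h, add_sub_cancel_left]
          exact div_self (pow_ne_zero _ hY)
        have h2 : Finset.Icc 1 N = Finset.Icc 1 (N - 1 + 1) := by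
          rw [Nat.sub_add_cancel (NeZero.one_le)]
        rw [h2, Finset.prod_Icc_succ_top (by omega), Nat.sub_add_cancel (NeZero.one_le),
          ZMod.natCast_self] at h1
        simp only [omegaFun, hval, ZMod.val_zero]
        rw [← mul_div_assoc, div_eq_one_iff_eq (hfac 0)] at h1
        rw [← h1]
        simp [mul_comm]
      · have hpos : 0 < n.val := Nat.pos_of_ne_zero fun h0 => hn ((ZMod.val_eq_zero n).1 h0)
        have hval : n.val = (n - 1).val + 1 := by
          have h1 : n - 1 = ((n.val - 1 : ℕ) : ZMod N) := by
            rw [Nat.cast_sub hpos, ZMod.natCast_zmod_val, Nat.cast_one]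
          have := ZMod.val_lt n
          rw [h1, ZMod.val_natCast, Nat.mod_eq_of_lt (by omega)]
          omega
        have hc : (((n - 1).val + 1 : ℕ) : ZMod N) = n := by
          rw [← hval, ZMod.natCast_zmod_val]
        unfold omegaFun
        rw [hval, Finset.prod_Icc_succ_top (by omega), hc, mul_assoc, div_mul_cancel₀ _ (hfac n),
          mul_comm]
    rw [hfac', mul_div_assoc', key]
    ring

theorem omegaFun_zero (X Y Z : ℂ) : omegaFun N X Y Z 0 = 1 := by simp [omegaFun]

theorem IsDilog.mul_apply_zero {x y : ℂ} {f g : ZMod N → ℂ} (hf : IsDilog x y f)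
    (hg : IsDilog x y g) (n : ZMod N) : f n * g 0 = g n * f 0 := by
  have h := eq_apply_zero_of_sub_one (fun n => f n / g n) (fun n => by
    rw [div_eq_div_iff (hg.ne_zero _) (hg.ne_zero _)]
    refine mul_left_cancel₀ hf.param_ne_zero ?_
    have h1 := hf.step n
    have h2 := hg.step n
    linear_combination g n * (-h1) + f n * h2) n
  rw [div_eq_div_iff (hg.ne_zero _) (hg.ne_zero _)] at h
  rw [h, mul_comm]

theorem omegaFun_mul_omegaPow {X Y Z : ℂ} (h : X ^ N + Y ^ N = Z ^ N) (hY : Y ≠ 0) (hZ : Z ≠ 0)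
    (n : ZMod N) :
    omegaFun N (X * omegaPow N (-1)) Y Z n * omegaFun N X Y Z (-1) = omegaFun N X Y Z (n - 1) := by
  have h1 := (isDilog_omegaFun h hY hZ).twist 1 one_ne_zero 1 0
  have h' : (X * omegaPow N (-1)) ^ N + Y ^ N = Z ^ N := by
    rw [mul_pow, omegaPow_pow_card, mul_one, h]
  have h2 := isDilog_omegaFun h' hY hZ
  rw [omegaPow_zero, mul_one, div_mul_eq_mul_div] at h1
  have := h2.mul_apply_zero h1 n
  simpa [omegaPow_zero, omegaFun_zero] using this

/-- The dilogarithm of a tetrahedron of index `1` with charges `a` and `c`. -/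
noncomputable def chargedDilog (X Y Z : ℂ) (a c n : ZMod N) : ℂ :=
  omegaPow N (-(a * c * half N)) * omegaPow N (c * n) * omegaFun N X Y Z (n - a)

/-- The inverse dilogarithm of a tetrahedron of index `-1` with charges `a` and `c`. -/
noncomputable def chargedDilogBar (X Y Z : ℂ) (a c n : ZMod N) : ℂ :=
  omegaPow N (a * c * half N) * omegaPow N (c * n) /
    omegaFun N (X * omegaPow N (-1)) Y Z (n + a)

/-- The dependence of a 6j-symbol on the states. -/
noncomputable def symbolCore (f : ZMod N → ℂ) (α β γ δ : ZMod N) : ℂ :=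
  if γ + δ = β then omegaPow N (α * δ + α ^ 2 * half N) * f (γ - α) else 0

/-- The dependence of an inverse 6j-symbol on the states. -/
noncomputable def symbolCoreBar (f : ZMod N → ℂ) (α β γ δ : ZMod N) : ℂ :=
  if γ + δ = β then omegaPow N (-(α * δ + α ^ 2 * half N)) * f (γ - α) else 0

theorem cSixJ_eq (X Y Z : ℂ) (a c α β γ δ : ZMod N) :
    cSixJ N X Y Z a c α β γ δ =
      Z ^ ((N - 1) / 2) * hFun N (X / Z) * symbolCore (chargedDilog X Y Z a c) α β γ δ := by
  have hiff : γ - a + δ = β - a ↔ γ + δ = β := by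
    constructor
    · intro h; linear_combination h
    · intro h; linear_combination h
  unfold cSixJ sixJ symbolCore chargedDilog omegaFun₂
  simp only [hiff]
  split_ifs
  · rw [show γ - a - α = γ - α - a by ring, sub_eq_add_neg (c * (γ - α)), omegaPow_add,
    omegaPow_add]
    ring
  · simp

theorem cSixJBar_eq (X Y Z : ℂ) (a c α β γ δ : ZMod N) :
    cSixJBar N X Y Z a c α β γ δ =
      Z ^ ((N - 1) / 2) * (bracket N (X / Z) / hFun N (X / Z)) *
        symbolCoreBar (chargedDilogBar X Y Z a c) α β γ δ := by
  have hiff : γ + a + δ = β + a ↔ γ + δ = β := by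
    constructor
    · intro h; linear_combination h
    · intro h; linear_combination h
  unfold cSixJBar sixJBar symbolCoreBar chargedDilogBar omegaFun₂
  simp only [hiff]
  split_ifs
  · rw [show γ + a - α = γ - α + a by ring, omegaPow_add (c * (γ - α)), neg_add, omegaPow_add,
      omegaPow_neg (α ^ 2 * half N)]
    simp only [div_eq_mul_inv, mul_inv]
    ring
  · simp

theorem sum_core_deltaBeta {f g : ZMod N → ℂ} {k : ℂ} (h : ∀ n, f n * g n = k)
    (α α' γ γ' : ZMod N) :
    ∑ δ, ∑ β, symbolCore f α β γ δ * symbolCoreBar g α' β γ' δ =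
      if γ = γ' ∧ α = α' then N * k else 0 := by
  unfold symbolCore symbolCoreBar
  simp only [ite_mul, zero_mul, Finset.sum_ite_eq, Finset.mem_univ, if_true]
  by_cases hγ : γ = γ'
  · subst hγ
    simp only [true_and, if_true]
    have h1 : ∀ δ, omegaPow N (α * δ + α ^ 2 * half N) * f (γ - α) *
        (omegaPow N (-(α' * δ + α' ^ 2 * half N)) * g (γ - α')) =
        omegaPow N (α ^ 2 * half N - α' ^ 2 * half N) * (f (γ - α) * g (γ - α')) *
          omegaPow N ((α - α') * δ) := by
      intro δ
      have e : omegaPow N (α * δ + α ^ 2 * half N) * omegaPow N (-(α' * δ + α' ^ 2 * half N)) =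
          omegaPow N (α ^ 2 * half N - α' ^ 2 * half N) * omegaPow N ((α - α') * δ) := by
        rw [← omegaPow_add, ← omegaPow_add]; congr 1; ring
      linear_combination f (γ - α) * g (γ - α') * e
    simp only [h1, ← Finset.mul_sum, sum_omegaPow_mul, sub_eq_zero]
    split_ifs with hα
    · subst hα
      rw [sub_self, omegaPow_zero, h]
      ring
    · ring
  · simp [hγ, Ne.symm hγ]

theorem sum_core_betaGamma {f g : ZMod N → ℂ} {k : ℂ}
    (h : ∀ s, ∑ n, f n * g (n + s) = if s = 0 then k else 0) (α α' δ δ' : ZMod N) :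
    ∑ β, ∑ γ, symbolCore f α β γ δ * symbolCoreBar g α' β γ δ' =
      if δ = δ' ∧ α = α' then k else 0 := by
  unfold symbolCore symbolCoreBar
  rw [Finset.sum_comm]
  simp only [ite_mul, zero_mul, Finset.sum_ite_eq, Finset.mem_univ, if_true, add_right_inj]
  by_cases hδ : δ = δ'
  · subst hδ
    simp only [true_and, if_true]
    have h1 : ∀ γ, omegaPow N (α * δ + α ^ 2 * half N) * f (γ - α) *
        (omegaPow N (-(α' * δ + α' ^ 2 * half N)) * g (γ - α')) =
        omegaPow N (α * δ + α ^ 2 * half N - (α' * δ + α' ^ 2 * half N)) *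
          (f (γ - α) * g (γ - α + (α - α'))) := by
      intro γ
      rw [sub_eq_add_neg _ (α' * δ + α' ^ 2 * half N), omegaPow_add _ (-_), sub_add_sub_cancel]
      ring
    simp only [h1, ← Finset.mul_sum]
    rw [Fintype.sum_equiv (Equiv.subRight α) (fun γ => f (γ - α) * g (γ - α + (α - α')))
      (fun n => f n * g (n + (α - α'))) fun γ => rfl, h]
    simp only [sub_eq_zero]
    split_ifs with hα
    · subst hα
      rw [sub_self, omegaPow_zero, one_mul]
    · ring
  · simp [hδ, Ne.symm hδ]

theorem sum_core_deltaGamma {f g : ZMod N → ℂ} {k : ℂ}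
    (h : ∀ s, ∑ n, omegaPow N (-s * n) * (f n * g (n + s)) = if s = 0 then k else 0)
    (α α' β β' : ZMod N) :
    ∑ δ, ∑ γ, symbolCore f α β γ δ * symbolCoreBar g α' β' γ δ =
      if β = β' ∧ α = α' then k else 0 := by
  unfold symbolCore symbolCoreBar
  rw [Finset.sum_comm]
  have hiff : ∀ γ δ b : ZMod N, γ + δ = b ↔ b - γ = δ := fun γ δ b =>
    ⟨fun e => by rw [← e, add_sub_cancel_left], fun e => by rw [← e, add_sub_cancel]⟩
  simp only [ite_mul, zero_mul, hiff, Finset.sum_ite_eq, Finset.mem_univ, if_true, sub_left_inj]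
  by_cases hβ : β = β'
  · subst hβ
    simp only [true_and, if_true]
    have h1 : ∀ γ, omegaPow N (α * (β - γ) + α ^ 2 * half N) * f (γ - α) *
        (omegaPow N (-(α' * (β - γ) + α' ^ 2 * half N)) * g (γ - α')) =
        omegaPow N (α ^ 2 * half N - α' ^ 2 * half N + (α - α') * (β - α)) *
          (omegaPow N (-(α - α') * (γ - α)) * (f (γ - α) * g (γ - α + (α - α')))) := by
      intro γ
      have e : omegaPow N (α * (β - γ) + α ^ 2 * half N) *
            omegaPow N (-(α' * (β - γ) + α' ^ 2 * half N)) =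
          omegaPow N (α ^ 2 * half N - α' ^ 2 * half N + (α - α') * (β - α)) *
          omegaPow N (-(α - α') * (γ - α)) := by
        rw [← omegaPow_add, ← omegaPow_add]; congr 1; ring
      rw [sub_add_sub_cancel]
      linear_combination f (γ - α) * g (γ - α') * e
    simp only [h1, ← Finset.mul_sum]
    rw [Fintype.sum_equiv (Equiv.subRight α)
      (fun γ => omegaPow N (-(α - α') * (γ - α)) * (f (γ - α) * g (γ - α + (α - α'))))
      (fun n => omegaPow N (-(α - α') * n) * (f n * g (n + (α - α')))) fun γ => rfl, h]
    simp only [sub_eq_zero]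
    split_ifs with hα
    · subst hα
      rw [sub_self, sub_self, zero_mul, add_zero, omegaPow_zero, one_mul]
    · ring
  · simp [hβ, Ne.symm hβ]

section Inverse

variable {X Y Z : ℂ}

theorem chargedDilogBar_eq (h : X ^ N + Y ^ N = Z ^ N) (hY : Y ≠ 0) (hZ : Z ≠ 0) (a c n : ZMod N) :
    chargedDilogBar X Y Z a c n = omegaPow N (a * c * half N) * omegaPow N (c * n) *
      omegaFun N X Y Z (-1) / omegaFun N X Y Z (n + a - 1) := by
  have hd := isDilog_omegaFun h hY hZ
  have e := omegaFun_mul_omegaPow h hY hZ (n + a)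
  have h1 : omegaFun N (X * omegaPow N (-1)) Y Z (n + a) ≠ 0 := by
    intro h0
    rw [h0, zero_mul] at e
    exact hd.ne_zero _ e.symm
  rw [chargedDilogBar, ← e, mul_div_mul_right _ _ (hd.ne_zero _)]

theorem omegaFun_neg_one (h : X ^ N + Y ^ N = Z ^ N) (hY : Y ≠ 0) (hZ : Z ≠ 0) :
    omegaFun N X Y Z (-1) = (1 - X / Z) / (Y / Z) := by
  have hd := isDilog_omegaFun h hY hZ
  have := hd.step 0
  rw [omegaFun_zero, omegaPow_zero, zero_sub, mul_one, one_mul] at this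
  rw [this, mul_div_cancel_left₀ _ hd.param_ne_zero]

theorem chargedDilog_mul_bar (h : X ^ N + Y ^ N = Z ^ N) (hY : Y ≠ 0) (hZ : Z ≠ 0)
    {a a' c c' : ZMod N} (ha : a + a' = 1) (hc : c + c' = 0)
    (n : ZMod N) :
    chargedDilog X Y Z a c n * chargedDilogBar X Y Z a' c' n =
      omegaPow N (-(a * c * half N) + a' * c' * half N) * omegaFun N X Y Z (-1) := by
  have hd := isDilog_omegaFun h hY hZ
  rw [chargedDilogBar_eq h hY hZ, chargedDilog, show n + a' - 1 = n - a by linear_combination ha]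
  have hw := hd.ne_zero (n - a)
  have e : omegaPow N (c * n) * omegaPow N (c' * n) = 1 := by
    rw [← omegaPow_add, ← add_mul, hc, zero_mul, omegaPow_zero]
  rw [omegaPow_add, mul_div_assoc', div_eq_iff hw]
  linear_combination omegaPow N (-(a * c * half N)) * omegaPow N (a' * c' * half N) *
    omegaFun N X Y Z (-1) * omegaFun N X Y Z (n - a) * e

theorem chargedDilog_mul_bar_add (h : X ^ N + Y ^ N = Z ^ N) (hY : Y ≠ 0) (hZ : Z ≠ 0)
    (a c c' : ZMod N) (m s : ZMod N) :
    chargedDilog X Y Z a c (m + a) * chargedDilogBar X Y Z (-a) c' (m + a + s) =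
      omegaPow N (-(a * c * half N) + -a * c' * half N) * omegaFun N X Y Z (-1) *
        omegaPow N ((c + c') * (m + a) + c' * s) *
          (omegaFun N X Y Z m / omegaFun N X Y Z (m + s - 1)) := by
  rw [chargedDilogBar_eq h hY hZ, chargedDilog, add_sub_cancel_right,
    show m + a + s + -a - 1 = m + s - 1 by ring]
  have e : omegaPow N (c * (m + a)) * omegaPow N (c' * (m + a + s)) =
      omegaPow N ((c + c') * (m + a) + c' * s) := by
    rw [← omegaPow_add]; congr 1; ring
  rw [← e, omegaPow_add (-(a * c * half N))]
  ring

theorem sum_chargedDilog_mul_bar_of_c (h : X ^ N + Y ^ N = Z ^ N) (hY : Y ≠ 0) (hZ : Z ≠ 0)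
    {a a' c c' : ZMod N} (ha : a + a' = 0) (hc : c + c' = 1)
    (s : ZMod N) :
    ∑ n, chargedDilog X Y Z a c n * chargedDilogBar X Y Z a' c' (n + s) =
      if s = 0 then omegaPow N (-(a * c * half N) + a' * c' * half N + a) *
        omegaFun N X Y Z (-1) *
        (N * (Y / Z) * (X / Z) ^ (N - 1) / (1 - (X / Z) ^ N)) else 0 := by
  have hd := isDilog_omegaFun h hY hZ
  obtain rfl : a' = -a := by linear_combination ha
  rw [← Fintype.sum_equiv (Equiv.addRight a) _ _ fun n => rfl]
  simp only [Equiv.coe_addRight, chargedDilog_mul_bar_add h hY hZ, hc]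
  have e : ∀ m : ZMod N, omegaPow N (1 * (m + a) + c' * s) =
      omegaPow N (a + c' * s) * omegaPow N m := by
    intro m
    rw [← omegaPow_add]; congr 1; ring
  simp only [e, mul_assoc, ← Finset.mul_sum, hd.sum_omegaPow_mul_div]
  split_ifs with hs
  · subst hs
    rw [mul_zero, add_zero, omegaPow_add _ a]
    ring
  · simp

theorem sum_chargedDilog_mul_bar_of_b (h : X ^ N + Y ^ N = Z ^ N) (hY : Y ≠ 0) (hZ : Z ≠ 0)
    {a a' c c' : ZMod N} (ha : a + a' = 0) (hc : c + c' = 0)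
    (s : ZMod N) :
    ∑ n, omegaPow N (-s * n) * (chargedDilog X Y Z a c n * chargedDilogBar X Y Z a' c' (n + s)) =
      if s = 0 then omegaPow N (-(a * c * half N) + a' * c' * half N) *
        omegaFun N X Y Z (-1) * (N * (Y / Z) / (1 - (X / Z) ^ N)) else 0 := by
  have hd := isDilog_omegaFun h hY hZ
  obtain rfl : a' = -a := by linear_combination ha
  rw [← Fintype.sum_equiv (Equiv.addRight a) (fun m => _) _ fun n => rfl]
  simp only [Equiv.coe_addRight, chargedDilog_mul_bar_add h hY hZ, hc]
  have e : ∀ m : ZMod N, ∀ A B C : ℂ, omegaPow N (-s * (m + a)) *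
      (A * B * omegaPow N (0 * (m + a) + c' * s) * C) =
      A * B * omegaPow N (-s * a + c' * s) * (omegaPow N (-s * m) * C) := by
    intro m A B C
    have e1 : omegaPow N (-s * (m + a)) * omegaPow N (0 * (m + a) + c' * s) =
        omegaPow N (-s * a + c' * s) * omegaPow N (-s * m) := by
      rw [← omegaPow_add, ← omegaPow_add]; congr 1; ring
    linear_combination A * B * C * e1
  simp only [e, ← Finset.mul_sum, hd.sum_omegaPow_neg_mul_div]
  split_ifs with hs
  · subst hs
    simp [omegaPow_zero]
  · simp

end Inverse

end Symbol

section Tetrahedron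

variable {N : ℕ} [NeZero N]

theorem hFun_ne_zero {x y : ℂ} {f : ZMod N → ℂ} (hf : IsDilog x y f) : hFun N x ≠ 0 := by
  have h1 : gFun N x ^ N ≠ 0 := by rw [gFun_pow]; exact hf.gPow_ne_zero
  have h2 : gFun N 1 ^ N ≠ 0 := by rw [gFun_pow]; exact gPow_one_ne_zero
  exact div_ne_zero ((pow_ne_zero_iff (NeZero.ne N)).1 h1) ((pow_ne_zero_iff (NeZero.ne N)).1 h2)

/-- The parameters of the edges of a tetrahedron. -/
structure TetParams (N : ℕ) (y : Fin 4 → Fin 4 → ℂ) : Prop where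
  symm : ∀ i j, y i j = y j i
  ne_zero : ∀ i j, i ≠ j → y i j ≠ 0
  fermat : (y 0 3 * y 1 2) ^ N + (y 0 1 * y 2 3) ^ N = (y 0 2 * y 1 3) ^ N

/-- Charges on the edges of a tetrahedron which agree on opposite edges. -/
structure TetCharges {A : Type*} (q : Fin 4 → Fin 4 → A) : Prop where
  symm : ∀ i j, q i j = q j i
  opp : ∀ i j k l, i ≠ j → i ≠ k → i ≠ l → j ≠ k → j ≠ l → k ≠ l → q i j = q k l

/-- The symbol of a tetrahedron of index `σ`, where `r i` is the state of the face opposite to the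
vertex `i`. -/
noncomputable def tetWeight (σ : ℤˣ) (y : Fin 4 → Fin 4 → ℂ) (q : Fin 4 → Fin 4 → ZMod N)
    (r : Fin 4 → ZMod N) : ℂ :=
  if σ = 1 then
    cSixJ N (y 0 3 * y 1 2) (y 0 1 * y 2 3) (y 0 2 * y 1 3) (q 0 1) (q 1 2) (r 3) (r 1) (r 2) (r 0)
  else
    cSixJBar N (y 0 3 * y 1 2) (y 0 1 * y 2 3) (y 0 2 * y 1 3) (q 0 1) (q 1 2)
      (r 3) (r 1) (r 2) (r 0)

/-- Gluing `F` and `G` along the faces `i` and `j` gives `K` times the identity. -/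
def PairInverse {A : Type*} [Fintype A] [DecidableEq A] (F G : (Fin 4 → A) → ℂ) (i j k l : Fin 4)
    (K : ℂ) : Prop :=
  ∀ r r' : Fin 4 → A,
    ∑ u, ∑ v, F (Function.update (Function.update r i u) j v) *
      G (Function.update (Function.update r' i u) j v) = if r k = r' k ∧ r l = r' l then K else 0

namespace PairInverse

variable {A : Type*} [Fintype A] [DecidableEq A] {F G : (Fin 4 → A) → ℂ} {i j k l : Fin 4} {K : ℂ}

theorem symm (h : PairInverse F G i j k l K) : PairInverse G F i j k l K := by
  intro r r'
  have := h r' r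
  simp only [eq_comm (a := r k), eq_comm (a := r l)]
  rw [← this]
  exact Finset.sum_congr rfl fun u _ => Finset.sum_congr rfl fun v _ => mul_comm _ _

theorem swap (h : PairInverse F G i j k l K) (hij : i ≠ j) : PairInverse F G j i k l K := by
  intro r r'
  rw [← h r r', Finset.sum_comm]
  refine Finset.sum_congr rfl fun u _ => Finset.sum_congr rfl fun v _ => ?_
  rw [Function.update_comm hij.symm, Function.update_comm hij.symm]

theorem swap' (h : PairInverse F G i j k l K) : PairInverse F G i j l k K := by
  intro r r'
  rw [h r r']
  simp only [and_comm]

theorem transpose (h : PairInverse F G i j k l K) (hK : K ≠ 0) (hij : i ≠ j) (hik : i ≠ k)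
    (hil : i ≠ l) (hjk : j ≠ k) (hjl : j ≠ l) (hkl : k ≠ l) : PairInverse F G k l i j K := by
  have hcov : ∀ m, m = i ∨ m = j ∨ m = k ∨ m = l := by
    clear h
    revert i j k l
    decide
  set row : A × A → A × A → Fin 4 → A := fun p u m =>
    if m = i then u.1 else if m = j then u.2 else if m = k then p.1 else p.2 with hrow
  have e1 : ∀ (p u : A × A) (a b : A),
      Function.update (Function.update (row p u) i a) j b = row p (a, b) := by
    intro p u a b
    funext m
    rcases hcov m with rfl | rfl | rfl | rfl <;> simp [*, Ne.symm]
  have e2 : ∀ (r : Fin 4 → A) (a b : A),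
      Function.update (Function.update r k a) l b = row (a, b) (r i, r j) := by
    intro r a b
    funext m
    rcases hcov m with rfl | rfl | rfl | rfl <;>
      simp [*, Ne.symm, hij.symm, hik.symm, hil.symm, hjk.symm,
        hjl.symm, hkl.symm]
  set M : Matrix (A × A) (A × A) ℂ := Matrix.of fun p u => F (row p u) with hM
  set M' : Matrix (A × A) (A × A) ℂ := Matrix.of fun u p => K⁻¹ * G (row p u) with hM'
  have h1 : M * M' = 1 := by
    ext p p'
    rw [Matrix.mul_apply, Fintype.sum_prod_type]
    have := h (row p p) (row p' p')
    simp only [e1] at this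
    simp only [hM, hM', Matrix.of_apply, mul_left_comm _ K⁻¹, ← Finset.mul_sum, this]
    have h2 : (row p p k = row p' p' k ∧ row p p l = row p' p' l) ↔ p = p' := by
      simp [hrow, hik.symm, hjk.symm, hil.symm, hjl.symm, hkl.symm, Prod.ext_iff]
    simp only [h2, Matrix.one_apply]
    split_ifs
    · exact inv_mul_cancel₀ hK
    · exact mul_zero _
  have h2 : M' * M = 1 := mul_eq_one_comm.1 h1
  intro r r'
  have h3 := congrFun (congrFun h2 (r' i, r' j)) (r i, r j)
  rw [Matrix.mul_apply, Fintype.sum_prod_type] at h3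
  simp only [hM, hM', Matrix.of_apply, mul_assoc, ← Finset.mul_sum] at h3
  rw [inv_mul_eq_iff_eq_mul₀ hK, Matrix.one_apply] at h3
  simp only [e2]
  simp only [mul_comm (F _)]
  rw [h3]
  simp only [Prod.mk.injEq, eq_comm (a := r' i), eq_comm (a := r' j)]
  split_ifs <;> simp

end PairInverse

theorem sum_sum_mul_mul {A : Type*} [Fintype A] (a b : ℂ) (F G : A → A → ℂ) :
    ∑ u, ∑ v, a * F u v * (b * G u v) = a * b * ∑ u, ∑ v, F u v * G u v := by
  simp only [Finset.mul_sum]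
  exact Finset.sum_congr rfl fun u _ => Finset.sum_congr rfl fun v _ => by ring

theorem TetParams.normalization (hN : Odd N) {y : Fin 4 → Fin 4 → ℂ} (hy : TetParams N y)
    (k : ℂ) :
    (y 0 2 * y 1 3) ^ ((N - 1) / 2) * hFun N (y 0 3 * y 1 2 / (y 0 2 * y 1 3)) *
      ((y 0 2 * y 1 3) ^ ((N - 1) / 2) * (bracket N (y 0 3 * y 1 2 / (y 0 2 * y 1 3)) /
        hFun N (y 0 3 * y 1 2 / (y 0 2 * y 1 3)))) *
      (omegaFun N (y 0 3 * y 1 2) (y 0 1 * y 2 3) (y 0 2 * y 1 3) (-1) * (N * k)) =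
    (y 0 2 * y 1 3) ^ N * (1 - (y 0 3 * y 1 2 / (y 0 2 * y 1 3)) ^ N) / (y 0 1 * y 2 3) * k := by
  have hY : y 0 1 * y 2 3 ≠ 0 :=
    mul_ne_zero (hy.ne_zero _ _ (by decide)) (hy.ne_zero _ _ (by decide))
  have hZ : y 0 2 * y 1 3 ≠ 0 :=
    mul_ne_zero (hy.ne_zero _ _ (by decide)) (hy.ne_zero _ _ (by decide))
  have hd := isDilog_omegaFun hy.fermat hY hZ
  rw [omegaFun_neg_one hy.fermat hY hZ, bracket]
  have h1 := hFun_ne_zero hd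
  have h2 : 1 - y 0 3 * y 1 2 / (y 0 2 * y 1 3) ≠ 0 := by
    have := hd.factor_ne_zero 0
    rwa [omegaPow_zero, mul_one] at this
  have hN0 : (N : ℂ) ≠ 0 := NeZero.ne _
  have h3 : (y 0 2 * y 1 3) ^ N =
      (y 0 2 * y 1 3) ^ ((N - 1) / 2) * (y 0 2 * y 1 3) ^ ((N - 1) / 2) * (y 0 2 * y 1 3) := by
    rw [← pow_add, ← pow_succ]
    congr 1
    obtain ⟨m, rfl⟩ := hN
    omega
  rw [h3]
  generalize y 0 2 * y 1 3 = Z at *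
  generalize y 0 3 * y 1 2 = X at *
  generalize y 0 1 * y 2 3 = Y at *
  generalize hFun N (X / Z) = H at *
  generalize X / Z = x at *
  generalize Z ^ ((N - 1) / 2) = W
  field_simp

variable {y : Fin 4 → Fin 4 → ℂ} {q q' : Fin 4 → Fin 4 → ZMod N}

theorem tetWeight_one_inverse_Y (hN : Odd N) (hy : TetParams N y)
    (ha : q 0 1 + q' 0 1 = 1) (hc : q 1 2 + q' 1 2 = 0) :
    ∃ K : ℂ, K ^ N = ((y 0 1 * y 2 3) ^ (N - 1)) ^ N ∧
      PairInverse (tetWeight 1 y q) (tetWeight (-1) y q') 0 1 2 3 K := by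
  have hY : y 0 1 * y 2 3 ≠ 0 :=
    mul_ne_zero (hy.ne_zero _ _ (by decide)) (hy.ne_zero _ _ (by decide))
  have hZ : y 0 2 * y 1 3 ≠ 0 :=
    mul_ne_zero (hy.ne_zero _ _ (by decide)) (hy.ne_zero _ _ (by decide))
  refine ⟨omegaPow N (-(q 0 1 * q 1 2 * half N) + q' 0 1 * q' 1 2 * half N) *
    (y 0 1 * y 2 3) ^ (N - 1), ?_, ?_⟩
  · rw [mul_pow, omegaPow_pow_card, one_mul]
  · intro r r'
    have h := sum_core_deltaBeta (chargedDilog_mul_bar hy.fermat hY hZ ha hc) (r 3) (r' 3)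
      (r 2) (r' 2)
    have hne : (-1 : ℤˣ) ≠ 1 := by decide
    simp only [tetWeight, if_true, hne, if_false, cSixJ_eq, cSixJBar_eq, sum_sum_mul_mul,
      Function.update_apply, Fin.reduceEq]
    rw [h]
    split_ifs
    · have h2 := hy.normalization hN
        (omegaPow N (-(q 0 1 * q 1 2 * half N) + q' 0 1 * q' 1 2 * half N))
      rw [mul_comm (omegaPow N _) (omegaFun N _ _ _ _), mul_left_comm (N : ℂ), h2, div_pow,
        mul_sub, mul_one, mul_div_cancel₀ _ (pow_ne_zero _ hZ), ← hy.fermat, add_sub_cancel_left,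
        mul_comm, ← pow_sub_one_mul (NeZero.ne N), mul_div_cancel_right₀ _ hY]
    · rw [mul_zero]

theorem tetWeight_one_inverse_X (hN : Odd N) (hy : TetParams N y)
    (ha : q 0 1 + q' 0 1 = 0) (hc : q 1 2 + q' 1 2 = 1) :
    ∃ K : ℂ, K ^ N = ((y 1 2 * y 0 3) ^ (N - 1)) ^ N ∧
      PairInverse (tetWeight 1 y q) (tetWeight (-1) y q') 1 2 0 3 K := by
  have hY : y 0 1 * y 2 3 ≠ 0 :=
    mul_ne_zero (hy.ne_zero _ _ (by decide)) (hy.ne_zero _ _ (by decide))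
  have hZ : y 0 2 * y 1 3 ≠ 0 :=
    mul_ne_zero (hy.ne_zero _ _ (by decide)) (hy.ne_zero _ _ (by decide))
  have hd := isDilog_omegaFun hy.fermat hY hZ
  refine ⟨omegaPow N (-(q 0 1 * q 1 2 * half N) + q' 0 1 * q' 1 2 * half N + q 0 1) *
    (y 0 3 * y 1 2) ^ (N - 1), ?_, ?_⟩
  · rw [mul_pow, omegaPow_pow_card, one_mul, mul_comm (y 0 3)]
  · intro r r'
    have h := sum_core_betaGamma (sum_chargedDilog_mul_bar_of_c hy.fermat hY hZ ha hc)
      (r 3) (r' 3) (r 0) (r' 0)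
    have hne : (-1 : ℤˣ) ≠ 1 := by decide
    simp only [tetWeight, if_true, hne, if_false, cSixJ_eq, cSixJBar_eq, sum_sum_mul_mul,
      Function.update_apply, Fin.reduceEq]
    rw [h]
    split_ifs
    · set ζ := omegaPow N (-(q 0 1 * q 1 2 * half N) + q' 0 1 * q' 1 2 * half N + q 0 1)
      have h2 := hy.normalization hN (ζ * ((y 0 1 * y 2 3 / (y 0 2 * y 1 3)) *
        (y 0 3 * y 1 2 / (y 0 2 * y 1 3)) ^ (N - 1) /
          (1 - (y 0 3 * y 1 2 / (y 0 2 * y 1 3)) ^ N)))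
      have h3 : ∀ a b c d e : ℂ, a * b * (c * d * e / (1 - (y 0 3 * y 1 2 / (y 0 2 * y 1 3)) ^ N)) =
          b * (c * (a * (d * e / (1 - (y 0 3 * y 1 2 / (y 0 2 * y 1 3)) ^ N)))) := by
        intros; ring
      rw [h3, h2]
      have h4 := hd.one_sub_pow_ne_zero
      rw [← pow_sub_one_mul (NeZero.ne N) (y 0 2 * y 1 3), div_pow _ _ (N - 1)]
      generalize (1 - (y 0 3 * y 1 2 / (y 0 2 * y 1 3)) ^ N) = D at *
      have h5 := pow_ne_zero (N - 1) hZ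
      generalize (y 0 2 * y 1 3) ^ (N - 1) = W at *
      generalize y 0 2 * y 1 3 = Z at *
      generalize y 0 1 * y 2 3 = Y at *
      field_simp
    · rw [mul_zero]

theorem tetWeight_one_inverse_Z (hN : Odd N) (hy : TetParams N y)
    (ha : q 0 1 + q' 0 1 = 0) (hc : q 1 2 + q' 1 2 = 0) :
    ∃ K : ℂ, K ^ N = ((y 0 2 * y 1 3) ^ (N - 1)) ^ N ∧
      PairInverse (tetWeight 1 y q) (tetWeight (-1) y q') 0 2 1 3 K := by
  have hY : y 0 1 * y 2 3 ≠ 0 :=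
    mul_ne_zero (hy.ne_zero _ _ (by decide)) (hy.ne_zero _ _ (by decide))
  have hZ : y 0 2 * y 1 3 ≠ 0 :=
    mul_ne_zero (hy.ne_zero _ _ (by decide)) (hy.ne_zero _ _ (by decide))
  have hd := isDilog_omegaFun hy.fermat hY hZ
  refine ⟨omegaPow N (-(q 0 1 * q 1 2 * half N) + q' 0 1 * q' 1 2 * half N) *
    (y 0 2 * y 1 3) ^ (N - 1), ?_, ?_⟩
  · rw [mul_pow, omegaPow_pow_card, one_mul]
  · intro r r'
    have h := sum_core_deltaGamma (sum_chargedDilog_mul_bar_of_b hy.fermat hY hZ ha hc)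
      (r 3) (r' 3) (r 1) (r' 1)
    have hne : (-1 : ℤˣ) ≠ 1 := by decide
    simp only [tetWeight, if_true, hne, if_false, cSixJ_eq, cSixJBar_eq, sum_sum_mul_mul,
      Function.update_apply, Fin.reduceEq]
    rw [h]
    split_ifs
    · set ζ := omegaPow N (-(q 0 1 * q 1 2 * half N) + q' 0 1 * q' 1 2 * half N)
      have h2 := hy.normalization hN (ζ * ((y 0 1 * y 2 3 / (y 0 2 * y 1 3)) /
          (1 - (y 0 3 * y 1 2 / (y 0 2 * y 1 3)) ^ N)))
      have h3 : ∀ a b c d : ℂ, a * b * (c * d / (1 - (y 0 3 * y 1 2 / (y 0 2 * y 1 3)) ^ N)) =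
          b * (c * (a * (d / (1 - (y 0 3 * y 1 2 / (y 0 2 * y 1 3)) ^ N)))) := by
        intros; ring
      rw [h3, h2]
      have h4 := hd.one_sub_pow_ne_zero
      rw [← pow_sub_one_mul (NeZero.ne N) (y 0 2 * y 1 3)]
      generalize (1 - (y 0 3 * y 1 2 / (y 0 2 * y 1 3)) ^ N) = D at *
      generalize (y 0 2 * y 1 3) ^ (N - 1) = W at *
      generalize y 0 2 * y 1 3 = Z at *
      generalize y 0 1 * y 2 3 = Y at *
      field_simp
    · rw [mul_zero]

/-- The inversion relations of the symbols. -/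
theorem tetWeight_one_inverse (hN : Odd N) (hy : TetParams N y) (hq : TetCharges q)
    (hq' : TetCharges q') {i j k l : Fin 4} (hij : i ≠ j) (hik : i ≠ k) (hil : i ≠ l)
    (hjk : j ≠ k) (hjl : j ≠ l) (hkl : k ≠ l) (h₁ : q i j + q' i j = 1) (h₂ : q i k + q' i k = 0)
    (h₃ : q i l + q' i l = 0) :
    ∃ K : ℂ, K ^ N = ((y i j * y k l) ^ (N - 1)) ^ N ∧
      PairInverse (tetWeight 1 y q) (tetWeight (-1) y q') i j k l K := by
  have sq : ∀ {a b c d : Fin 4} {s : ZMod N}, a ≠ b → a ≠ c → a ≠ d → b ≠ c → b ≠ d → c ≠ d →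
      q a b + q' a b = s → q c d + q' c d = s := by
    intro a b c d s h1 h2 h3 h4 h5 h6 h
    rw [← hq.opp a b c d h1 h2 h3 h4 h5 h6, ← hq'.opp a b c d h1 h2 h3 h4 h5 h6, h]
  have ss : ∀ {a b : Fin 4} {s : ZMod N}, q a b + q' a b = s → q b a + q' b a = s := by
    intro a b s h
    rw [hq.symm b a, hq'.symm b a, h]
  set Good : Fin 4 → Fin 4 → Fin 4 → Fin 4 → Prop := fun i j k l =>
    i ≠ j → i ≠ k → i ≠ l → j ≠ k → j ≠ l → k ≠ l →
    q i j + q' i j = 1 → q i k + q' i k = 0 → q i l + q' i l = 0 →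
    ∃ K : ℂ, K ^ N = ((y i j * y k l) ^ (N - 1)) ^ N ∧
      PairInverse (tetWeight 1 y q) (tetWeight (-1) y q') i j k l K with hGood
  have g1 : ∀ {i j k l}, Good i j k l → Good j i k l := by
    intro i j k l h h1 h2 h3 h4 h5 h6 a b c
    obtain ⟨K, hK, hI⟩ := h h1.symm h4 h5 h2 h3 h6 (ss a) (sq h3 h1 h2 h5.symm h6.symm h4 c)
      (sq h2 h1 h3 h4.symm h6 h5 b)
    exact ⟨K, by rw [hK, hy.symm], hI.swap h1.symm⟩
  have g2 : ∀ {i j k l}, Good i j k l → Good i j l k := by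
    intro i j k l h h1 h2 h3 h4 h5 h6 a b c
    obtain ⟨K, hK, hI⟩ := h h1 h3 h2 h5 h4 h6.symm a c b
    exact ⟨K, by rw [hK, hy.symm k l], hI.swap'⟩
  have g3 : ∀ {i j k l}, Good i j k l → Good k l i j := by
    intro i j k l h h1 h2 h3 h4 h5 h6 a b c
    have c' := sq h3 h1 h2 h5.symm h6.symm h4 c
    obtain ⟨K, hK, hI⟩ := h h6 h2.symm h4.symm h3.symm h5.symm h1
      (sq h1 h2 h3 h4 h5 h6 a) (ss b) (ss c')
    refine ⟨K, by rw [hK, mul_comm], hI.transpose ?_ h6 h2.symm h4.symm h3.symm h5.symm h1⟩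
    refine (pow_ne_zero_iff (NeZero.ne N)).1 ?_
    rw [hK]
    exact pow_ne_zero _ (pow_ne_zero _ (mul_ne_zero (hy.ne_zero _ _ h6) (hy.ne_zero _ _ h1)))
  have b1 : Good 0 1 2 3 := by
    intro h1 h2 h3 h4 h5 h6 a b c
    exact tetWeight_one_inverse_Y hN hy a (sq h3 h1 h2 h5.symm h6.symm h4 c)
  have b2 : Good 1 2 0 3 := by
    intro h1 h2 h3 h4 h5 h6 a b c
    exact tetWeight_one_inverse_X hN hy (ss b) a
  have b3 : Good 0 2 1 3 := by
    intro h1 h2 h3 h4 h5 h6 a b c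
    exact tetWeight_one_inverse_Z hN hy b (ss (sq h3 h1 h2 h5.symm h6.symm h4 c))
  have hall : Good i j k l := by
    have fill : ∀ a b c d, Good a b c d → (∀ k l : Fin 4, a ≠ k → a ≠ l → b ≠ k → b ≠ l → k ≠ l →
        k = c ∧ l = d ∨ k = d ∧ l = c) → (i = a ∧ j = b ∨ i = b ∧ j = a) → Good i j k l := by
      rintro a b c d h hc (⟨rfl, rfl⟩ | ⟨rfl, rfl⟩)
      · rcases hc k l hik hil hjk hjl hkl with ⟨rfl, rfl⟩ | ⟨rfl, rfl⟩
        · exact h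
        · exact g2 h
      · rcases hc k l hjk hjl hik hil hkl with ⟨rfl, rfl⟩ | ⟨rfl, rfl⟩
        · exact g1 h
        · exact g1 (g2 h)
    have hcases : ∀ i j : Fin 4, i ≠ j →
        (i = 0 ∧ j = 1 ∨ i = 1 ∧ j = 0) ∨ (i = 2 ∧ j = 3 ∨ i = 3 ∧ j = 2) ∨
        (i = 1 ∧ j = 2 ∨ i = 2 ∧ j = 1) ∨ (i = 0 ∧ j = 3 ∨ i = 3 ∧ j = 0) ∨
        (i = 0 ∧ j = 2 ∨ i = 2 ∧ j = 0) ∨ (i = 1 ∧ j = 3 ∨ i = 3 ∧ j = 1) := by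
      decide
    rcases hcases i j hij with h | h | h | h | h | h
    · exact fill 0 1 2 3 b1 (by decide) h
    · exact fill 2 3 0 1 (g3 b1) (by decide) h
    · exact fill 1 2 0 3 b2 (by decide) h
    · exact fill 0 3 1 2 (g3 b2) (by decide) h
    · exact fill 0 2 1 3 b3 (by decide) h
    · exact fill 1 3 0 2 (g3 b3) (by decide) h
  exact hall hij hik hil hjk hjl hkl h₁ h₂ h₃

theorem tetWeight_inverse (hN : Odd N) (σ : ℤˣ) (hy : TetParams N y) (hq : TetCharges q)
    (hq' : TetCharges q') {i j k l : Fin 4} (hij : i ≠ j) (hik : i ≠ k) (hil : i ≠ l)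
    (hjk : j ≠ k) (hjl : j ≠ l) (hkl : k ≠ l) (h₁ : q i j + q' i j = 1) (h₂ : q i k + q' i k = 0)
    (h₃ : q i l + q' i l = 0) :
    ∃ K : ℂ, K ^ N = ((y i j * y k l) ^ (N - 1)) ^ N ∧
      PairInverse (tetWeight σ y q) (tetWeight (-σ) y q') i j k l K := by
  rcases Int.units_eq_one_or σ with rfl | rfl
  · exact tetWeight_one_inverse hN hy hq hq' hij hik hil hjk hjl hkl h₁ h₂ h₃
  · obtain ⟨K, hK, hI⟩ := tetWeight_one_inverse hN hy hq' hq hij hik hil hjk hjl hkl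
      ((add_comm _ _).trans h₁) ((add_comm _ _).trans h₂) ((add_comm _ _).trans h₃)
    exact ⟨K, hK, by rw [neg_neg]; exact hI.symm⟩

end Tetrahedron

section PentagonSymbols

variable {N : ℕ} [NeZero N]

theorem two_mul_half (hN : Odd N) : 2 * half N = 1 := by
  obtain ⟨m, rfl⟩ := hN
  have h : ((2 * m + 1 : ℕ) : ZMod (2 * m + 1)) = 0 := ZMod.natCast_self _
  have e : (2 * m + 1 - 1) / 2 + 1 = m + 1 := by omega
  rw [half, e]
  push_cast at h ⊢
  linear_combination h

theorem prod_omegaPow_mul (hN : Odd N) (c : ZMod N) : ∏ n : ZMod N, omegaPow N (c * n) = 1 := by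
  set s := ∑ n : ZMod N, c * n with hs
  have h1 : ∏ n : ZMod N, omegaPow N (c * n) = omegaPow N s := by
    rw [hs]
    induction (Finset.univ : Finset (ZMod N)) using Finset.induction_on with
    | empty => simp [omegaPow_zero]
    | insert m l hm ih => rw [Finset.prod_insert hm, Finset.sum_insert hm, omegaPow_add, ih]
  have h2 : s = -s := by
    rw [hs, ← Finset.sum_neg_distrib]
    exact Fintype.sum_equiv (Equiv.neg _) _ _ fun n => by simp
  have h3 : s = 0 := by linear_combination half N * h2 - s * two_mul_half hN
  rw [h1, h3, omegaPow_zero]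

theorem prod_chargedDilog (hN : Odd N) (X Y Z : ℂ) (a c : ZMod N) :
    ∏ n, chargedDilog X Y Z a c n = ∏ n, omegaFun N X Y Z n := by
  unfold chargedDilog
  rw [Finset.prod_mul_distrib, Finset.prod_mul_distrib, prod_omegaPow_mul hN, Finset.prod_const,
    Finset.card_univ, ZMod.card, omegaPow_pow_card, one_mul, one_mul]
  exact Fintype.prod_equiv (Equiv.subRight a) _ _ fun n => rfl

theorem isDilog_chargedDilog {X Y Z : ℂ} (h : X ^ N + Y ^ N = Z ^ N) (hY : Y ≠ 0) (hZ : Z ≠ 0)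
    (a c : ZMod N) :
    IsDilog (X / Z * omegaPow N (-a)) (Y / Z * omegaPow N c) (chargedDilog X Y Z a c) :=
  (isDilog_omegaFun h hY hZ).twist _ (omegaPow_ne_zero _) a c

/-- The pentagon relation for the state dependence of the 6j-symbols. -/
theorem sum_core_pentagon (hN : Odd N) {f : Fin 5 → ZMod N → ℂ} {κ : ℂ}
    (h : ∀ b e, pentagonSum (f 0) (f 2) (f 4) b e = κ * (f 1 (b + e) * f 3 b))
    (s01 s03 s12 s14 s23 s34 : ZMod N) :
    ∑ s02, ∑ s04, ∑ s24, symbolCore (f 0) s04 s02 s03 s01 * symbolCore (f 2) s24 s12 s23 s02 *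
        symbolCore (f 4) s34 s14 s24 s04 =
      κ * ∑ s13, symbolCore (f 1) s14 s12 s13 s01 * symbolCore (f 3) s34 s13 s23 s03 := by
  have h2 := two_mul_half hN
  have hl : ∑ s13, symbolCore (f 1) s14 s12 s13 s01 * symbolCore (f 3) s34 s13 s23 s03 =
      symbolCore (f 1) s14 s12 (s23 + s03) s01 *
        (omegaPow N (s34 * s03 + s34 ^ 2 * half N) * f 3 (s23 - s34)) := by
    rw [Finset.sum_eq_single (s23 + s03)]
    · simp [symbolCore]
    · intro b _ hb
      simp [symbolCore, Ne.symm hb]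
    · simp
  have hr : ∑ s02, ∑ s04, ∑ s24, symbolCore (f 0) s04 s02 s03 s01 *
      symbolCore (f 2) s24 s12 s23 s02 * symbolCore (f 4) s34 s14 s24 s04 =
      ∑ s24, omegaPow N ((s14 - s24) * s01 + (s14 - s24) ^ 2 * half N) * f 0 (s03 - (s14 - s24)) *
        symbolCore (f 2) s24 s12 s23 (s03 + s01) *
        (omegaPow N (s34 * (s14 - s24) + s34 ^ 2 * half N) * f 4 (s24 - s34)) := by
    rw [Finset.sum_eq_single (s03 + s01)]
    · rw [Finset.sum_comm]
      refine Finset.sum_congr rfl fun s24 _ => ?_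
      rw [Finset.sum_eq_single (s14 - s24)]
      · simp [symbolCore]
      · intro b _ hb
        have : s24 + b ≠ s14 := fun e => hb (by rw [← e, add_sub_cancel_left])
        simp [symbolCore, this]
      · simp
    · intro b _ hb
      simp [symbolCore, Ne.symm hb]
    · simp
  rw [hl, hr]
  unfold symbolCore
  have hiff : s23 + s03 + s01 = s12 ↔ s23 + (s03 + s01) = s12 := by rw [add_assoc]
  simp only [hiff]
  split_ifs
  · have hp := h (s23 - s34) (s34 + s03 - s14)
    rw [show s23 - s34 + (s34 + s03 - s14) = s23 + s03 - s14 by ring] at hp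
    have e1 : ∀ A B : ℂ, κ * (omegaPow N (s14 * s01 + s14 ^ 2 * half N) * A *
        (omegaPow N (s34 * s03 + s34 ^ 2 * half N) * B)) =
        omegaPow N (s14 * s01 + s14 ^ 2 * half N) * omegaPow N (s34 * s03 + s34 ^ 2 * half N) *
          (κ * (A * B)) := by intros; ring
    rw [e1, ← hp, pentagonSum, Finset.mul_sum,
      Fintype.sum_equiv (Equiv.subRight s34) _ (fun n => _) fun n => ?_]
    simp only [Equiv.subRight_apply]
    rw [show n - s34 + (s34 + s03 - s14) = s03 - (s14 - n) by ring,
      show s23 - s34 - (n - s34) = s23 - n by ring]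
    have e2 : omegaPow N ((s14 - n) * s01 + (s14 - n) ^ 2 * half N) *
        omegaPow N (n * (s03 + s01) + n ^ 2 * half N) *
        omegaPow N (s34 * (s14 - n) + s34 ^ 2 * half N) =
        omegaPow N (s14 * s01 + s14 ^ 2 * half N) * omegaPow N (s34 * s03 + s34 ^ 2 * half N) *
        omegaPow N ((n - s34) * (s03 - (s14 - n))) := by
      rw [← omegaPow_add, ← omegaPow_add, ← omegaPow_add, ← omegaPow_add]
      congr 1
      linear_combination (n ^ 2 - s14 * n) * h2
    linear_combination f 0 (s03 - (s14 - n)) * f 2 (s23 - n) * f 4 (n - s34) * e2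
  · simp

theorem hFun_pow_mul_gPow (x : ℂ) : hFun N x ^ N * gPow N 1 = gPow N x := by
  rw [hFun, div_pow, gFun_pow, gFun_pow, div_mul_cancel₀ _ gPow_one_ne_zero]

theorem prod_omegaFun_mul_gPow (hN : Odd N) {X Y Z : ℂ} (h : X ^ N + Y ^ N = Z ^ N) (hY : Y ≠ 0)
    (hZ : Z ≠ 0) :
    (∏ n, omegaFun N X Y Z n) * gPow N (X / Z) = ((Y / Z) ^ ((N - 1) / 2)) ^ N := by
  have := (isDilog_omegaFun h hY hZ).prod_mul_gPow
  rw [this, omegaFun_zero, one_pow, one_mul, ← pow_mul]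
  congr 1
  obtain ⟨m, rfl⟩ := hN
  rw [Nat.add_sub_cancel, Nat.mul_div_cancel_left _ two_pos, mul_comm (2 * m + 1),
    mul_assoc, Nat.mul_div_cancel_left _ two_pos]

theorem triangular_eq (hN : Odd N) : N * (N - 1) / 2 = (N - 1) / 2 * N := by
  obtain ⟨m, rfl⟩ := hN
  rw [Nat.add_sub_cancel, Nat.mul_div_cancel_left _ two_pos, mul_comm (2 * m + 1),
    mul_assoc, Nat.mul_div_cancel_left _ two_pos]

theorem pow_triangular_mul_omegaPow (hN : Odd N) (x : ℂ) (a : ZMod N) :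
    (x * omegaPow N a) ^ (N * (N - 1) / 2) = (x ^ ((N - 1) / 2)) ^ N := by
  rw [triangular_eq hN, pow_mul, mul_pow, mul_pow, ← pow_mul (omegaPow N a), mul_comm _ N, pow_mul,
    omegaPow_pow_card, one_pow, mul_one]

/-- The pentagon relation for the products of normalized symbols. -/
theorem exists_core_pentagon (hN : Odd N) {X Y Z : Fin 5 → ℂ} {a c : Fin 5 → ZMod N}
    (h : ∀ i, X i ^ N + Y i ^ N = Z i ^ N) (hX : ∀ i, X i ≠ 0) (hY : ∀ i, Y i ≠ 0)
    (hZ : ∀ i, Z i ≠ 0)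
    (hp : PentagonParams (fun i => X i / Z i * omegaPow N (-a i))
      (fun i => Y i / Z i * omegaPow N (c i))) :
    ∃ K : ℂ, (K * ((Z 0 * Y 4 * X 2) / (Y 3 * X 1)) ^ ((N - 1) / 2)) ^ N = 1 ∧
      ∀ s01 s03 s12 s14 s23 s34 : ZMod N,
      ∑ s13, cSixJ N (X 1) (Y 1) (Z 1) (a 1) (c 1) s14 s12 s13 s01 *
          cSixJ N (X 3) (Y 3) (Z 3) (a 3) (c 3) s34 s13 s23 s03 =
        K * ∑ s02, ∑ s04, ∑ s24, cSixJ N (X 0) (Y 0) (Z 0) (a 0) (c 0) s04 s02 s03 s01 *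
          cSixJ N (X 2) (Y 2) (Z 2) (a 2) (c 2) s24 s12 s23 s02 *
          cSixJ N (X 4) (Y 4) (Z 4) (a 4) (c 4) s34 s14 s24 s04 := by
  set x : Fin 5 → ℂ := fun i => X i / Z i with hx
  set y : Fin 5 → ℂ := fun i => Y i / Z i with hy
  set f : Fin 5 → ZMod N → ℂ := fun i => chargedDilog (X i) (Y i) (Z i) (a i) (c i) with hf
  have hd : ∀ i, IsDilog (x i) (y i) (omegaFun N (X i) (Y i) (Z i)) := fun i =>
    isDilog_omegaFun (h i) (hY i) (hZ i)
  obtain ⟨κ, hκ0, hκ, hκN⟩ := exists_pentagon (f := f)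
    (fun i => isDilog_chargedDilog (h i) (hY i) (hZ i) (a i) (c i))
    (fun i => mul_ne_zero (div_ne_zero (hX i) (hZ i)) (omegaPow_ne_zero _)) hp
  have hsum := sum_core_pentagon hN hκ
  set p := (N - 1) / 2 with hpdef
  set H : Fin 5 → ℂ := fun i => hFun N (x i) with hH
  have hH0 : ∀ i, H i ≠ 0 := fun i => hFun_ne_zero (hd i)
  refine ⟨(Z 1 ^ p * H 1 * (Z 3 ^ p * H 3)) /
    (κ * (Z 0 ^ p * H 0 * (Z 2 ^ p * H 2) * (Z 4 ^ p * H 4))), ?_, ?_⟩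
  · set G := gPow N 1 with hG
    have hG0 : G ≠ 0 := gPow_one_ne_zero
    have hHG : ∀ i, H i ^ N * G = gPow N (x i) := fun i => hFun_pow_mul_gPow _
    set B : Fin 5 → ℂ := fun i => ∏ n, omegaFun N (X i) (Y i) (Z i) n with hB
    have hB0 : ∀ i, B i ≠ 0 := fun i => Finset.prod_ne_zero_iff.2 fun n _ => (hd i).ne_zero n
    have hBH : ∀ i, B i * (H i ^ N * G) = ((Y i / Z i) ^ p) ^ N := fun i => by
      rw [hHG]
      exact prod_omegaFun_mul_gPow hN (h i) (hY i) (hZ i)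
    simp only [hf, prod_chargedDilog hN] at hκN
    have e1 : (X 1 / Z 1 * omegaPow N (-a 1) * (Y 2 / Z 2 * omegaPow N (c 2)) *
        (Y 0 / Z 0 * omegaPow N (c 0))) =
        (X 1 / Z 1 * (Y 2 / Z 2) * (Y 0 / Z 0)) * omegaPow N (-a 1 + c 2 + c 0) := by
      rw [omegaPow_add, omegaPow_add]; ring
    have e2 : (X 2 / Z 2 * omegaPow N (-a 2) * (Y 1 / Z 1 * omegaPow N (c 1))) =
        (X 2 / Z 2 * (Y 1 / Z 1)) * omegaPow N (-a 2 + c 1) := by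
      rw [omegaPow_add]; ring
    rw [e1, e2, pow_triangular_mul_omegaPow hN, pow_triangular_mul_omegaPow hN] at hκN
    have hκN' : κ ^ N * (B 3 * B 1 * ((X 1 / Z 1 * (Y 2 / Z 2) * (Y 0 / Z 0)) ^ p) ^ N) =
      B 2 * B 4 * B 0 * ((X 2 / Z 2 * (Y 1 / Z 1)) ^ p) ^ N * G := hκN
    have hB' : ∀ i, B i = ((Y i / Z i) ^ p) ^ N / (H i ^ N * G) := fun i => by
      rw [← hBH, mul_div_cancel_right₀ _ (mul_ne_zero (pow_ne_zero _ (hH0 i)) hG0)]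
    rw [hB' 0, hB' 1, hB' 2, hB' 3, hB' 4] at hκN'
    clear_value H G B p
    simp only [div_pow, mul_pow] at hκN' ⊢
    have zz : ∀ i, (Z i ^ p) ^ N ≠ 0 := fun i => pow_ne_zero _ (pow_ne_zero _ (hZ i))
    have yy : ∀ i, (Y i ^ p) ^ N ≠ 0 := fun i => pow_ne_zero _ (pow_ne_zero _ (hY i))
    have xx : ∀ i, (X i ^ p) ^ N ≠ 0 := fun i => pow_ne_zero _ (pow_ne_zero _ (hX i))
    have hh : ∀ i, H i ^ N ≠ 0 := fun i => pow_ne_zero _ (hH0 i)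
    have hk : κ ^ N ≠ 0 := pow_ne_zero _ hκ0
    have z0 := zz 0; have z1 := zz 1; have z2 := zz 2; have z3 := zz 3; have z4 := zz 4
    have y0 := yy 0; have y1 := yy 1; have y2 := yy 2; have y3 := yy 3; have y4 := yy 4
    have x1 := xx 1; have x2 := xx 2
    have h0 := hh 0; have h1 := hh 1; have h2 := hh 2; have h3 := hh 3; have h4 := hh 4
    generalize (Z 0 ^ p) ^ N = z0' at *
    generalize (Z 1 ^ p) ^ N = z1' at *
    generalize (Z 2 ^ p) ^ N = z2' at *
    generalize (Z 3 ^ p) ^ N = z3' at *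
    generalize (Z 4 ^ p) ^ N = z4' at *
    generalize (Y 0 ^ p) ^ N = y0' at *
    generalize (Y 1 ^ p) ^ N = y1' at *
    generalize (Y 2 ^ p) ^ N = y2' at *
    generalize (Y 3 ^ p) ^ N = y3' at *
    generalize (Y 4 ^ p) ^ N = y4' at *
    generalize (X 1 ^ p) ^ N = x1' at *
    generalize (X 2 ^ p) ^ N = x2' at *
    generalize H 0 ^ N = h0' at *
    generalize H 1 ^ N = h1' at *
    generalize H 2 ^ N = h2' at *
    generalize H 3 ^ N = h3' at *
    generalize H 4 ^ N = h4' at *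
    generalize κ ^ N = k at *
    field_simp at hκN' ⊢
    linear_combination -hκN'
  · intro s01 s03 s12 s14 s23 s34
    simp only [cSixJ_eq, ← hpdef]
    have hs := hsum s01 s03 s12 s14 s23 s34
    have r1 : ∀ s13, Z 1 ^ p * hFun N (X 1 / Z 1) *
        symbolCore (chargedDilog (X 1) (Y 1) (Z 1) (a 1) (c 1)) s14 s12 s13 s01 *
        (Z 3 ^ p * hFun N (X 3 / Z 3) *
        symbolCore (chargedDilog (X 3) (Y 3) (Z 3) (a 3) (c 3)) s34 s13 s23 s03) =
        (Z 1 ^ p * H 1 * (Z 3 ^ p * H 3)) *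
        (symbolCore (f 1) s14 s12 s13 s01 * symbolCore (f 3) s34 s13 s23 s03) := by
      intro s13
      simp only [hf, hH, hx]
      ring
    have r2 : ∀ s02 s04 s24, Z 0 ^ p * hFun N (X 0 / Z 0) *
        symbolCore (chargedDilog (X 0) (Y 0) (Z 0) (a 0) (c 0)) s04 s02 s03 s01 *
        (Z 2 ^ p * hFun N (X 2 / Z 2) *
        symbolCore (chargedDilog (X 2) (Y 2) (Z 2) (a 2) (c 2)) s24 s12 s23 s02) *
        (Z 4 ^ p * hFun N (X 4 / Z 4) *
        symbolCore (chargedDilog (X 4) (Y 4) (Z 4) (a 4) (c 4)) s34 s14 s24 s04) =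
        (Z 0 ^ p * H 0 * (Z 2 ^ p * H 2) * (Z 4 ^ p * H 4)) *
        (symbolCore (f 0) s04 s02 s03 s01 * symbolCore (f 2) s24 s12 s23 s02 *
        symbolCore (f 4) s34 s14 s24 s04) := by
      intro s02 s04 s24
      simp only [hf, hH, hx]
      ring
    simp only [r1, r2, ← Finset.mul_sum]
    rw [hs]
    have hne : Z 0 ^ p * H 0 * (Z 2 ^ p * H 2) * (Z 4 ^ p * H 4) ≠ 0 :=
      mul_ne_zero (mul_ne_zero (mul_ne_zero (pow_ne_zero _ (hZ _)) (hH0 _))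
        (mul_ne_zero (pow_ne_zero _ (hZ _)) (hH0 _))) (mul_ne_zero (pow_ne_zero _ (hZ _)) (hH0 _))
    generalize Z 0 ^ p * H 0 * (Z 2 ^ p * H 2) * (Z 4 ^ p * H 4) = D at *
    field_simp

end PentagonSymbols

section Simplex

variable {N : ℕ} [NeZero N]

/-- The parameters of the edges of a 4-simplex. -/
structure SimplexParams (N : ℕ) (y : Fin 5 → Fin 5 → ℂ) : Prop where
  symm : ∀ i j, y i j = y j i
  ne_zero : ∀ i j, i ≠ j → y i j ≠ 0
  fermat : ∀ i : Fin 5, (y (i.succAbove 0) (i.succAbove 3) * y (i.succAbove 1)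
    (i.succAbove 2)) ^ N +
    (y (i.succAbove 0) (i.succAbove 1) * y (i.succAbove 2) (i.succAbove 3)) ^ N =
    (y (i.succAbove 0) (i.succAbove 2) * y (i.succAbove 1) (i.succAbove 3)) ^ N

theorem SimplexParams.facet {N : ℕ} {y : Fin 5 → Fin 5 → ℂ} (hy : SimplexParams N y) (i : Fin 5) :
    TetParams N fun k l => y (i.succAbove k) (i.succAbove l) where
  symm _ _ := hy.symm _ _
  ne_zero _ _ h := hy.ne_zero _ _ fun e => h (Fin.succAbove_right_injective e)
  fermat := hy.fermat i

/-- The symbol of the facet `i` of a 4-simplex, where `r j` is the state of the common face of the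
facets `i` and `j`. -/
noncomputable def facetWeight (σ : ℤˣ) (y : Fin 5 → Fin 5 → ℂ) (q : Fin 5 → Fin 5 → ZMod N)
    (i : Fin 5) (r : Fin 5 → ZMod N) : ℂ :=
  tetWeight σ (fun k l => y (i.succAbove k) (i.succAbove l))
    (fun k l => q (i.succAbove k) (i.succAbove l)) fun k => r (i.succAbove k)

/-- The function with values `vb`, `vc`, `vd`, `ve` at `b`, `c`, `d`, `e`. -/
def row {A : Type*} [Zero A] (b c d e : Fin 5) (vb vc vd ve : A) (j : Fin 5) : A :=
  if j = b then vb else if j = c then vc else if j = d then vd else if j = e then ve else 0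

theorem eq_of_nodup_five {a b c d e : Fin 5} (h : [a, b, c, d, e].Nodup) (v : Fin 5) :
    v = a ∨ v = b ∨ v = c ∨ v = d ∨ v = e := by
  have h1 : [a, b, c, d, e].toFinset = Finset.univ :=
    Finset.eq_univ_of_card _ (by rw [List.toFinset_card_of_nodup h]; rfl)
  have h2 := Finset.mem_univ v
  rw [← h1] at h2
  simpa using h2

theorem nodup_pairs {α : Type*} {a b c d e : α} (h : [a, b, c, d, e].Nodup) :
    [c, d, a, b, e].Nodup :=
  (((List.perm_append_comm (l₁ := [c, d]) (l₂ := [a, b])).append_right [e]).nodup_iff).2 h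

theorem nodup_swap₁ {α : Type*} {a b c d e : α} (h : [a, b, c, d, e].Nodup) :
    [b, a, c, d, e].Nodup := ((List.Perm.swap a b [c, d, e]).nodup_iff).2 h

theorem nodup_swap₂ {α : Type*} {a b c d e : α} (h : [a, b, c, d, e].Nodup) :
    [a, c, b, d, e].Nodup := (((List.Perm.swap b c [d, e]).cons a).nodup_iff).2 h

theorem nodup_swap₃ {α : Type*} {a b c d e : α} (h : [a, b, c, d, e].Nodup) :
    [a, b, d, c, e].Nodup := ((((List.Perm.swap c d [e]).cons b).cons a).nodup_iff).2 h

theorem nodup_swap₄ {α : Type*} {a b c d e : α} (h : [a, b, c, d, e].Nodup) :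
    [a, b, c, e, d].Nodup := (((((List.Perm.swap d e []).cons c).cons b).cons a).nodup_iff).2 h

/-- Charges on the facets of a 4-simplex: `q i u v` is the charge of the edge `uv` of the facet
`i`. -/
structure SimplexCharges {A : Type*} (q : Fin 5 → Fin 5 → Fin 5 → A) : Prop where
  symm : ∀ i u v, q i u v = q i v u
  opp : ∀ i u v w x, [i, u, v, w, x].Nodup → q i u v = q i w x

/-- The charge of the edge `uv` in the facet `i`, which is zero if `uv` is not in the facet. -/
def facetCharge {A : Type*} [Zero A] (q : Fin 5 → Fin 5 → Fin 5 → A) (i u v : Fin 5) : A :=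
  if i = u ∨ i = v then 0 else q i u v

/-- The indicator function of the edge `ab`. -/
def edgeInd {A : Type*} [Zero A] [One A] (a b u v : Fin 5) : A :=
  if (u = a ∧ v = b) ∨ (u = b ∧ v = a) then 1 else 0

/-- The charges on the facet `e` which are inverse to those of `q` for gluings along `a` and `b`. -/
theorem SimplexCharges.inverse {A : Type*} [AddCommGroup A] [One A]
    {q : Fin 5 → Fin 5 → Fin 5 → A} (hq : SimplexCharges q) {a b c d e : Fin 5}
    (h : [a, b, c, d, e].Nodup) :
    SimplexCharges (Function.update q e fun u v => edgeInd a b u v +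
      edgeInd c d u v - q e u v) where
  symm i u v := by
    by_cases hi : i = e
    · subst hi
      simp only [Function.update_self, edgeInd]
      rw [hq.symm i u v]
      simp only [and_comm, or_comm]
    · simp only [Function.update_of_ne hi]
      exact hq.symm i u v
  opp i u v w x hn := by
    by_cases hi : i = e
    · subst hi
      simp only [Function.update_self]
      rw [hq.opp i u v w x hn]
      congr 1
      have key : ∀ a b c d i u v w x : Fin 5, [a, b, c, d, i].Nodup → [i, u, v, w, x].Nodup →
          ((u = a ∧ v = b) ∨ (u = b ∧ v = a)) → ((w = c ∧ x = d) ∨ (w = d ∧ x = c)) := by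
        intro a b c d i u v w x h1 h2 h3
        have hw := eq_of_nodup_five h1 w
        have hx := eq_of_nodup_five h1 x
        simp only [List.nodup_cons, List.mem_cons, List.not_mem_nil, or_false, not_or] at h2
        obtain ⟨⟨iu, iv, iw, ix⟩, ⟨uv, uw, ux⟩, ⟨vw, vx⟩, wx, -⟩ := h2
        have hab : (w ≠ a ∧ w ≠ b) ∧ x ≠ a ∧ x ≠ b := by
          rcases h3 with ⟨rfl, rfl⟩ | ⟨rfl, rfl⟩
          · exact ⟨⟨Ne.symm uw, Ne.symm vw⟩, Ne.symm ux, Ne.symm vx⟩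
          · exact ⟨⟨Ne.symm vw, Ne.symm uw⟩, Ne.symm vx, Ne.symm ux⟩
        have hw' : w = c ∨ w = d :=
          ((hw.resolve_left hab.1.1).resolve_left hab.1.2).imp_right
            fun e => e.resolve_right (Ne.symm iw)
        have hx' : x = c ∨ x = d :=
          ((hx.resolve_left hab.2.1).resolve_left hab.2.2).imp_right
            fun e => e.resolve_right (Ne.symm ix)
        rcases hw' with rfl | rfl <;> rcases hx' with rfl | rfl
        · exact absurd rfl wx
        · exact Or.inl ⟨rfl, rfl⟩
        · exact Or.inr ⟨rfl, rfl⟩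
        · exact absurd rfl wx
      have h' : [c, d, a, b, i].Nodup := nodup_pairs h
      have hn' : [i, w, x, u, v].Nodup :=
        (((List.perm_append_comm (l₁ := [w, x]) (l₂ := [u, v])).cons i).nodup_iff).2 hn
      have k1 : (edgeInd a b u v : A) = edgeInd c d w x :=
        if_congr ⟨key _ _ _ _ _ _ _ _ _ h hn, key _ _ _ _ _ _ _ _ _ h' hn'⟩ rfl rfl
      have k2 : (edgeInd c d u v : A) = edgeInd a b w x :=
        if_congr ⟨key _ _ _ _ _ _ _ _ _ h' hn, key _ _ _ _ _ _ _ _ _ h hn'⟩ rfl rfl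
      rw [k1, k2, add_comm]
    · simp only [Function.update_of_ne hi]
      exact hq.opp i u v w x hn

end Simplex

theorem ne_of_nodup_five {α : Type*} {a b c d e : α} (h : [a, b, c, d, e].Nodup) :
    a ≠ b ∧ a ≠ c ∧ a ≠ d ∧ a ≠ e ∧ b ≠ c ∧ b ≠ d ∧ b ≠ e ∧ c ≠ d ∧ c ≠ e ∧ d ≠ e := by
  simp only [List.nodup_cons, List.mem_cons, List.not_mem_nil, or_false, not_or] at h
  obtain ⟨⟨ab, ac, ad, ae⟩, ⟨bc, bd, be⟩, ⟨cd, ce⟩, de, -⟩ := h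
  exact ⟨ab, ac, ad, ae, bc, bd, be, cd, ce, de⟩

section Row

variable {A : Type*} [Zero A] {b c d e : Fin 5} (vb vc vd ve : A)

theorem row_swap₁ (h : b ≠ c) : row b c d e vb vc vd ve = row c b d e vc vb vd ve := by
  funext j
  unfold row
  by_cases h1 : j = b
  · subst h1; simp [h]
  · simp [h1]

theorem row_swap₂ (h : c ≠ d) : row b c d e vb vc vd ve = row b d c e vb vd vc ve := by
  funext j
  unfold row
  by_cases h1 : j = c
  · subst h1; simp [h]
  · simp [h1]

theorem row_swap₃ (h : d ≠ e) : row b c d e vb vc vd ve = row b c e d vb vc ve vd := by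
  funext j
  unfold row
  by_cases h1 : j = d
  · subst h1; simp [h]
  · simp [h1]

theorem row_rotate (h : b ≠ c) (h' : b ≠ d) :
    row c d b e vc vd vb ve = row b c d e vb vc vd ve := by
  rw [row_swap₁ vb vc vd ve h, row_swap₂ vc vb vd ve h']

end Row

section Relations

variable {N : ℕ} [NeZero N] {y : Fin 5 → Fin 5 → ℂ}

theorem SimplexCharges.facet {A : Type*} {q : Fin 5 → Fin 5 → Fin 5 → A} (hq : SimplexCharges q)
    (i : Fin 5) : TetCharges fun k l => q i (i.succAbove k) (i.succAbove l) where
  symm _ _ := hq.symm _ _ _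
  opp a b c d h1 h2 h3 h4 h5 h6 := by
    refine hq.opp _ _ _ _ _ ?_
    have hs := Fin.succAbove_right_injective (p := i)
    simp only [List.nodup_cons, List.mem_cons, List.not_mem_nil, or_false, not_or, hs.eq_iff,
      List.nodup_nil, not_false_eq_true, and_true]
    exact ⟨⟨Fin.ne_succAbove _ _, Fin.ne_succAbove _ _, Fin.ne_succAbove _ _,
      Fin.ne_succAbove _ _⟩, ⟨h1, h2, h3⟩, ⟨h4, h5⟩, h6⟩

theorem exists_facetWeight_inverse (hN : Odd N) (hy : SimplexParams N y)
    {q : Fin 5 → Fin 5 → Fin 5 → ZMod N} (hq : SimplexCharges q) (σ : ℤˣ) {a b c d e : Fin 5}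
    (hn : [a, b, c, d, e].Nodup) :
    ∃ K : ℂ, K ^ N = ((y a b * y c d) ^ (N - 1)) ^ N ∧ ∀ p s p' s' : ZMod N,
      ∑ u, ∑ v, facetWeight σ y (q e) e (row a b c d u v p s) *
        facetWeight (-σ) y (fun u v => edgeInd a b u v + edgeInd c d u v - q e u v) e
          (row a b c d u v p' s') = if p = p' ∧ s = s' then K else 0 := by
  have hq' := (hq.inverse hn).facet e
  simp only [Function.update_self] at hq'
  obtain ⟨ab, ac, ad, ae, bc, bd, be, cd, ce, de⟩ := ne_of_nodup_five hn
  obtain ⟨i, rfl⟩ := Fin.exists_succAbove_eq ae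
  obtain ⟨j, rfl⟩ := Fin.exists_succAbove_eq be
  obtain ⟨k, rfl⟩ := Fin.exists_succAbove_eq ce
  obtain ⟨l, rfl⟩ := Fin.exists_succAbove_eq de
  have hs := Fin.succAbove_right_injective (p := e)
  simp only [ne_eq, hs.eq_iff] at ab ac ad bc bd cd
  obtain ⟨K, hK, hI⟩ := tetWeight_inverse hN σ (hy.facet e) (hq.facet e) hq' ab ac ad bc bd cd
    (by simp [edgeInd, hs.eq_iff, *]) (by simp [edgeInd, hs.eq_iff, *, Ne.symm bc])
    (by simp [edgeInd, hs.eq_iff, *, Ne.symm bd])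
  refine ⟨K, hK, fun p s p' s' => ?_⟩
  have hrow : ∀ (p s u v : ZMod N), (fun m => row (e.succAbove i) (e.succAbove j) (e.succAbove k)
      (e.succAbove l) u v p s (e.succAbove m)) = Function.update (Function.update
      (fun m => if m = k then p else if m = l then s else 0) i u) j v := by
    intro p s u v
    funext m
    simp only [row, hs.eq_iff, Function.update_apply]
    by_cases hi : m = i
    · subst hi; simp [ab]
    · simp [hi]
  have h := hI (fun m => if m = k then p else if m = l then s else 0)
    (fun m => if m = k then p' else if m = l then s' else 0)
  simp only [facetWeight, hrow]
  rw [h]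
  simp [Ne.symm cd]

/-- The sign of the facet `i` in a move which replaces the facets in `S` by the other ones. -/
def sideSign (S : Finset (Fin 5)) (ε : ℤˣ) (i : Fin 5) : ℤˣ :=
  if i ∈ S then ε * (-1) ^ (i : ℕ) else -ε * (-1) ^ (i : ℕ)

/-- The sums of the charges at the edges on the two sides of a move differ by `m`. -/
def ChargeBalance {A : Type*} [AddCommMonoid A] (S : Finset (Fin 5)) (m : Fin 5 → Fin 5 → A)
    (q : Fin 5 → Fin 5 → Fin 5 → A) : Prop :=
  ∀ u v, u ≠ v → ∑ i ∈ Sᶜ, facetCharge q i u v = ∑ i ∈ S, facetCharge q i u v + m u v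

/-- The pentagon relation between the facets `a`, `b` and the facets `c`, `d`, `e`. -/
def PentagonRel (N : ℕ) [NeZero N] (y : Fin 5 → Fin 5 → ℂ) (ε : ℤˣ) (a b c d e : Fin 5) : Prop :=
  ∀ q : Fin 5 → Fin 5 → Fin 5 → ZMod N, SimplexCharges q → ChargeBalance {a, b} (edgeInd a b) q →
    ∃ K : ℂ, (K * y a b ^ (N - 1)) ^ N = 1 ∧ ∀ ac ad ae bc bd be : ZMod N,
      ∑ ab, facetWeight (sideSign {a, b} ε a) y (q a) a (row b c d e ab ac ad ae) *
          facetWeight (sideSign {a, b} ε b) y (q b) b (row a c d e ab bc bd be) =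
        K * ∑ cd, ∑ ce, ∑ de,
          facetWeight (sideSign {a, b} ε c) y (q c) c (row a b d e ac bc cd ce) *
          facetWeight (sideSign {a, b} ε d) y (q d) d (row a b c e ad bd cd de) *
          facetWeight (sideSign {a, b} ε e) y (q e) e (row a b c d ae be ce de)

theorem edgeInd_comm {A : Type*} [Zero A] [One A] (a b : Fin 5) :
    (edgeInd a b : Fin 5 → Fin 5 → A) = edgeInd b a := by
  funext u v
  simp only [edgeInd, or_comm]

namespace PentagonRel

variable {ε : ℤˣ} {a b c d e : Fin 5}

theorem swap₁ (hy : SimplexParams N y) (hn : [a, b, c, d, e].Nodup)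
    (h : PentagonRel N y ε a b c d e) : PentagonRel N y ε b a c d e := by
  obtain ⟨ab, ac, ad, ae, bc, bd, be, cd, ce, de⟩ := ne_of_nodup_five hn
  intro q hq hb
  rw [Finset.pair_comm, edgeInd_comm] at hb
  obtain ⟨K, hK, h⟩ := h q hq hb
  refine ⟨K, by rw [hy.symm, hK], fun bc bd be ac ad ae => ?_⟩
  simp only [Finset.pair_comm b a, row_swap₁ (b := b) (c := a) _ _ _ _ ab.symm]
  rw [← h ac ad ae bc bd be]
  exact Finset.sum_congr rfl fun _ _ => mul_comm _ _

theorem swap₃ (hn : [a, b, c, d, e].Nodup)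
    (h : PentagonRel N y ε a b c d e) : PentagonRel N y ε a b d c e := by
  obtain ⟨ab, ac, ad, ae, bc, bd, be, cd, ce, de⟩ := ne_of_nodup_five hn
  intro q hq hb
  obtain ⟨K, hK, h⟩ := h q hq hb
  refine ⟨K, hK, fun vad vac vae vbd vbc vbe => ?_⟩
  simp only [row_swap₂ (c := d) (d := c) _ _ _ _ cd.symm,
    row_swap₃ (d := d) (e := c) _ _ _ _ cd.symm]
  rw [h vac vad vae vbc vbd vbe]
  refine congrArg (K * ·) ?_
  refine Finset.sum_congr rfl fun vcd _ => ?_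
  rw [Finset.sum_comm]
  exact Finset.sum_congr rfl fun _ _ => Finset.sum_congr rfl fun _ _ => by ring

theorem swap₄ (hn : [a, b, c, d, e].Nodup)
    (h : PentagonRel N y ε a b c d e) : PentagonRel N y ε a b c e d := by
  obtain ⟨ab, ac, ad, ae, bc, bd, be, cd, ce, de⟩ := ne_of_nodup_five hn
  intro q hq hb
  obtain ⟨K, hK, h⟩ := h q hq hb
  refine ⟨K, hK, fun vac vae vad vbc vbe vbd => ?_⟩
  simp only [row_swap₃ (d := e) (e := d) _ _ _ _ de.symm]
  rw [h vac vad vae vbc vbd vbe]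
  refine congrArg (K * ·) ?_
  rw [Finset.sum_comm]
  exact Finset.sum_congr rfl fun _ _ => Finset.sum_congr rfl fun _ _ =>
    Finset.sum_congr rfl fun _ _ => by ring

end PentagonRel

theorem sum_comm_three {A B : Type*} [Fintype A] [Fintype B] (g : B → A → A → A → ℂ) :
    ∑ x, ∑ a, ∑ b, ∑ c, g x a b c = ∑ a, ∑ b, ∑ c, ∑ x, g x a b c := by
  rw [Finset.sum_comm]
  refine Finset.sum_congr rfl fun _ _ => ?_
  rw [Finset.sum_comm]
  refine Finset.sum_congr rfl fun _ _ => ?_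
  rw [Finset.sum_comm]

theorem sum_mul_of_inverse {A : Type*} [Fintype A] [DecidableEq A] {P Q R S F : A → A → ℂ}
    {G : A → A → A → A → ℂ} {K K' : ℂ} {ce₀ de₀ : A}
    (h₁ : ∀ ae be, ∑ ab, P ab ae * Q ab be =
      K * ∑ cd, ∑ ce, ∑ de, R cd ce * S cd de * G ae be ce de)
    (h₂ : ∀ ce de, ∑ ae, ∑ be, F ae be * G ae be ce de =
      if ce₀ = ce ∧ de₀ = de then K' else 0) :
    ∑ ab, ∑ ae, ∑ be, P ab ae * Q ab be * F ae be = K * K' * ∑ cd, R cd ce₀ * S cd de₀ := by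
  calc ∑ ab, ∑ ae, ∑ be, P ab ae * Q ab be * F ae be
      = ∑ ae, ∑ be, F ae be * ∑ ab, P ab ae * Q ab be := by
        rw [Finset.sum_comm]
        refine Finset.sum_congr rfl fun ae _ => ?_
        rw [Finset.sum_comm]
        refine Finset.sum_congr rfl fun be _ => ?_
        rw [Finset.mul_sum]
        exact Finset.sum_congr rfl fun ab _ => by ring
    _ = ∑ ae, ∑ be, ∑ cd, ∑ ce, ∑ de, K * (R cd ce * S cd de) * (F ae be * G ae be ce de) := by
        simp only [h₁, Finset.mul_sum]
        refine Finset.sum_congr rfl fun _ _ => Finset.sum_congr rfl fun _ _ =>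
          Finset.sum_congr rfl fun _ _ => Finset.sum_congr rfl fun _ _ =>
          Finset.sum_congr rfl fun _ _ => by ring
    _ = ∑ cd, ∑ ce, ∑ de, ∑ ae, ∑ be, K * (R cd ce * S cd de) * (F ae be * G ae be ce de) := by
        refine (Finset.sum_congr rfl fun ae _ => sum_comm_three _).trans ?_
        exact sum_comm_three fun ae cd ce de => ∑ be, K * (R cd ce * S cd de) *
          (F ae be * G ae be ce de)
    _ = ∑ cd, K * K' * (R cd ce₀ * S cd de₀) := by
        refine Finset.sum_congr rfl fun cd _ => ?_
        simp only [← Finset.mul_sum, h₂]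
        rw [Finset.sum_eq_single ce₀, Finset.sum_eq_single de₀]
        · simp only [and_self, if_true]; ring
        · intro de _ hde; simp [Ne.symm hde]
        · simp
        · intro ce _ hce; simp [Ne.symm hce]
        · simp
    _ = _ := by rw [Finset.mul_sum]

theorem sum_update_facetCharge {A : Type*} [Zero A] {q : Fin 5 → Fin 5 → Fin 5 → A}
    {f : Fin 5 → Fin 5 → A} {e i : Fin 5} (h : i ≠ e) (u v : Fin 5) :
    facetCharge (Function.update q e f) i u v = facetCharge q i u v := by
  simp [facetCharge, Function.update_of_ne h]

theorem facetCharge_inverse {A : Type*} [AddCommGroup A] [One A] {q : Fin 5 → Fin 5 → Fin 5 → A}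
    {a b c d e : Fin 5}
    (hn : [a, b, c, d, e].Nodup) (u v : Fin 5) :
    facetCharge (Function.update q e
      fun u v => edgeInd a b u v + edgeInd c d u v - q e u v) e u v =
      edgeInd a b u v + edgeInd c d u v - facetCharge q e u v := by
  obtain ⟨ab, ac, ad, ae, bc, bd, be, cd, ce, de⟩ := ne_of_nodup_five hn
  unfold facetCharge
  rw [Function.update_self]
  split_ifs with h
  · rcases h with rfl | rfl <;>
      simp [edgeInd, ae.symm, be.symm, ce.symm, de.symm]
  · rfl

theorem compl_pair {a b c d e : Fin 5} (hn : [a, b, c, d, e].Nodup) :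
    ({a, b} : Finset (Fin 5))ᶜ = {c, d, e} := by
  obtain ⟨ab, ac, ad, ae, bc, bd, be, cd, ce, de⟩ := ne_of_nodup_five hn
  ext v
  simp only [Finset.mem_compl, Finset.mem_insert, Finset.mem_singleton, not_or]
  constructor
  · rintro ⟨h1, h2⟩
    exact ((eq_of_nodup_five hn v).resolve_left h1).resolve_left h2
  · rintro (rfl | rfl | rfl)
    · exact ⟨ac.symm, bc.symm⟩
    · exact ⟨ad.symm, bd.symm⟩
    · exact ⟨ae.symm, be.symm⟩

theorem PentagonRel.step (hN : Odd N) (hy : SimplexParams N y) {ε : ℤˣ} {a b c d e : Fin 5}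
    (hn : [a, b, c, d, e].Nodup) (h : PentagonRel N y ε a b c d e) :
    PentagonRel N y (-ε) c d a b e := by
  obtain ⟨ab, ac, ad, ae, bc, bd, be, cd, ce, de⟩ := ne_of_nodup_five hn
  intro q hq hb
  obtain ⟨K', hK', hI⟩ := exists_facetWeight_inverse hN hy hq (sideSign {c, d} (-ε) e) hn
  set q' := Function.update q e fun u v => edgeInd a b u v + edgeInd c d u v - q e u v with hq'
  have hb' : ChargeBalance {a, b} (edgeInd a b) q' := by
    intro u v huv
    have h1 := hb u v huv
    rw [compl_pair (nodup_pairs hn), Finset.sum_insert (by simp [ab, ae]), Finset.sum_pair be,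
      Finset.sum_pair cd] at h1
    rw [compl_pair hn, Finset.sum_insert (by simp [cd, ce]), Finset.sum_pair de,
      Finset.sum_pair ab, sum_update_facetCharge ce, sum_update_facetCharge de,
      sum_update_facetCharge ae, sum_update_facetCharge be, facetCharge_inverse hn]
    linear_combination -h1
  obtain ⟨K, hK, hS⟩ := h q' (hq.inverse hn) hb'
  have hKab : y a b ≠ 0 := hy.ne_zero _ _ ab
  have hKcd : y c d ≠ 0 := hy.ne_zero _ _ cd
  have hK0 : K ≠ 0 := by
    rintro rfl
    rw [zero_mul, zero_pow (NeZero.ne N)] at hK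
    exact zero_ne_one hK
  have hK0' : K' ≠ 0 := by
    rintro rfl
    rw [zero_pow (NeZero.ne N)] at hK'
    exact pow_ne_zero _ (pow_ne_zero _ (mul_ne_zero hKab hKcd)) hK'.symm
  refine ⟨(K * K')⁻¹, ?_, ?_⟩
  · rw [mul_pow] at hK
    rw [mul_pow, inv_pow, mul_pow, hK', mul_pow (y a b), mul_pow (_ ^ _)]
    have : K ^ N = ((y a b ^ (N - 1)) ^ N)⁻¹ := eq_inv_of_mul_eq_one_left hK
    rw [this]
    have h1 := pow_ne_zero N (pow_ne_zero (N - 1) hKab)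
    have h2 := pow_ne_zero N (pow_ne_zero (N - 1) hKcd)
    field_simp
  · intro ca cb vce da db vde
    rw [eq_inv_mul_iff_mul_eq₀ (mul_ne_zero hK0 hK0')]
    have sa : sideSign {c, d} (-ε) a = sideSign {a, b} ε a := by simp [sideSign, ac, ad]
    have sb : sideSign {c, d} (-ε) b = sideSign {a, b} ε b := by simp [sideSign, bc, bd]
    have sc : sideSign {c, d} (-ε) c = sideSign {a, b} ε c := by
      simp [sideSign, ac.symm, bc.symm]
    have sd : sideSign {c, d} (-ε) d = sideSign {a, b} ε d := by
      simp [sideSign, ad.symm, bd.symm]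
    have se : -sideSign {c, d} (-ε) e = sideSign {a, b} ε e := by
      simp [sideSign, ae.symm, be.symm, ce.symm, de.symm]
    have qa : q' a = q a := Function.update_of_ne ae _ _
    have qb : q' b = q b := Function.update_of_ne be _ _
    have qc : q' c = q c := Function.update_of_ne ce _ _
    have qd : q' d = q d := Function.update_of_ne de _ _
    have qe : q' e = fun u v => edgeInd a b u v + edgeInd c d u v - q e u v :=
      Function.update_self _ _ _
    rw [se, ← qe] at hI
    rw [qa, qb, qc, qd] at hS
    have r1 : ∀ vab vae, row c d b e ca da vab vae = row b c d e vab ca da vae := fun _ _ =>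
      row_rotate _ _ _ _ bc bd
    have r2 : ∀ vab vbe, row c d a e cb db vab vbe = row a c d e vab cb db vbe := fun _ _ =>
      row_rotate _ _ _ _ ac ad
    have r3 : ∀ vae vbe, row c d a b vce vde vae vbe = row a b c d vae vbe vce vde := fun _ _ => by
      rw [row_rotate _ _ _ _ ac ad, row_swap₃ _ _ _ _ bd.symm, row_swap₂ _ _ _ _ bc.symm]
    have r4 : ∀ vcd, row d a b e vcd ca cb vce = row a b d e ca cb vcd vce := fun _ => by
      rw [row_rotate _ _ _ _ ad.symm bd.symm]
    have r5 : ∀ vcd, row c a b e vcd da db vde = row a b c e da db vcd vde := fun _ => by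
      rw [row_rotate _ _ _ _ ac.symm bc.symm]
    simp only [r1, r2, r3, r4, r5, sa, sb, sc, sd]
    exact (sum_mul_of_inverse
      (P := fun vab vae => facetWeight (sideSign {a, b} ε a) y (q a) a (row b c d e vab ca da vae))
      (Q := fun vab vbe => facetWeight (sideSign {a, b} ε b) y (q b) b (row a c d e vab cb db vbe))
      (R := fun vcd vce => facetWeight (sideSign {a, b} ε c) y (q c) c (row a b d e ca cb vcd vce))
      (S := fun vcd vde => facetWeight (sideSign {a, b} ε d) y (q d) d (row a b c e da db vcd vde))
      (G := fun vae vbe vce vde =>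
        facetWeight (sideSign {a, b} ε e) y (q' e) e (row a b c d vae vbe vce vde))
      (fun vae vbe => hS ca da vae cb db vbe) (fun vce' vde' => hI vce vde vce' vde')).symm

end Relations

section AllPentagons

variable {N : ℕ} [NeZero N] {y : Fin 5 → Fin 5 → ℂ}

theorem facetWeight_one (q : Fin 5 → Fin 5 → ZMod N) (i : Fin 5) (r : Fin 5 → ZMod N) :
    facetWeight 1 y q i r =
      cSixJ N (y (i.succAbove 0) (i.succAbove 3) * y (i.succAbove 1) (i.succAbove 2))
        (y (i.succAbove 0) (i.succAbove 1) * y (i.succAbove 2) (i.succAbove 3))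
        (y (i.succAbove 0) (i.succAbove 2) * y (i.succAbove 1) (i.succAbove 3))
        (q (i.succAbove 0) (i.succAbove 1)) (q (i.succAbove 1) (i.succAbove 2))
        (r (i.succAbove 3)) (r (i.succAbove 1)) (r (i.succAbove 2)) (r (i.succAbove 0)) := by
  unfold facetWeight tetWeight
  exact if_pos rfl

theorem pentagonParams_of_balance (hy : SimplexParams N y) {q : Fin 5 → Fin 5 → Fin 5 → ZMod N}
    (hq : SimplexCharges q) (hb : ChargeBalance {1, 3} (edgeInd 1 3) q) :
    PentagonParams
      (fun i => (y (i.succAbove 0) (i.succAbove 3) * y (i.succAbove 1) (i.succAbove 2)) /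
        (y (i.succAbove 0) (i.succAbove 2) * y (i.succAbove 1) (i.succAbove 3)) *
          omegaPow N (-q i (i.succAbove 0) (i.succAbove 1)))
      (fun i => (y (i.succAbove 0) (i.succAbove 1) * y (i.succAbove 2) (i.succAbove 3)) /
        (y (i.succAbove 0) (i.succAbove 2) * y (i.succAbove 1) (i.succAbove 3)) *
          omegaPow N (q i (i.succAbove 1) (i.succAbove 2))) := by
  have hc : ({1, 3} : Finset (Fin 5))ᶜ = {0, 2, 4} := by decide
  have b23 := hb 2 3 (by decide)
  have b12 := hb 1 2 (by decide)
  have b04 := hb 0 4 (by decide)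
  have b01 := hb 0 1 (by decide)
  have b34 := hb 3 4 (by decide)
  rw [hc] at b23 b12 b04 b01 b34
  simp [facetCharge, edgeInd] at b23 b12 b04 b01 b34
  have o4 : q 4 0 1 = q 4 2 3 := hq.opp _ _ _ _ _ (by decide)
  have o2 : q 2 0 4 = q 2 1 3 := hq.opp _ _ _ _ _ (by decide)
  have o1 : q 1 0 4 = q 1 2 3 := hq.opp _ _ _ _ _ (by decide)
  have o3 : q 3 0 4 = q 3 1 2 := hq.opp _ _ _ _ _ (by decide)
  have o0 : q 0 3 4 = q 0 1 2 := hq.opp _ _ _ _ _ (by decide)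
  have o2' : q 2 3 4 = q 2 0 1 := hq.opp _ _ _ _ _ (by decide)
  have o1' : q 1 3 4 = q 1 0 2 := hq.opp _ _ _ _ _ (by decide)
  have hne : ∀ i j, i ≠ j → y i j ≠ 0 := hy.ne_zero
  have n01 := hne 0 1 (by decide)
  have n02 := hne 0 2 (by decide)
  have n03 := hne 0 3 (by decide)
  have n04 := hne 0 4 (by decide)
  have n12 := hne 1 2 (by decide)
  have n13 := hne 1 3 (by decide)
  have n14 := hne 1 4 (by decide)
  have n23 := hne 2 3 (by decide)
  have n24 := hne 2 4 (by decide)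
  have n34 := hne 3 4 (by decide)
  have combine : ∀ A B C D : ℂ, A = C → B = D → A * B = C * D := by
    rintro A B C D rfl rfl; rfl
  constructor
  · show (y 0 1 * y 3 4 / (y 0 3 * y 1 4) * omegaPow N (q 2 1 3)) *
        (y 1 4 * y 2 3 / (y 1 3 * y 2 4) * omegaPow N (-q 0 1 2)) *
        (y 0 3 * y 1 2 / (y 0 2 * y 1 3) * omegaPow N (-q 4 0 1)) =
        (y 1 2 * y 3 4 / (y 1 3 * y 2 4) * omegaPow N (q 0 2 3)) *
        (y 0 1 * y 2 3 / (y 0 2 * y 1 3) * omegaPow N (q 4 1 2))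
    have hω : omegaPow N (q 2 1 3) * omegaPow N (-q 0 1 2) * omegaPow N (-q 4 0 1) =
        omegaPow N (q 0 2 3) * omegaPow N (q 4 1 2) := by
      rw [← omegaPow_add, ← omegaPow_add, ← omegaPow_add]
      congr 1
      linear_combination -o2 + b04 + o1 + o3 - b23 - b12 - o4
    have hyy : (y 0 1 * y 3 4 / (y 0 3 * y 1 4)) * (y 1 4 * y 2 3 / (y 1 3 * y 2 4)) *
        (y 0 3 * y 1 2 / (y 0 2 * y 1 3)) = (y 1 2 * y 3 4 / (y 1 3 * y 2 4)) *
        (y 0 1 * y 2 3 / (y 0 2 * y 1 3)) := by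
      field_simp
    linear_combination combine _ _ _ _ hyy hω
  · show y 1 2 * y 3 4 / (y 1 3 * y 2 4) * omegaPow N (q 0 2 3) =
      (y 0 2 * y 3 4 / (y 0 3 * y 2 4) * omegaPow N (q 1 2 3)) *
        (y 0 3 * y 1 2 / (y 0 2 * y 1 3) * omegaPow N (-q 4 0 1))
    have hω : omegaPow N (q 0 2 3) = omegaPow N (q 1 2 3) * omegaPow N (-q 4 0 1) := by
      rw [← omegaPow_add]
      congr 1
      linear_combination b23 + o4
    have hyy : y 1 2 * y 3 4 / (y 1 3 * y 2 4) = y 0 2 * y 3 4 / (y 0 3 * y 2 4) *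
        (y 0 3 * y 1 2 / (y 0 2 * y 1 3)) := by
      field_simp
    linear_combination combine _ _ _ _ hyy hω
  · show y 0 1 * y 2 3 / (y 0 2 * y 1 3) * omegaPow N (q 4 1 2) =
      (y 0 1 * y 2 4 / (y 0 2 * y 1 4) * omegaPow N (q 3 1 2)) *
        (y 1 4 * y 2 3 / (y 1 3 * y 2 4) * omegaPow N (-q 0 1 2))
    have hω : omegaPow N (q 4 1 2) = omegaPow N (q 3 1 2) * omegaPow N (-q 0 1 2) := by
      rw [← omegaPow_add]
      congr 1
      linear_combination b12
    have hyy : y 0 1 * y 2 3 / (y 0 2 * y 1 3) = y 0 1 * y 2 4 / (y 0 2 * y 1 4) *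
        (y 1 4 * y 2 3 / (y 1 3 * y 2 4)) := by
      field_simp
    linear_combination combine _ _ _ _ hyy hω
  · show (y 0 4 * y 1 3 / (y 0 3 * y 1 4) * omegaPow N (-q 2 0 1)) *
      (y 0 1 * y 2 3 / (y 0 2 * y 1 3) * omegaPow N (q 4 1 2)) *
      (y 0 2 * y 3 4 / (y 0 3 * y 2 4) * omegaPow N (q 1 2 3)) =
      (y 0 1 * y 3 4 / (y 0 3 * y 1 4) * omegaPow N (q 2 1 3)) *
      (y 0 4 * y 2 3 / (y 0 3 * y 2 4) * omegaPow N (-q 1 0 2))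
    have hω : omegaPow N (-q 2 0 1) * omegaPow N (q 4 1 2) * omegaPow N (q 1 2 3) =
        omegaPow N (q 2 1 3) * omegaPow N (-q 1 0 2) := by
      rw [← omegaPow_add, ← omegaPow_add, ← omegaPow_add]
      congr 1
      linear_combination o2 - b04 - o1 - o3 + b12 - b34 + o2' + o0 - o1'
    have hyy : y 0 4 * y 1 3 / (y 0 3 * y 1 4) * (y 0 1 * y 2 3 / (y 0 2 * y 1 3)) *
        (y 0 2 * y 3 4 / (y 0 3 * y 2 4)) = y 0 1 * y 3 4 / (y 0 3 * y 1 4) *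
        (y 0 4 * y 2 3 / (y 0 3 * y 2 4)) := by
      field_simp
    linear_combination combine _ _ _ _ hyy hω
  · show (y 0 4 * y 1 3 / (y 0 3 * y 1 4) * omegaPow N (-q 2 0 1)) *
      (y 1 2 * y 3 4 / (y 1 3 * y 2 4) * omegaPow N (q 0 2 3)) *
      (y 0 1 * y 2 3 / (y 0 2 * y 1 3) * omegaPow N (q 4 1 2)) =
      (y 0 1 * y 3 4 / (y 0 3 * y 1 4) * omegaPow N (q 2 1 3)) *
      (y 0 4 * y 1 2 / (y 0 2 * y 1 4) * omegaPow N (-q 3 0 1)) *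
      (y 1 4 * y 2 3 / (y 1 3 * y 2 4) * omegaPow N (-q 0 1 2))
    have hω : omegaPow N (-q 2 0 1) * omegaPow N (q 0 2 3) * omegaPow N (q 4 1 2) =
        omegaPow N (q 2 1 3) * omegaPow N (-q 3 0 1) * omegaPow N (-q 0 1 2) := by
      rw [← omegaPow_add, ← omegaPow_add, ← omegaPow_add, ← omegaPow_add]
      congr 1
      linear_combination o2 - b04 - o1 - o3 + b12 + b23 - b01 + o4
    have hyy : y 0 4 * y 1 3 / (y 0 3 * y 1 4) * (y 1 2 * y 3 4 / (y 1 3 * y 2 4)) *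
        (y 0 1 * y 2 3 / (y 0 2 * y 1 3)) = y 0 1 * y 3 4 / (y 0 3 * y 1 4) *
        (y 0 4 * y 1 2 / (y 0 2 * y 1 4)) * (y 1 4 * y 2 3 / (y 1 3 * y 2 4)) := by
      field_simp
    linear_combination combine _ _ _ _ hyy hω

theorem pentagonRel_base (hN : Odd N) (hy : SimplexParams N y) :
    PentagonRel N y (-1) 1 3 0 2 4 := by
  intro q hq hb
  have hne : ∀ i j, i ≠ j → y i j ≠ 0 := hy.ne_zero
  have hsa : ∀ i : Fin 5, ∀ k l : Fin 4, k ≠ l → y (i.succAbove k) (i.succAbove l) ≠ 0 :=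
    fun i k l h => hne _ _ fun e => h (Fin.succAbove_right_injective e)
  obtain ⟨K, hK, hS⟩ := exists_core_pentagon hN
    (X := fun i => y (i.succAbove 0) (i.succAbove 3) * y (i.succAbove 1) (i.succAbove 2))
    (Y := fun i => y (i.succAbove 0) (i.succAbove 1) * y (i.succAbove 2) (i.succAbove 3))
    (Z := fun i => y (i.succAbove 0) (i.succAbove 2) * y (i.succAbove 1) (i.succAbove 3))
    (a := fun i => q i (i.succAbove 0) (i.succAbove 1))
    (c := fun i => q i (i.succAbove 1) (i.succAbove 2))
    hy.fermat
    (fun i => mul_ne_zero (hsa _ _ _ (by decide)) (hsa _ _ _ (by decide)))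
    (fun i => mul_ne_zero (hsa _ _ _ (by decide)) (hsa _ _ _ (by decide)))
    (fun i => mul_ne_zero (hsa _ _ _ (by decide)) (hsa _ _ _ (by decide)))
    (pentagonParams_of_balance hy hq hb)
  refine ⟨K, ?_, ?_⟩
  · rw [← hK]
    have e : y 1 3 * y 2 4 * (y 0 1 * y 2 3) * (y 0 4 * y 1 3) /
        (y 0 1 * y 2 4 * (y 0 4 * y 2 3)) = y 1 3 ^ 2 := by
      have n01 := hne 0 1 (by decide)
      have n04 := hne 0 4 (by decide)
      have n23 := hne 2 3 (by decide)
      have n24 := hne 2 4 (by decide)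
      field_simp
    have e2 : N - 1 = 2 * ((N - 1) / 2) := by
      obtain ⟨m, rfl⟩ := hN
      omega
    have e3 : y 1 3 ^ (N - 1) = (y 1 3 ^ 2) ^ ((N - 1) / 2) := by rw [← pow_mul, ← e2]
    rw [e3, ← e]
    rfl
  · intro s10 s12 s14 s30 s32 s34
    have h0 : sideSign {1, 3} (-1) 0 = 1 := by decide
    have h1 : sideSign {1, 3} (-1) 1 = 1 := by decide
    have h2 : sideSign {1, 3} (-1) 2 = 1 := by decide
    have h3 : sideSign {1, 3} (-1) 3 = 1 := by decide
    have h4 : sideSign {1, 3} (-1) 4 = 1 := by decide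
    rw [h0, h1, h2, h3, h4]
    simp only [facetWeight_one]
    exact hS s10 s30 s12 s14 s32 s34

namespace PentagonRel

variable {ε : ℤˣ} {a b c d e : Fin 5}

theorem swap₂ (hN : Odd N) (hy : SimplexParams N y) (hn : [a, b, c, d, e].Nodup)
    (h : PentagonRel N y ε a b c d e) : PentagonRel N y ε a c b d e := by
  have n1 : [a, b, d, e, c].Nodup := nodup_swap₄ (nodup_swap₃ hn)
  have h1 : PentagonRel N y ε a b d e c := (h.swap₃ hn).swap₄ (nodup_swap₃ hn)
  have h2 := h1.step hN hy n1
  have n2 := nodup_pairs n1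
  have h3 := h2.swap₄ n2
  have n3 := nodup_swap₄ n2
  have h4 := h3.step hN hy n3
  have n4 := nodup_pairs n3
  rw [neg_neg] at h4
  exact (h4.swap₄ n4).swap₃ (nodup_swap₄ n4)

theorem perm (hN : Odd N) (hy : SimplexParams N y) (π₀ : Equiv.Perm (Fin 5))
    (h : PentagonRel N y ε (π₀ 0) (π₀ 1) (π₀ 2) (π₀ 3) (π₀ 4)) (π : Equiv.Perm (Fin 5)) :
    PentagonRel N y ε (π 0) (π 1) (π 2) (π 3) (π 4) := by
  have key : ∀ σ : Equiv.Perm (Fin 5), PentagonRel N y ε ((π₀ * σ) 0) ((π₀ * σ) 1) ((π₀ * σ) 2)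
      ((π₀ * σ) 3) ((π₀ * σ) 4) := by
    intro σ
    induction σ using Submonoid.induction_of_closure_eq_top_right
      (Equiv.Perm.mclosure_swap_castSucc_succ 4) with
    | one => exact h
    | mul_right σ τ hτ ih =>
      obtain ⟨i, rfl⟩ := hτ
      have hn := List.Nodup.map (π₀ * σ).injective (by decide : [(0 : Fin 5), 1, 2, 3, 4].Nodup)
      rw [← mul_assoc]
      fin_cases i
      · exact ih.swap₁ hy hn
      · exact ih.swap₂ hN hy hn
      · exact ih.swap₃ hn
      · exact ih.swap₄ hn
  have := key (π₀⁻¹ * π)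
  rwa [mul_inv_cancel_left] at this

end PentagonRel

theorem exists_perm_of_nodup {a b c d e : Fin 5} (hn : [a, b, c, d, e].Nodup) :
    ∃ π : Equiv.Perm (Fin 5), π 0 = a ∧ π 1 = b ∧ π 2 = c ∧ π 3 = d ∧ π 4 = e := by
  have hinj : Function.Surjective ![a, b, c, d, e] := by
    intro v
    rcases eq_of_nodup_five hn v with rfl | rfl | rfl | rfl | rfl
    exacts [⟨0, rfl⟩, ⟨1, rfl⟩, ⟨2, rfl⟩, ⟨3, rfl⟩, ⟨4, rfl⟩]
  exact ⟨Equiv.ofBijective _ (Finite.surjective_iff_bijective.1 hinj), rfl, rfl, rfl, rfl, rfl⟩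

/-- All the pentagon relations. -/
theorem pentagonRel (hN : Odd N) (hy : SimplexParams N y) (ε : ℤˣ) {a b c d e : Fin 5}
    (hn : [a, b, c, d, e].Nodup) : PentagonRel N y ε a b c d e := by
  have h := pentagonRel_base hN hy
  have n0 : [(1 : Fin 5), 3, 0, 2, 4].Nodup := by decide
  obtain ⟨π, h0, h1, h2, h3, h4⟩ := exists_perm_of_nodup hn
  rw [← h0, ← h1, ← h2, ← h3, ← h4]
  rcases Int.units_eq_one_or ε with rfl | rfl
  · have h' := h.step hN hy n0
    obtain ⟨π₀, e0, e1, e2, e3, e4⟩ := exists_perm_of_nodup (nodup_pairs n0)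
    rw [neg_neg] at h'
    exact PentagonRel.perm hN hy π₀ (by rwa [e0, e1, e2, e3, e4]) π
  · obtain ⟨π₀, e0, e1, e2, e3, e4⟩ := exists_perm_of_nodup n0
    exact PentagonRel.perm hN hy π₀ (by rwa [e0, e1, e2, e3, e4]) π

theorem sum_comm_two {A B : Type*} [Fintype A] [Fintype B] (g : B → A → A → ℂ) :
    ∑ x, ∑ a, ∑ b, g x a b = ∑ a, ∑ b, ∑ x, g x a b := by
  rw [Finset.sum_comm]
  refine Finset.sum_congr rfl fun _ _ => ?_
  rw [Finset.sum_comm]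

theorem sum_cone_of_inverse {A : Type*} [Fintype A] [DecidableEq A] {W : A → ℂ}
    {R S T F : A → A → A → ℂ} {G : A → A → A → A → ℂ} {K K' : ℂ} {il₀ : A}
    (h₁ : ∀ jl kl lm, ∑ il, W il * G jl kl il lm =
      K * ∑ jk, ∑ jm, ∑ km, R jk jl jm * S jk kl km * T jm km lm)
    (h₂ : ∀ il lm, ∑ jl, ∑ kl, F jl kl lm * G jl kl il lm = if il₀ = il then K' else 0) :
    Fintype.card A * K' * W il₀ =
      K * ∑ jk, ∑ jl, ∑ jm, ∑ kl, ∑ km, ∑ lm,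
        R jk jl jm * S jk kl km * F jl kl lm * T jm km lm := by
  have e1 : ∑ lm, ∑ jl, ∑ kl, F jl kl lm * ∑ il, W il * G jl kl il lm =
      Fintype.card A * K' * W il₀ := by
    have : ∀ lm, ∑ jl, ∑ kl, F jl kl lm * ∑ il, W il * G jl kl il lm = K' * W il₀ := by
      intro lm
      calc _ = ∑ jl, ∑ kl, ∑ il, W il * (F jl kl lm * G jl kl il lm) := by
            refine Finset.sum_congr rfl fun _ _ => Finset.sum_congr rfl fun _ _ => ?_
            rw [Finset.mul_sum]
            exact Finset.sum_congr rfl fun _ _ => by ring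
        _ = ∑ il, ∑ jl, ∑ kl, W il * (F jl kl lm * G jl kl il lm) :=
            (sum_comm_two fun il jl kl => W il * (F jl kl lm * G jl kl il lm)).symm
        _ = ∑ il, W il * if il₀ = il then K' else 0 := by
            simp only [← Finset.mul_sum, h₂]
        _ = _ := by simp [mul_comm]
    simp only [this, Finset.sum_const, Finset.card_univ, nsmul_eq_mul, mul_assoc]
  rw [← e1, Finset.mul_sum]
  simp only [h₁]
  have e2 : ∀ lm, ∑ jl, ∑ kl, F jl kl lm *
      (K * ∑ jk, ∑ jm, ∑ km, R jk jl jm * S jk kl km * T jm km lm) =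
      K * ∑ jk, ∑ jl, ∑ jm, ∑ kl, ∑ km, R jk jl jm * S jk kl km * F jl kl lm * T jm km lm := by
    intro lm
    calc _ = ∑ jl, ∑ kl, ∑ jk, ∑ jm, ∑ km,
          K * (R jk jl jm * S jk kl km * F jl kl lm * T jm km lm) := by
          simp only [Finset.mul_sum]
          exact Finset.sum_congr rfl fun _ _ => Finset.sum_congr rfl fun _ _ =>
            Finset.sum_congr rfl fun _ _ => Finset.sum_congr rfl fun _ _ =>
            Finset.sum_congr rfl fun _ _ => by ring
      _ = ∑ jk, ∑ jl, ∑ kl, ∑ jm, ∑ km,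
          K * (R jk jl jm * S jk kl km * F jl kl lm * T jm km lm) :=
          (sum_comm_two fun jk jl kl => ∑ jm, ∑ km,
            K * (R jk jl jm * S jk kl km * F jl kl lm * T jm km lm)).symm
      _ = _ := by
          simp only [Finset.mul_sum]
          refine Finset.sum_congr rfl fun _ _ => Finset.sum_congr rfl fun _ _ => ?_
          rw [Finset.sum_comm]
  simp only [e2, ← Finset.mul_sum]
  congr 1
  rw [Finset.sum_comm]
  refine Finset.sum_congr rfl fun _ _ => ?_
  rw [Finset.sum_comm]
  refine Finset.sum_congr rfl fun _ _ => ?_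
  rw [Finset.sum_comm]
  refine Finset.sum_congr rfl fun _ _ => ?_
  rw [Finset.sum_comm]
  refine Finset.sum_congr rfl fun _ _ => ?_
  rw [Finset.sum_comm]

/-- The relation of the `1 → 4` move. -/
theorem exists_cone_relation (hN : Odd N) (hy : SimplexParams N y) (ε : ℤˣ) {i j k l m : Fin 5}
    (hn : [i, j, k, l, m].Nodup) {q : Fin 5 → Fin 5 → Fin 5 → ZMod N} (hq : SimplexCharges q)
    (hb : ChargeBalance {i} (fun u v => edgeInd j k u v + edgeInd i l u v + edgeInd i m u v) q) :
    ∃ K : ℂ, (K * (y j k * y i l * y i m) ^ (N - 1)) ^ N = 1 ∧ ∀ ij ik il im : ZMod N,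
      N * facetWeight (sideSign {i} ε i) y (q i) i (row j k l m ij ik il im) =
        K * ∑ jk, ∑ jl, ∑ jm, ∑ kl, ∑ km, ∑ lm,
          facetWeight (sideSign {i} ε j) y (q j) j (row i k l m ij jk jl jm) *
          facetWeight (sideSign {i} ε k) y (q k) k (row i j l m ik jk kl km) *
          facetWeight (sideSign {i} ε l) y (q l) l (row i j k m il jl kl lm) *
          facetWeight (sideSign {i} ε m) y (q m) m (row i j k l im jm km lm) := by
  obtain ⟨ij, ik, il, im, jk, jl, jm, kl, km, lm⟩ := ne_of_nodup_five hn
  have hn' : [j, k, i, m, l].Nodup :=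
    nodup_swap₄ (nodup_swap₂ (nodup_swap₁ hn))
  have hn2 : [i, l, j, k, m].Nodup := nodup_swap₂ (nodup_swap₃ hn)
  obtain ⟨K', hK', hI⟩ := exists_facetWeight_inverse hN hy hq (sideSign {i} ε l) hn'
  set q' := Function.update q l fun u v => edgeInd j k u v + edgeInd i m u v - q l u v with hq'
  have hb' : ChargeBalance {i, l} (edgeInd i l) q' := by
    intro u v huv
    have h1 := hb u v huv
    have hc : ({i} : Finset (Fin 5))ᶜ = {j, k, l, m} := by
      ext v
      simp only [Finset.mem_compl, Finset.mem_insert, Finset.mem_singleton]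
      constructor
      · intro h
        exact (eq_of_nodup_five hn v).resolve_left h
      · rintro (rfl | rfl | rfl | rfl)
        exacts [ij.symm, ik.symm, il.symm, im.symm]
    rw [hc, Finset.sum_insert (by simp [jk, jl, jm]), Finset.sum_insert (by simp [kl, km]),
      Finset.sum_pair lm, Finset.sum_singleton] at h1
    rw [compl_pair hn2, Finset.sum_insert (by simp [jk, jm]), Finset.sum_pair km,
      Finset.sum_pair il, sum_update_facetCharge jl, sum_update_facetCharge kl,
      sum_update_facetCharge lm.symm, sum_update_facetCharge il, facetCharge_inverse hn']
    linear_combination h1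
  obtain ⟨K, hK, hS⟩ := pentagonRel hN hy ε hn2 q' (hq.inverse hn') hb'
  have y1 : y j k ≠ 0 := hy.ne_zero _ _ jk
  have y2 : y i m ≠ 0 := hy.ne_zero _ _ im
  have hK0' : K' ≠ 0 := by
    rintro rfl
    rw [zero_pow (NeZero.ne N)] at hK'
    exact pow_ne_zero _ (pow_ne_zero _ (mul_ne_zero y1 y2)) hK'.symm
  refine ⟨K / K', ?_, ?_⟩
  · have e : K / K' * (y j k * y i l * y i m) ^ (N - 1) =
        K * y i l ^ (N - 1) * ((y j k * y i m) ^ (N - 1) / K') := by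
      rw [mul_pow, mul_pow, mul_pow]
      ring
    rw [e, mul_pow, hK, one_mul, div_pow, hK']
    exact div_self (pow_ne_zero _ (pow_ne_zero _ (mul_ne_zero y1 y2)))
  · intro vij vik vil vim
    have si : sideSign {i, l} ε i = sideSign {i} ε i := by simp [sideSign]
    have sj : sideSign {i, l} ε j = sideSign {i} ε j := by simp [sideSign, jl]
    have sk : sideSign {i, l} ε k = sideSign {i} ε k := by simp [sideSign, kl]
    have sm : sideSign {i, l} ε m = sideSign {i} ε m := by simp [sideSign, lm.symm]
    have sl : -sideSign {i} ε l = sideSign {i, l} ε l := by simp [sideSign, il.symm]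
    have qi : q' i = q i := Function.update_of_ne il _ _
    have qj : q' j = q j := Function.update_of_ne jl _ _
    have qk : q' k = q k := Function.update_of_ne kl _ _
    have qm : q' m = q m := Function.update_of_ne lm.symm _ _
    have ql : q' l = fun u v => edgeInd j k u v + edgeInd i m u v - q l u v :=
      Function.update_self _ _ _
    rw [sl, ← ql] at hI
    rw [qi, qj, qk, qm, si, sj, sk, sm] at hS
    have r1 : row j k l m vij vik vil vim = row l j k m vil vij vik vim :=
      row_rotate _ _ _ _ jl.symm kl.symm
    have r2 : ∀ vjk vjl vjm : ZMod N, row i k l m vij vjk vjl vjm = row i l k m vij vjl vjk vjm :=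
      fun _ _ _ => row_swap₂ _ _ _ _ kl
    have r3 : ∀ vjk vkl vkm : ZMod N, row i j l m vik vjk vkl vkm = row i l j m vik vkl vjk vkm :=
      fun _ _ _ => row_swap₂ _ _ _ _ jl
    have r4 : ∀ vjm vkm vlm : ZMod N, row i j k l vim vjm vkm vlm = row i l j k vim vlm vjm vkm :=
      fun _ _ _ => by rw [row_swap₃ _ _ _ _ kl, row_swap₂ _ _ _ _ jl]
    have r5 : ∀ u v p s : ZMod N, row j k i m u v p s = row i j k m p u v s :=
      fun _ _ _ _ => row_rotate _ _ _ _ ij ik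
    simp only [r5] at hI
    simp only [r1, r2, r3, r4]
    have hfin := sum_cone_of_inverse
      (W := fun vil => facetWeight (sideSign {i} ε i) y (q i) i (row l j k m vil vij vik vim))
      (R := fun vjk vjl vjm =>
        facetWeight (sideSign {i} ε j) y (q j) j (row i l k m vij vjl vjk vjm))
      (S := fun vjk vkl vkm =>
        facetWeight (sideSign {i} ε k) y (q k) k (row i l j m vik vkl vjk vkm))
      (T := fun vjm vkm vlm =>
        facetWeight (sideSign {i} ε m) y (q m) m (row i l j k vim vlm vjm vkm))
      (F := fun vjl vkl vlm =>
        facetWeight (sideSign {i} ε l) y (q l) l (row i j k m vil vjl vkl vlm))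
      (G := fun vjl vkl vil vlm =>
        facetWeight (sideSign {i, l} ε l) y (q' l) l (row i j k m vil vjl vkl vlm))
      (fun vjl vkl vlm => hS vij vik vim vjl vkl vlm)
      (fun vil' vlm => by simpa using hI vil vlm vil' vlm)
    rw [ZMod.card] at hfin
    rw [div_mul_eq_mul_div, eq_div_iff hK0', ← hfin]
    ring

end AllPentagons

section Embeddings

theorem range_pair {n : ℕ} {i j : Fin n} (h : i < j) : Set.range (pair i j h) = {i, j} := by
  ext v
  simp only [Set.mem_range, Set.mem_insert_iff, Set.mem_singleton_iff, Fin.exists_fin_two]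
  exact or_congr eq_comm eq_comm

theorem eq_pair {n : ℕ} (φ : Fin 2 ↪o Fin n) :
    φ = pair (φ 0) (φ 1) (φ.strictMono Fin.zero_lt_one) := by
  ext a
  fin_cases a <;> rfl

theorem pair_trans {n m : ℕ} {i j : Fin n} (h : i < j) (ψ : Fin n ↪o Fin m) :
    (pair i j h).trans ψ = pair (ψ i) (ψ j) (ψ.strictMono h) := by
  ext a
  fin_cases a <;> rfl

theorem orderEmb_ext {k n : ℕ} {φ ψ : Fin k ↪o Fin n} (h : Set.range φ = Set.range ψ) : φ = ψ :=
  OrderEmbedding.range_inj.1 h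

theorem range_opp {n : ℕ} (i : Fin (n + 1)) : Set.range (opp i) = {i}ᶜ :=
  Fin.range_succAbove i

theorem opp_apply {n : ℕ} (i : Fin (n + 1)) (k : Fin n) : opp i k = i.succAbove k := rfl

theorem trans_opp_injective {k n : ℕ} {i : Fin (n + 1)} {φ ψ : Fin k ↪o Fin n}
    (h : φ.trans (opp i) = ψ.trans (opp i)) : φ = ψ := by
  ext a
  have := congrArg (fun f : Fin k ↪o Fin (n + 1) => f a) h
  exact congrArg Fin.val ((opp i).injective this)

theorem notMem_range_trans_opp {k n : ℕ} {i : Fin (n + 1)} (ψ : Fin k ↪o Fin n) :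
    i ∉ Set.range (ψ.trans (opp i)) := by
  rintro ⟨a, h⟩
  exact Fin.succAbove_ne i (ψ a) h

theorem exists_trans_opp {k n : ℕ} {i : Fin (n + 1)} {φ : Fin k ↪o Fin (n + 1)}
    (h : i ∉ Set.range φ) : ∃ ψ : Fin k ↪o Fin n, ψ.trans (opp i) = φ := by
  have h1 : ∀ a, ∃ b, i.succAbove b = φ a := fun a =>
    Fin.exists_succAbove_eq fun e => h ⟨a, e⟩
  choose f hf using h1
  refine ⟨OrderEmbedding.ofStrictMono f fun a b hab => ?_, ?_⟩
  · rw [← (Fin.strictMono_succAbove i).lt_iff_lt, hf, hf]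
    exact φ.strictMono hab
  · ext a
    exact congrArg Fin.val (hf a)

/-- The value at the edge with ends `u` and `v` of a function on ordered edges. -/
def edgeVal {n : ℕ} {A : Type*} [Zero A] (f : (Fin 2 ↪o Fin n) → A) (u v : Fin n) : A :=
  if h : u < v then f (pair u v h) else if h : v < u then f (pair v u h) else 0

section EdgeVal

variable {n : ℕ} {A : Type*} [Zero A] (f : (Fin 2 ↪o Fin n) → A)

theorem edgeVal_of_lt {u v : Fin n} (h : u < v) : edgeVal f u v = f (pair u v h) := dif_pos h

theorem edgeVal_symm (u v : Fin n) : edgeVal f u v = edgeVal f v u := by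
  rcases lt_trichotomy u v with h | rfl | h
  · rw [edgeVal_of_lt f h, edgeVal, dif_neg h.not_gt, dif_pos h]
  · rfl
  · rw [edgeVal_of_lt f h, edgeVal, dif_neg h.not_gt, dif_pos h]

theorem edgeVal_trans {m : ℕ} (ψ : Fin m ↪o Fin n) (u v : Fin m) :
    edgeVal f (ψ u) (ψ v) = edgeVal (fun φ => f (φ.trans ψ)) u v := by
  rcases lt_trichotomy u v with h | rfl | h
  · rw [edgeVal_of_lt f (ψ.strictMono h), edgeVal_of_lt _ h, pair_trans]
  · simp [edgeVal]
  · rw [edgeVal_symm f, edgeVal_symm _ u v, edgeVal_of_lt f (ψ.strictMono h), edgeVal_of_lt _ h,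
      pair_trans]

theorem exists_edge {u v : Fin n} (h : u ≠ v) : ∃ φ : Fin 2 ↪o Fin n, Set.range φ = {u, v} := by
  rcases lt_or_gt_of_ne h with h | h
  · exact ⟨_, range_pair h⟩
  · exact ⟨_, (range_pair h).trans (Set.pair_comm _ _)⟩

theorem edgeVal_eq {φ : Fin 2 ↪o Fin n} {u v : Fin n} (h : Set.range φ = {u, v}) :
    edgeVal f u v = f φ := by
  rcases lt_trichotomy u v with h' | rfl | h'
  · rw [edgeVal_of_lt f h', orderEmb_ext ((range_pair h').trans h.symm)]
  · have h0 : φ 0 ∈ ({u, u} : Set (Fin n)) := h ▸ ⟨0, rfl⟩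
    have h1 : φ 1 ∈ ({u, u} : Set (Fin n)) := h ▸ ⟨1, rfl⟩
    have := φ.injective ((by simpa using h0 : φ 0 = u).trans (by simpa using h1 : φ 1 = u).symm)
    exact absurd this (by decide)
  · rw [edgeVal_symm, edgeVal_of_lt f h',
      orderEmb_ext ((range_pair h').trans ((Set.pair_comm _ _).trans h.symm))]

end EdgeVal

theorem sum_pairs_three {A : Type*} [AddCommMonoid A] (f : (Fin 2 ↪o Fin 3) → A) :
    ∑ φ, f φ = f (pair 0 1 (by decide)) + f (pair 0 2 (by decide)) + f (pair 1 2 (by decide)) := by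
  have h : (Finset.univ : Finset (Fin 2 ↪o Fin 3)) =
      {pair 0 1 (by decide), pair 0 2 (by decide), pair 1 2 (by decide)} := by
    ext φ
    simp only [Finset.mem_univ, Finset.mem_insert, Finset.mem_singleton, true_iff]
    have key : ∀ (a b : Fin 3) (h : a < b), pair a b h = pair 0 1 (by decide) ∨
        pair a b h = pair 0 2 (by decide) ∨ pair a b h = pair 1 2 (by decide) := by
      intro a b h
      fin_cases a <;> fin_cases b <;> first | exact absurd h (by decide) | simp
    rw [eq_pair φ]
    exact key _ _ _
  have ne : ∀ {i j k l : Fin 3} (h : i < j) (h' : k < l), (i, j) ≠ (k, l) →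
      pair i j h ≠ pair k l h' := fun h h' hne e =>
    hne (Prod.ext (congrArg (fun φ : Fin 2 ↪o Fin 3 => φ 0) e)
      (congrArg (fun φ : Fin 2 ↪o Fin 3 => φ 1) e))
  rw [h, Finset.sum_insert, Finset.sum_insert, Finset.sum_singleton, add_assoc]
  · simpa using ne _ _ (by decide)
  · simp only [Finset.mem_insert, Finset.mem_singleton, not_or]
    exact ⟨ne _ _ (by decide), ne _ _ (by decide)⟩

end Embeddings

namespace DecoratedTriangulation

variable (T : DecoratedTriangulation)

/-- The `N`-th roots of the cocycle on the edges of a tetrahedron. -/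
noncomputable def tetRoot (d : ℂ → ℂ) (t : T.cell 3) : Fin 4 → Fin 4 → ℂ :=
  edgeVal fun φ => d (T.x (T.res φ t))

/-- The charges modulo `N` on the edges of a tetrahedron. -/
def tetCharge (N : ℕ) [NeZero N] (t : T.cell 3) : Fin 4 → Fin 4 → ZMod N :=
  edgeVal fun φ => (T.charge t φ : ZMod N) * half N

theorem tetSymbol_eq (N : ℕ) [NeZero N] (d : ℂ → ℂ) (α : T.cell 2 → ZMod N) (t : T.cell 3) :
    T.tetSymbol N d α t = tetWeight (T.index t) (T.tetRoot d t) (T.tetCharge N t)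
      fun k => α (T.res (opp k) t) := by
  have h01 : (0 : Fin 4) < 1 := by decide
  have h02 : (0 : Fin 4) < 2 := by decide
  have h03 : (0 : Fin 4) < 3 := by decide
  have h12 : (1 : Fin 4) < 2 := by decide
  have h13 : (1 : Fin 4) < 3 := by decide
  have h23 : (2 : Fin 4) < 3 := by decide
  simp only [tetSymbol, tetWeight, tetRoot, tetCharge, edgeVal_of_lt _ h01, edgeVal_of_lt _ h02,
    edgeVal_of_lt _ h03, edgeVal_of_lt _ h12, edgeVal_of_lt _ h13, edgeVal_of_lt _ h23, yy,
    chargeMod]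

theorem tetSymbol_congr (N : ℕ) [NeZero N] (d : ℂ → ℂ) {T T' : DecoratedTriangulation}
    {α : T.cell 2 → ZMod N} {α' : T'.cell 2 → ZMod N} {t : T.cell 3} {t' : T'.cell 3}
    (hi : T.index t = T'.index t') (hz : ∀ φ : Fin 2 ↪o Fin 4, T.z (T.res φ t) = T'.z (T'.res φ t'))
    (hc : T.charge t = T'.charge t')
    (hα : ∀ k : Fin 4, α (T.res (opp k) t) = α' (T'.res (opp k) t')) :
    T.tetSymbol N d α t = T'.tetSymbol N d α' t' := by
  simp only [tetSymbol, yy, chargeMod, x, hi, hz, hc, hα]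

theorem root_pow {N : ℕ} {d : ℂ → ℂ} (hd : T.RootHolds N d) (e : T.cell 1) :
    d (T.x e) ^ N = T.x e := hd e 0 1 (T.z_full e)

theorem root_ne_zero {N : ℕ} [NeZero N] {d : ℂ → ℂ} (hd : T.RootHolds N d) (e : T.cell 1) :
    d (T.x e) ≠ 0 := by
  intro h
  have := T.root_pow hd e
  rw [h, zero_pow (NeZero.ne N)] at this
  exact T.z_full e this.symm

theorem x_relation (f : T.cell 2) :
    T.x (T.res (pair 0 2 (by decide)) f) =
      T.z (T.res (pair 0 1 (by decide)) f) 0 0 * T.x (T.res (pair 1 2 (by decide)) f) +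
      T.x (T.res (pair 0 1 (by decide)) f) * T.z (T.res (pair 1 2 (by decide)) f) 1 1 := by
  rw [x, T.z_cocycle f]
  simp [Matrix.mul_apply, Fin.sum_univ_two, x]

theorem z_diag (e : T.cell 1) : T.z e 0 0 * T.z e 1 1 = 1 := by
  have := (T.z e).det_coe
  rw [Matrix.det_fin_two, T.z_upper e, mul_zero, sub_zero] at this
  exact this

theorem z_diag_mul (f : T.cell 2) (i : Fin 2) :
    T.z (T.res (pair 0 2 (by decide)) f) i i =
      T.z (T.res (pair 0 1 (by decide)) f) i i * T.z (T.res (pair 1 2 (by decide)) f) i i := by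
  rw [T.z_cocycle f]
  fin_cases i <;> simp [Matrix.mul_apply, Fin.sum_univ_two, T.z_upper]

theorem res_pair_res (t : T.cell 3) (ψ : Fin 3 ↪o Fin 4) {i j : Fin 3} (h : i < j) :
    T.res (pair i j h) (T.res ψ t) = T.res (pair (ψ i) (ψ j) (ψ.strictMono h)) t := by
  rw [← T.res_comp, pair_trans]

theorem ptolemy (t : T.cell 3) :
    T.x (T.res (pair 0 3 (by decide)) t) * T.x (T.res (pair 1 2 (by decide)) t) +
      T.x (T.res (pair 0 1 (by decide)) t) * T.x (T.res (pair 2 3 (by decide)) t) =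
      T.x (T.res (pair 0 2 (by decide)) t) * T.x (T.res (pair 1 3 (by decide)) t) := by
  have h3 := T.x_relation (T.res (opp 3) t)
  have h1 := T.x_relation (T.res (opp 1) t)
  have h0 := T.x_relation (T.res (opp 0) t)
  have d3 := T.z_diag_mul (T.res (opp 3) t) 0
  simp only [res_pair_res] at h3 h1 h0 d3
  change T.x (T.res (pair 0 2 _) t) = T.z (T.res (pair 0 1 _) t) 0 0 * T.x (T.res (pair 1 2 _) t) +
    T.x (T.res (pair 0 1 _) t) * T.z (T.res (pair 1 2 _) t) 1 1 at h3
  change T.x (T.res (pair 0 3 _) t) = T.z (T.res (pair 0 2 _) t) 0 0 * T.x (T.res (pair 2 3 _) t) +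
    T.x (T.res (pair 0 2 _) t) * T.z (T.res (pair 2 3 _) t) 1 1 at h1
  change T.x (T.res (pair 1 3 _) t) = T.z (T.res (pair 1 2 _) t) 0 0 * T.x (T.res (pair 2 3 _) t) +
    T.x (T.res (pair 1 2 _) t) * T.z (T.res (pair 2 3 _) t) 1 1 at h0
  change T.z (T.res (pair 0 2 _) t) 0 0 = T.z (T.res (pair 0 1 _) t) 0 0 *
    T.z (T.res (pair 1 2 _) t) 0 0 at d3
  have e := T.z_diag (T.res (pair 1 2 (by decide)) t)
  rw [h1, h0, d3, h3]
  linear_combination (-T.x (T.res (pair 0 1 (by decide)) t) *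
    T.x (T.res (pair 2 3 (by decide)) t)) * e

theorem tetParams_tetRoot {N : ℕ} [NeZero N] {d : ℂ → ℂ} (hd : T.RootHolds N d) (t : T.cell 3) :
    TetParams N (T.tetRoot d t) where
  symm := edgeVal_symm _
  ne_zero i j h := by
    obtain ⟨φ, hφ⟩ := exists_edge h
    rw [tetRoot, edgeVal_eq _ hφ]
    exact T.root_ne_zero hd _
  fermat := by
    have h01 : (0 : Fin 4) < 1 := by decide
    have h02 : (0 : Fin 4) < 2 := by decide
    have h03 : (0 : Fin 4) < 3 := by decide
    have h12 : (1 : Fin 4) < 2 := by decide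
    have h13 : (1 : Fin 4) < 3 := by decide
    have h23 : (2 : Fin 4) < 3 := by decide
    simp only [tetRoot, edgeVal_of_lt _ h01, edgeVal_of_lt _ h02, edgeVal_of_lt _ h03,
      edgeVal_of_lt _ h12, edgeVal_of_lt _ h13, edgeVal_of_lt _ h23, mul_pow, T.root_pow hd]
    exact T.ptolemy t

/-- The integral charges on the edges of a tetrahedron. -/
def intCharge (t : T.cell 3) : Fin 4 → Fin 4 → ℤ := edgeVal (T.charge t)

theorem tetCharge_eq (N : ℕ) [NeZero N] (t : T.cell 3) (i j : Fin 4) :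
    T.tetCharge N t i j = (T.intCharge t i j : ZMod N) * half N := by
  simp only [tetCharge, intCharge, edgeVal]
  split_ifs <;> simp

theorem intCharge_sum (t : T.cell 3) (ψ : Fin 3 ↪o Fin 4) :
    T.intCharge t (ψ 0) (ψ 1) + T.intCharge t (ψ 0) (ψ 2) + T.intCharge t (ψ 1) (ψ 2) = 1 := by
  have h := T.charge_face t ψ
  rw [sum_pairs_three] at h
  have h01 : (0 : Fin 3) < 1 := by decide
  have h02 : (0 : Fin 3) < 2 := by decide
  have h12 : (1 : Fin 3) < 2 := by decide
  simp only [intCharge, edgeVal_trans, edgeVal_of_lt _ h01, edgeVal_of_lt _ h02,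
    edgeVal_of_lt _ h12]
  exact h

theorem intCharge_sums (t : T.cell 3) {i j k l : Fin 4} (hij : i ≠ j) (hik : i ≠ k) (hil : i ≠ l)
    (hjk : j ≠ k) (hjl : j ≠ l) (hkl : k ≠ l) :
    T.intCharge t i j = T.intCharge t k l ∧
      T.intCharge t i j + T.intCharge t i k + T.intCharge t j k = 1 := by
  have s : ∀ u v, T.intCharge t u v = T.intCharge t v u := edgeVal_symm _
  have h3 : T.intCharge t 0 1 + T.intCharge t 0 2 + T.intCharge t 1 2 = 1 :=
    T.intCharge_sum t (opp 3)
  have h2 : T.intCharge t 0 1 + T.intCharge t 0 3 + T.intCharge t 1 3 = 1 :=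
    T.intCharge_sum t (opp 2)
  have h1 : T.intCharge t 0 2 + T.intCharge t 0 3 + T.intCharge t 2 3 = 1 :=
    T.intCharge_sum t (opp 1)
  have h0 : T.intCharge t 1 2 + T.intCharge t 1 3 + T.intCharge t 2 3 = 1 :=
    T.intCharge_sum t (opp 0)
  have s10 := s 1 0
  have s20 := s 2 0
  have s30 := s 3 0
  have s21 := s 2 1
  have s31 := s 3 1
  have s32 := s 3 2
  fin_cases i <;> fin_cases j <;> first | exact absurd rfl hij | skip
  all_goals
    fin_cases k <;> first | exact absurd rfl hik | exact absurd rfl hjk | skip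
  all_goals
    fin_cases l <;>
      first | exact absurd rfl hil | exact absurd rfl hjl | exact absurd rfl hkl | skip
  all_goals
    simp only [Fin.zero_eta, Fin.mk_one, Fin.reduceFinMk]
    omega

theorem tetCharges_tetCharge (N : ℕ) [NeZero N] (t : T.cell 3) :
    TetCharges (T.tetCharge N t) where
  symm := edgeVal_symm _
  opp i j k l hij hik hil hjk hjl hkl := by
    rw [tetCharge_eq, tetCharge_eq, (T.intCharge_sums t hij hik hil hjk hjl hkl).1]

end DecoratedTriangulation

section Covers

/-- The map `L` enumerates the elements with the property `P`. -/
structure Covers {C ι : Type*} (P : C → Prop) (L : ι → C) : Prop where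
  inj : Function.Injective L
  iff : ∀ c, P c ↔ ∃ k, L k = c

namespace Covers

variable {C ι : Type*} {P : C → Prop} {L : ι → C}

theorem mem (h : Covers P L) (k : ι) : P (L k) := (h.iff _).2 ⟨k, rfl⟩

open Classical in
/-- The function with values `v` on the enumerated elements and `β` on the others. -/
noncomputable def glue {A : Type*} (h : Covers P L) (β : {c // ¬ P c} → A) (v : ι → A) (c : C) :
    A :=
  if hc : P c then v ((h.iff c).1 hc).choose else β ⟨c, hc⟩

variable {A : Type*}

theorem glue_apply (h : Covers P L) (β : {c // ¬ P c} → A) (v : ι → A) (k : ι) :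
    h.glue β v (L k) = v k := by
  rw [glue, dif_pos (h.mem k)]
  exact congrArg v (h.inj ((h.iff (L k)).1 (h.mem k)).choose_spec)

theorem glue_out (h : Covers P L) (β : {c // ¬ P c} → A) (v : ι → A) {c : C} (hc : ¬ P c) :
    h.glue β v c = β ⟨c, hc⟩ := dif_neg hc

/-- A function is determined by its values inside and outside. -/
noncomputable def splitEquiv (h : Covers P L) (A : Type*) :
    (C → A) ≃ ({c // ¬ P c} → A) × (ι → A) where
  toFun α := (fun c => α c, fun k => α (L k))
  invFun p := h.glue p.1 p.2
  left_inv α := by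
    ext c
    by_cases hc : P c
    · obtain ⟨k, rfl⟩ := (h.iff c).1 hc
      exact h.glue_apply _ _ _
    · exact h.glue_out _ _ hc
  right_inv p := by
    ext c
    · exact h.glue_out _ _ c.2
    · exact h.glue_apply _ _ _

open Classical in
theorem sum_glue [Fintype C] [Fintype ι] [DecidableEq ι] [Fintype A] {B : Type*} [AddCommMonoid B]
    (h : Covers P L)
    (G : (C → A) → B) :
    ∑ α, G α = ∑ β : {c // ¬ P c} → A, ∑ v : ι → A, G (h.glue β v) := by
  rw [← Fintype.sum_prod_type' (f := fun β v => G (h.glue β v))]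
  exact Fintype.sum_equiv (h.splitEquiv A) _ _ fun α =>
    congrArg G ((h.splitEquiv A).symm_apply_apply α).symm

open Classical in
@[to_additive]
theorem prod_eq [Fintype C] [Fintype ι] {B : Type*} [CommMonoid B] (h : Covers P L) (g : C → B) :
    ∏ c, g c = (∏ k, g (L k)) * ∏ c : {c // ¬ P c}, g c := by
  rw [← Fintype.prod_subtype_mul_prod_subtype P g]
  congr 1
  symm
  refine Fintype.prod_bijective (fun k => (⟨L k, h.mem k⟩ : {c // P c})) ⟨?_, ?_⟩ _ _ fun _ => rfl
  · exact fun a b e => h.inj (congrArg Subtype.val e)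
  · rintro ⟨c, hc⟩
    obtain ⟨k, hk⟩ := (h.iff c).1 hc
    exact ⟨k, Subtype.ext hk⟩

open Classical in
theorem card_eq [Fintype C] [Fintype ι] (h : Covers P L) :
    Fintype.card C = Fintype.card ι + Fintype.card {c // ¬ P c} := by
  have := h.sum_eq fun _ => 1
  simpa only [Finset.sum_const, Finset.card_univ, smul_eq_mul, mul_one] using this

end Covers

theorem exists_equiv_of_rel {C C' : Type*} {P : C → Prop} {P' : C' → Prop} {R : C → C' → Prop}
    (hR : ∀ c c', R c c' → ¬ P c ∧ ¬ P' c') (hl : ∀ c, ¬ P c → ∃! c', R c c')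
    (hr : ∀ c', ¬ P' c' → ∃! c, R c c') :
    ∃ e : {c // ¬ P c} ≃ {c' // ¬ P' c'}, ∀ c, R c.1 (e c).1 := by
  choose f hf using fun c : {c // ¬ P c} => (hl c.1 c.2).exists
  choose g hg using fun c' : {c' // ¬ P' c'} => (hr c'.1 c'.2).exists
  refine ⟨⟨fun c => ⟨f c, (hR _ _ (hf c)).2⟩, fun c' => ⟨g c', (hR _ _ (hg c')).1⟩, ?_, ?_⟩, hf⟩
  · intro c
    exact Subtype.ext ((hr _ (hR _ _ (hf c)).2).unique (hg ⟨f c, _⟩) (hf c))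
  · intro c'
    exact Subtype.ext ((hl _ (hR _ _ (hg c')).1).unique (hf ⟨g c', _⟩) (hg c'))

variable {A B : Type*} [Fintype A] [AddCommMonoid B]

theorem sum_fin_succ {n : ℕ} (f : (Fin (n + 1) → A) → B) :
    ∑ v, f v = ∑ a, ∑ v : Fin n → A, f (Matrix.vecCons a v) := by
  rw [← Fintype.sum_prod_type' (f := fun a (v : Fin n → A) => f (Matrix.vecCons a v))]
  exact (Fintype.sum_equiv (Fin.consEquiv fun _ => A) _ _ fun _ => rfl).symm

theorem sum_fin_one (f : (Fin 1 → A) → B) : ∑ v, f v = ∑ a, f ![a] := by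
  simp only [sum_fin_succ, Fintype.sum_unique]
  exact Finset.sum_congr rfl fun a _ => congrArg f (congrArg _ (Subsingleton.elim _ _))

theorem sum_fin_two (f : (Fin 2 → A) → B) : ∑ v, f v = ∑ a, ∑ b, f ![a, b] := by
  rw [sum_fin_succ]
  exact Finset.sum_congr rfl fun a _ => sum_fin_one _

theorem sum_fin_three (f : (Fin 3 → A) → B) : ∑ v, f v = ∑ a, ∑ b, ∑ c, f ![a, b, c] := by
  rw [sum_fin_succ]
  exact Finset.sum_congr rfl fun a _ => sum_fin_two _

theorem sum_fin_six (f : (Fin 6 → A) → B) :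
    ∑ v, f v = ∑ a, ∑ b, ∑ c, ∑ a', ∑ b', ∑ c', f ![a, b, c, a', b', c'] := by
  rw [sum_fin_succ]
  refine Finset.sum_congr rfl fun a _ => ?_
  rw [sum_fin_succ]
  refine Finset.sum_congr rfl fun b _ => ?_
  rw [sum_fin_succ]
  exact Finset.sum_congr rfl fun c _ => sum_fin_three _

end Covers

section Ball

variable {X : BranchedComplex} {S : Finset (Fin 5)} {τ : S → X.cell 3}

theorem exists_image {k : ℕ} {φ : Fin (k + 1) ↪o Fin 5} (h : InBall S φ) :
    ∃ c, IsImage X S τ φ c := by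
  obtain ⟨i, hi, hφ⟩ := h
  obtain ⟨ψ, hψ⟩ := exists_trans_opp hφ
  exact ⟨_, ⟨i, hi⟩, ψ, hψ, rfl⟩

theorem isInner_iff {k : ℕ} {φ : Fin (k + 1) ↪o Fin 5} :
    IsInner S φ ↔ InBall S φ ∧ ∀ i, i ∉ Set.range φ → i ∈ S := by
  refine and_congr_right fun _ => ⟨fun h i hi => ?_, fun h => ?_⟩
  · by_contra hS
    exact h ⟨i, Finset.mem_compl.2 hS, hi⟩
  · rintro ⟨i, hi, hφ⟩
    exact Finset.mem_compl.1 hi (h i hφ)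

theorem isInner_opp {i : Fin 5} (hi : i ∈ S) : IsInner S (opp i) := by
  rw [isInner_iff, range_opp]
  refine ⟨⟨i, hi, ?_⟩, fun j hj => ?_⟩
  · rw [range_opp]; simp
  · simp only [Set.mem_compl_iff, Set.mem_singleton_iff, not_not] at hj
    exact hj ▸ hi

theorem isImage_opp (i : S) : IsImage X S τ (opp i.1) (τ i) :=
  ⟨i, RelEmbedding.refl _, rfl, X.res_id _⟩

theorem isImage_trans {k : ℕ} (i : S) (ψ : Fin (k + 1) ↪o Fin 4) :
    IsImage X S τ (ψ.trans (opp i.1)) (X.res ψ (τ i)) := ⟨i, ψ, rfl, rfl⟩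

namespace IsBall

theorem covers (hB : IsBall X S τ) {k : ℕ} {ι : Type*} {Φ : ι → (Fin (k + 1) ↪o Fin 5)}
    (hinj : Function.Injective Φ) (hΦ : ∀ φ, IsInner S φ ↔ ∃ n, Φ n = φ) {L : ι → X.cell k}
    (hL : ∀ n, IsImage X S τ (Φ n) (L n)) : Covers (InnerCell X S τ (k := k)) L where
  inj a b h := hinj (hB.inner_injective _ _ _ ((hΦ _).2 ⟨a, rfl⟩) (hL a) (h ▸ hL b))
  iff c := by
    constructor
    · rintro ⟨φ, hφ, hc⟩
      obtain ⟨n, rfl⟩ := (hΦ φ).1 hφ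
      exact ⟨n, hB.wellDefined _ _ _ (hL n) hc⟩
    · rintro ⟨n, rfl⟩
      exact ⟨Φ n, (hΦ _).2 ⟨n, rfl⟩, hL n⟩

theorem covers_tet (hB : IsBall X S τ) : Covers (InnerCell X S τ (k := 3)) τ := by
  refine hB.covers (Φ := fun i : S => opp i.1) ?_ (fun φ => ⟨fun h => ?_, ?_⟩) isImage_opp
  · intro i j h
    have h' : Set.range (opp i.1) = Set.range (opp j.1) :=
      congrArg (fun φ : Fin 4 ↪o Fin 5 => Set.range φ) h
    rw [range_opp, range_opp, compl_inj_iff, Set.singleton_eq_singleton_iff] at h'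
    exact Subtype.ext h'
  · obtain ⟨i, hi, hφ⟩ := h.1
    obtain ⟨ψ, hψ⟩ := exists_trans_opp hφ
    refine ⟨⟨i, hi⟩, ?_⟩
    have hr : Set.range ψ = Set.range (RelEmbedding.refl (α := Fin 4) (· ≤ ·)) :=
      (Finite.injective_iff_surjective.1 ψ.injective).range_eq.trans
        Function.surjective_id.range_eq.symm
    rw [← hψ, orderEmb_ext hr]
    rfl
  · rintro ⟨i, rfl⟩
    exact isInner_opp i.2

theorem not_innerCell (hB : IsBall X S τ) {k : ℕ} {φ : Fin (k + 1) ↪o Fin 5} {c : X.cell k}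
    (hc : IsImage X S τ φ c) (hφ : InBall Sᶜ φ) : ¬ InnerCell X S τ c := by
  rintro ⟨ψ, hψ, hc'⟩
  rw [hB.inner_injective _ _ _ hψ hc' hc] at hψ
  exact hψ.2 hφ

end IsBall

theorem exists_complement (φ : Fin 3 ↪o Fin 5) :
    ∃ z : Sym2 (Fin 5), ¬ z.IsDiag ∧ Set.range φ = {x | x ∉ z} := by
  have h : ((Finset.univ.map φ.toEmbedding)ᶜ : Finset (Fin 5)).card = 2 := by
    rw [Finset.card_compl, Finset.card_map]
    rfl
  obtain ⟨a, b, hab, h⟩ := Finset.card_eq_two.1 h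
  refine ⟨s(a, b), by simpa using hab, ?_⟩
  ext x
  have hx : x ∈ ((Finset.univ.map φ.toEmbedding)ᶜ : Finset (Fin 5)) ↔
      x ∈ ({a, b} : Finset (Fin 5)) := by rw [h]
  simp only [Finset.mem_compl, Finset.mem_map, Finset.mem_univ, true_and, Finset.mem_insert,
    Finset.mem_singleton] at hx
  rw [Set.mem_ofPred_eq, Sym2.mem_iff, ← hx, not_not]
  rfl

theorem exists_face {z : Sym2 (Fin 5)} (hz : ¬ z.IsDiag) :
    ∃ φ : Fin 3 ↪o Fin 5, Set.range φ = {x | x ∉ z} := by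
  induction z using Sym2.ind with
  | _ a b =>
    obtain ⟨k, hk⟩ := Fin.exists_succAbove_eq (x := b) (y := a) (by simpa [eq_comm] using hz)
    refine ⟨(opp k).trans (opp a), ?_⟩
    ext x
    simp only [Set.mem_range, Set.mem_ofPred_eq, Sym2.mem_iff, not_or]
    constructor
    · rintro ⟨n, rfl⟩
      refine ⟨Fin.succAbove_ne _ _, fun e => ?_⟩
      rw [← hk] at e
      exact Fin.succAbove_ne k n (Fin.succAbove_right_injective e)
    · rintro ⟨ha, hb⟩
      obtain ⟨m, rfl⟩ := Fin.exists_succAbove_eq ha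
      obtain ⟨n, rfl⟩ := Fin.exists_succAbove_eq (x := m) (y := k) fun e => hb (by rw [e, hk])
      exact ⟨n, rfl⟩

theorem sym2_ext_of_compl {z w : Sym2 (Fin 5)} (h : {x | x ∉ z} = {x | x ∉ w}) : z = w :=
  Sym2.ext fun x => not_iff_not.1 (Set.ext_iff.1 h x)

/-- The pairs of distinct elements of `S` are enumerated by `p`. -/
structure EnumPairs {α ι : Type*} (S : Finset α) (p : ι → Sym2 α) : Prop where
  inj : Function.Injective p
  not_isDiag : ∀ n, ¬ (p n).IsDiag
  mem : ∀ n, ∀ x ∈ p n, x ∈ S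
  surj : ∀ x ∈ S, ∀ y ∈ S, x ≠ y → ∃ n, p n = s(x, y)

/-- `F` maps the pair `ij` to the common face of the facets `i` and `j`. -/
def IsFaceMap (X : BranchedComplex) (S : Finset (Fin 5)) (τ : S → X.cell 3)
    (F : Sym2 (Fin 5) → X.cell 2) : Prop :=
  ∀ z : Sym2 (Fin 5), ¬ z.IsDiag → (∃ x ∈ z, x ∈ S) → ∀ φ : Fin 3 ↪o Fin 5,
    Set.range φ = {x | x ∉ z} → IsImage X S τ φ (F z)

theorem exists_isFaceMap (hS : S.Nonempty) : ∃ F, IsFaceMap X S τ F := by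
  classical
  obtain ⟨i₀, hi₀⟩ := hS
  have key : ∀ z : Sym2 (Fin 5), ∃ c : X.cell 2, ¬ z.IsDiag → (∃ x ∈ z, x ∈ S) →
      ∀ φ : Fin 3 ↪o Fin 5, Set.range φ = {x | x ∉ z} → IsImage X S τ φ c := by
    intro z
    by_cases hz : ¬ z.IsDiag ∧ ∃ x ∈ z, x ∈ S
    · obtain ⟨hz, x, hx, hxS⟩ := hz
      obtain ⟨φ, hφ⟩ := exists_face hz
      obtain ⟨c, hc⟩ := exists_image (X := X) (τ := τ) (φ := φ)
        ⟨x, hxS, by rw [hφ]; simpa using hx⟩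
      refine ⟨c, fun _ _ φ' hφ' => ?_⟩
      rwa [orderEmb_ext (hφ'.trans hφ.symm)]
    · exact ⟨X.res (opp 0) (τ ⟨i₀, hi₀⟩), fun h h' => absurd ⟨h, h'⟩ hz⟩
  choose F hF using key
  exact ⟨F, hF⟩

namespace IsFaceMap

variable {F : Sym2 (Fin 5) → X.cell 2}

theorem res_opp (hF : IsFaceMap X S τ F) (hB : IsBall X S τ) (i : S) (k : Fin 4) :
    X.res (opp k) (τ i) = F s(i.1, i.1.succAbove k) := by
  refine hB.wellDefined ((opp k).trans (opp i.1)) _ _ (isImage_trans i (opp k)) (hF _ ?_ ?_ _ ?_)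
  · simp
  · exact ⟨i.1, by simp, i.2⟩
  · ext x
    simp only [Set.mem_range, Set.mem_ofPred_eq, Sym2.mem_iff, not_or]
    constructor
    · rintro ⟨n, rfl⟩
      refine ⟨Fin.succAbove_ne _ _, fun e => ?_⟩
      exact Fin.succAbove_ne k n (Fin.succAbove_right_injective (p := i.1) e)
    · rintro ⟨ha, hb⟩
      obtain ⟨m, rfl⟩ := Fin.exists_succAbove_eq ha
      obtain ⟨n, rfl⟩ := Fin.exists_succAbove_eq (x := m) (y := k) fun e => hb (by rw [e])
      exact ⟨n, rfl⟩

theorem not_innerCell (hF : IsFaceMap X S τ F) (hB : IsBall X S τ) {i j : Fin 5} (hi : i ∈ S)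
    (hj : j ∉ S) : ¬ InnerCell X S τ (F s(i, j)) := by
  have hij : ¬ (s(i, j) : Sym2 (Fin 5)).IsDiag := by
    simp only [Sym2.mk_isDiag_iff]
    rintro rfl
    exact hj hi
  obtain ⟨φ, hφ⟩ := exists_face hij
  refine hB.not_innerCell (hF _ hij ⟨i, by simp, hi⟩ φ hφ) ⟨j, Finset.mem_compl.2 hj, ?_⟩
  rw [hφ]
  simp

theorem covers (hF : IsFaceMap X S τ F) (hB : IsBall X S τ) {ι : Type*} {p : ι → Sym2 (Fin 5)}
    (hp : EnumPairs S p) : Covers (InnerCell X S τ (k := 2)) fun n => F (p n) := by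
  choose Φ hΦ using fun n => exists_face (hp.not_isDiag n)
  have hS : ∀ n, ∃ x ∈ p n, x ∈ S := fun n =>
    ⟨_, (p n).out_fst_mem, hp.mem n _ (p n).out_fst_mem⟩
  refine hB.covers (Φ := Φ) (fun a b h => hp.inj (sym2_ext_of_compl ?_)) (fun φ => ⟨fun h => ?_,
    ?_⟩)
    fun n => hF _ (hp.not_isDiag n) (hS n) _ (hΦ n)
  · rw [← hΦ, ← hΦ, h]
  · obtain ⟨z, hz, hφ⟩ := exists_complement φ
    have hzS : ∀ x ∈ z, x ∈ S := fun x hx => (isInner_iff.1 h).2 x (by rw [hφ]; simpa using hx)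
    induction z using Sym2.ind with
    | _ a b =>
      obtain ⟨n, hn⟩ := hp.surj a (hzS a (by simp)) b (hzS b (by simp)) (by simpa using hz)
      exact ⟨n, orderEmb_ext (by rw [hΦ, hφ, hn])⟩
  · rintro ⟨n, rfl⟩
    obtain ⟨x, hx, hxS⟩ := hS n
    refine isInner_iff.2 ⟨⟨x, hxS, by rw [hΦ]; simpa using hx⟩, fun i hi => hp.mem n i ?_⟩
    rw [hΦ] at hi
    simpa using hi

end IsFaceMap

end Ball

section BallSum

variable {N : ℕ} [NeZero N] {d : ℂ → ℂ} {S : Finset (Fin 5)}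

theorem tetSymbol_ball (T : DecoratedTriangulation) {τ : S → T.cell 3}
    (hB : IsBall T.toBranchedComplex S τ) {F : Sym2 (Fin 5) → T.cell 2}
    (hF : IsFaceMap T.toBranchedComplex S τ F) {y : Fin 5 → Fin 5 → ℂ} {q : Fin 5 → Fin 5 → ZMod N}
    (i : S) (hy : T.tetRoot d (τ i) = fun k l => y (i.1.succAbove k) (i.1.succAbove l))
    (hq : T.tetCharge N (τ i) = fun k l => q (i.1.succAbove k) (i.1.succAbove l))
    {α : T.cell 2 → ZMod N} {r : Fin 5 → ZMod N} (hr : ∀ j ≠ i.1, α (F s(i.1, j)) = r j) :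
    T.tetSymbol N d α (τ i) = facetWeight (T.index (τ i)) y q i.1 r := by
  rw [T.tetSymbol_eq, facetWeight, hy, hq]
  congr 1
  ext k
  rw [hF.res_opp hB, hr _ (Fin.succAbove_ne _ _)]

theorem extend_of_notMem {ι A : Type*} {p : ι → Sym2 (Fin 5)} (hp : EnumPairs S p) (v : ι → A)
    (b : Sym2 (Fin 5) → A) {i j : Fin 5} (hj : j ∉ S) :
    Function.extend p v b s(i, j) = b s(i, j) :=
  Function.extend_apply' _ _ _ fun ⟨n, hn⟩ => hj (hp.mem n j (by rw [hn]; simp))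

open Classical in
theorem sum_prod_tetSymbol (T : DecoratedTriangulation) {τ : S → T.cell 3}
    (hB : IsBall T.toBranchedComplex S τ) {F : Sym2 (Fin 5) → T.cell 2}
    (hF : IsFaceMap T.toBranchedComplex S τ F) {ι : Type*} [Fintype ι] {p : ι → Sym2 (Fin 5)}
    (hp : EnumPairs S p) {σ : Fin 5 → ℤˣ} (hσ : ∀ i : S, T.index (τ i) = σ i)
    {y : Fin 5 → Fin 5 → ℂ} {q : Fin 5 → Fin 5 → Fin 5 → ZMod N}
    (hy : ∀ i : S, T.tetRoot d (τ i) = fun k l => y (i.1.succAbove k) (i.1.succAbove l))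
    (hq : ∀ i : S, T.tetCharge N (τ i) = fun k l => q i.1 (i.1.succAbove k) (i.1.succAbove l))
    (hout : ∀ t, ¬ InnerCell T.toBranchedComplex S τ t → ∀ k : Fin 4,
      ¬ InnerCell T.toBranchedComplex S τ (T.res (opp k) t))
    (b : ({c : T.cell 2 // ¬ InnerCell T.toBranchedComplex S τ c} → ZMod N) →
      Sym2 (Fin 5) → ZMod N)
    (hb : ∀ β, ∀ i ∈ S, ∀ j ∉ S, ∀ h, b β s(i, j) = β ⟨F s(i, j), h⟩) :
    ∑ α : T.cell 2 → ZMod N, ∏ t, T.tetSymbol N d α t =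
      ∑ β : {c : T.cell 2 // ¬ InnerCell T.toBranchedComplex S τ c} → ZMod N,
        (∑ v : ι → ZMod N, ∏ i ∈ S, facetWeight (σ i) y (q i) i
          fun j => Function.extend p v (b β) s(i, j)) *
        ∏ t : {t : T.cell 3 // ¬ InnerCell T.toBranchedComplex S τ t},
          T.tetSymbol N d ((hF.covers hB hp).glue β 0) t := by
  have hc := hF.covers hB hp
  rw [hc.sum_glue]
  refine Finset.sum_congr rfl fun β _ => ?_
  rw [Finset.sum_mul]
  refine Finset.sum_congr rfl fun v _ => ?_
  rw [hB.covers_tet.prod_eq]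
  congr 1
  · rw [← Finset.prod_coe_sort S fun i => facetWeight (σ i) y (q i) i
      fun j => Function.extend p v (b β) s(i, j)]
    refine Finset.prod_congr rfl fun i _ => ?_
    rw [← hσ i]
    refine tetSymbol_ball T hB hF i (hy i) (hq i) fun j hj => ?_
    by_cases hjS : j ∈ S
    · obtain ⟨n, hn⟩ := hp.surj i.1 i.2 j hjS hj.symm
      rw [← hn, hp.inj.extend_apply]
      exact hc.glue_apply β v n
    · rw [extend_of_notMem hp _ _ hjS, hb β i.1 i.2 j hjS (hF.not_innerCell hB i.2 hjS)]
      exact hc.glue_out β v _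
  · refine Finset.prod_congr rfl fun t _ => ?_
    refine DecoratedTriangulation.tetSymbol_congr N d rfl (fun _ => rfl) rfl fun k => ?_
    rw [hc.glue_out _ _ (hout t.1 t.2 k), Covers.glue_out _ _ _ (hout t.1 t.2 k)]

variable {T T' : DecoratedTriangulation} {τ : S → T.cell 3}
  {τ' : (Sᶜ : Finset (Fin 5)) → T'.cell 3} {common : ∀ k, T.cell k → T'.cell k → Prop}

theorem exists_commonEquiv
    (hm : IsBallMove T.toBranchedTriangulation T'.toBranchedTriangulation S τ τ' common) (k : ℕ) :
    ∃ e : {c : T.cell k // ¬ InnerCell T.toBranchedComplex S τ c} ≃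
      {c' : T'.cell k // ¬ InnerCell T'.toBranchedComplex Sᶜ τ' c'},
      (∀ c, common k c.1 (e c).1) ∧ ∀ c c', common k c.1 c'.1 → e c = c' := by
  obtain ⟨e, he⟩ := exists_equiv_of_rel (R := common k) hm.common_inner hm.common_left
    hm.common_right
  exact ⟨e, he, fun c c' h => Subtype.ext ((hm.common_left c.1 c.2).unique (he c) h)⟩

open Classical in
theorem sum_prod_tetSymbol_ballMove
    (hm : IsBallMove T.toBranchedTriangulation T'.toBranchedTriangulation S τ τ' common)
    (ha : AgreeOnCommon T T' common) (hS : S.Nonempty) (hS' : Sᶜ.Nonempty)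
    {ι ι' : Type*} [Fintype ι] [Fintype ι'] {p : ι → Sym2 (Fin 5)} {p' : ι' → Sym2 (Fin 5)}
    (hp : EnumPairs S p) (hp' : EnumPairs Sᶜ p') {σ : Fin 5 → ℤˣ}
    (hσ : ∀ i : S, T.index (τ i) = σ i)
    (hσ' : ∀ i : (Sᶜ : Finset (Fin 5)), T'.index (τ' i) = σ i)
    {y : Fin 5 → Fin 5 → ℂ} {q : Fin 5 → Fin 5 → Fin 5 → ZMod N}
    (hy : ∀ i : S, T.tetRoot d (τ i) = fun k l => y (i.1.succAbove k) (i.1.succAbove l))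
    (hq : ∀ i : S, T.tetCharge N (τ i) = fun k l => q i.1 (i.1.succAbove k) (i.1.succAbove l))
    (hy' : ∀ i : (Sᶜ : Finset (Fin 5)),
      T'.tetRoot d (τ' i) = fun k l => y (i.1.succAbove k) (i.1.succAbove l))
    (hq' : ∀ i : (Sᶜ : Finset (Fin 5)),
      T'.tetCharge N (τ' i) = fun k l => q i.1 (i.1.succAbove k) (i.1.succAbove l))
    (w w' : ℂ)
    (hrel : ∀ b : Sym2 (Fin 5) → ZMod N,
      w * ∑ v : ι → ZMod N, ∏ i ∈ S, facetWeight (σ i) y (q i) i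
          (fun j => Function.extend p v b s(i, j)) =
      w' * ∑ v : ι' → ZMod N, ∏ i ∈ Sᶜ, facetWeight (σ i) y (q i) i
          (fun j => Function.extend p' v b s(i, j))) :
    w * ∑ α : T.cell 2 → ZMod N, ∏ t, T.tetSymbol N d α t =
      w' * ∑ α : T'.cell 2 → ZMod N, ∏ t, T'.tetSymbol N d α t := by
  obtain ⟨F, hF⟩ := exists_isFaceMap (X := T.toBranchedComplex) (τ := τ) hS
  obtain ⟨F', hF'⟩ := exists_isFaceMap (X := T'.toBranchedComplex) (τ := τ') hS'
  obtain ⟨e, he, he'⟩ := exists_commonEquiv hm 2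
  obtain ⟨e₃, he₃, -⟩ := exists_commonEquiv hm 3
  have hc := hF.covers hm.ball hp
  have hc' := hF'.covers hm.ball' hp'
  have hout : ∀ t, ¬ InnerCell T.toBranchedComplex S τ t → ∀ k : Fin 4,
      ¬ InnerCell T.toBranchedComplex S τ (T.res (opp k) t) := fun t ht k =>
    (hm.common_inner _ _ (hm.common_res (opp k) t _ (he₃ ⟨t, ht⟩))).1
  have hout' : ∀ t, ¬ InnerCell T'.toBranchedComplex Sᶜ τ' t → ∀ k : Fin 4,
      ¬ InnerCell T'.toBranchedComplex Sᶜ τ' (T'.res (opp k) t) := by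
    intro t ht k
    have h := he₃ (e₃.symm ⟨t, ht⟩)
    rw [Equiv.apply_symm_apply] at h
    exact (hm.common_inner _ _ (hm.common_res (opp k) _ _ h)).2
  have hglue : ∀ (β : _ → ZMod N) c c', common 2 c c' →
      hc.glue β 0 c = hc'.glue (fun x => β (e.symm x)) 0 c' := by
    intro β c c' h
    obtain ⟨h1, h2⟩ := hm.common_inner _ _ h
    rw [hc.glue_out _ _ h1, hc'.glue_out _ _ h2, ← he' ⟨c, h1⟩ ⟨c', h2⟩ h, Equiv.symm_apply_apply]
  have hFF : ∀ i ∈ S, ∀ j ∉ S, common 2 (F s(i, j)) (F' s(j, i)) := by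
    intro i hi j hj
    have hij : ¬ (s(i, j) : Sym2 (Fin 5)).IsDiag := by
      rw [Sym2.mk_isDiag_iff]
      rintro rfl
      exact hj hi
    obtain ⟨φ, hφ⟩ := exists_face hij
    refine hm.common_boundary φ _ _ (hF _ hij ⟨i, by simp, hi⟩ φ hφ) ?_
    rw [Sym2.eq_swap] at hij hφ
    exact hF' _ hij ⟨j, by simp, Finset.mem_compl.2 hj⟩ φ hφ
  rw [sum_prod_tetSymbol T hm.ball hF hp hσ hy hq hout (fun β z => hc.glue β 0 (F z))
      (fun β i hi j hj h => hc.glue_out _ _ h),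
    sum_prod_tetSymbol T' hm.ball' hF' hp' hσ' hy' hq' hout'
      (fun β' z => hc.glue (fun x => β' (e x)) 0 (F z)) ?_, Finset.mul_sum, Finset.mul_sum]
  · refine Fintype.sum_equiv (e.arrowCongr (Equiv.refl _)) _ _ fun β => ?_
    have hβ : (fun x => (e.arrowCongr (Equiv.refl (ZMod N))) β (e x)) = β := by
      ext x
      simp
    rw [hβ, ← mul_assoc, ← mul_assoc, hrel]
    congr 1
    refine Fintype.prod_equiv e₃ _ _ fun t => ?_
    refine DecoratedTriangulation.tetSymbol_congr N d (hm.common_index _ _ (he₃ t))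
      (fun φ => ha.cocycle _ _ (hm.common_res φ _ _ (he₃ t))) (ha.charge _ _ (he₃ t)) fun k => ?_
    exact hglue β _ _ (hm.common_res (opp k) _ _ (he₃ t))
  · intro β' i hi j hj h
    have hiS : j ∉ Sᶜ → j ∈ S := fun h => by simpa using h
    have h1 := hFF j (hiS hj) i (Finset.mem_compl.1 hi)
    change hc.glue (fun x => β' (e x)) 0 (F s(i, j)) = _
    have hs : F s(i, j) = F s(j, i) := congrArg F Sym2.eq_swap
    rw [hs, hglue _ _ _ h1]
    simp only [Equiv.apply_symm_apply]
    exact hc'.glue_out _ _ h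

end BallSum

section BallData

theorem range_eq_pair {n : ℕ} {φ : Fin 2 ↪o Fin n} {a b : Fin n} (hab : a ≠ b)
    (ha : a ∈ Set.range φ) (hb : b ∈ Set.range φ) : Set.range φ = {a, b} := by
  rw [eq_pair φ, range_pair] at *
  simp only [Set.mem_insert_iff, Set.mem_singleton_iff] at ha hb
  rcases ha with rfl | rfl <;> rcases hb with rfl | rfl
  · exact absurd rfl hab
  · rfl
  · exact Set.pair_comm _ _
  · exact absurd rfl hab

theorem exists_range_eq {n : ℕ} (φ : Fin 2 ↪o Fin n) :
    ∃ a b, a ≠ b ∧ Set.range φ = {a, b} :=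
  ⟨φ 0, φ 1, φ.injective.ne (by decide), by rw [← range_pair (φ.strictMono Fin.zero_lt_one),
    ← eq_pair]⟩

theorem inBall_edge {S : Finset (Fin 5)} (hS : 3 ≤ S.card) (φ : Fin 2 ↪o Fin 5) : InBall S φ := by
  by_contra h
  have h1 : S ⊆ Finset.univ.map φ.toEmbedding := by
    intro i hi
    by_contra hφ
    refine h ⟨i, hi, fun hr => hφ ?_⟩
    simpa using hr
  have := Finset.card_le_card h1
  rw [Finset.card_map, Finset.card_univ, Fintype.card_fin] at this
  omega

open Classical in
/-- The charge of the edge `φ` of the 4-simplex in the tetrahedron `t`, which is its facet `i`. -/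
noncomputable def cornerCharge (T : DecoratedTriangulation) (t : T.cell 3) (i : Fin 5)
    (φ : Fin 2 ↪o Fin 5) : ℤ :=
  ∑ ψ : Fin 2 ↪o Fin 4, if ψ.trans (opp i) = φ then T.charge t ψ else 0

theorem cornerCharge_trans (T : DecoratedTriangulation) (t : T.cell 3) (i : Fin 5)
    (ψ : Fin 2 ↪o Fin 4) : cornerCharge T t i (ψ.trans (opp i)) = T.charge t ψ := by
  rw [cornerCharge, Finset.sum_eq_single ψ, if_pos rfl]
  · intro ψ' _ h
    exact if_neg fun e => h (trans_opp_injective e)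
  · exact fun h => absurd (Finset.mem_univ _) h

theorem cornerCharge_eq_zero (T : DecoratedTriangulation) (t : T.cell 3) {i : Fin 5}
    {φ : Fin 2 ↪o Fin 5} (h : i ∈ Set.range φ) : cornerCharge T t i φ = 0 :=
  Finset.sum_eq_zero fun ψ _ => if_neg fun e => notMem_range_trans_opp ψ (e ▸ h)

theorem ballCharge_eq (T : DecoratedTriangulation) (S : Finset (Fin 5)) (τ : S → T.cell 3)
    (φ : Fin 2 ↪o Fin 5) : ballCharge T S τ φ = ∑ i : S, cornerCharge T (τ i) i φ := rfl

theorem ballCharge_eq_zero (T : DecoratedTriangulation) {S : Finset (Fin 5)} (τ : S → T.cell 3)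
    {φ : Fin 2 ↪o Fin 5} (h : ∀ i ∈ S, i ∈ Set.range φ) : ballCharge T S τ φ = 0 :=
  Finset.sum_eq_zero fun i _ => cornerCharge_eq_zero T _ (h i.1 i.2)

open Classical in
theorem ballCharge_inner (T : DecoratedTriangulation) {S : Finset (Fin 5)} {τ : S → T.cell 3}
    (hB : IsBall T.toBranchedComplex S τ)
    (hout : ∀ t, ¬ InnerCell T.toBranchedComplex S τ t → ∀ ψ : Fin 2 ↪o Fin 4,
      ¬ InnerCell T.toBranchedComplex S τ (T.res ψ t))
    {φ : Fin 2 ↪o Fin 5} (hφ : IsInner S φ) {e : T.cell 1}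
    (he : IsImage T.toBranchedComplex S τ φ e) :
    ballCharge T S τ φ = if e ∈ T.H then 0 else 2 := by
  rw [← T.charge_edge e, hB.covers_tet.sum_eq, ballCharge]
  symm
  convert add_zero _ using 1
  · congr 1
    · refine Finset.sum_congr rfl fun i _ => Finset.sum_congr rfl fun ψ _ => if_congr ?_ rfl rfl
      constructor
      · rintro rfl
        exact (hB.inner_injective _ _ _ hφ he (isImage_trans i ψ)).symm
      · rintro rfl
        exact hB.wellDefined _ _ _ (isImage_trans i ψ) he
    · refine Finset.sum_eq_zero fun t _ => Finset.sum_eq_zero fun ψ _ => if_neg fun h => ?_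
      exact hout t.1 t.2 ψ (h ▸ ⟨φ, hφ, he⟩)

theorem simplexCharges_of_facets {A : Type*} {q : Fin 5 → Fin 5 → Fin 5 → A}
    (hs : ∀ i u v, q i u v = q i v u)
    (h : ∀ i : Fin 5, TetCharges fun k l => q i (i.succAbove k) (i.succAbove l)) :
    SimplexCharges q where
  symm := hs
  opp i u v w x hn := by
    obtain ⟨iu, iv, iw, ix, uv, uw, ux, vw, vx, wx⟩ := ne_of_nodup_five hn
    obtain ⟨u, rfl⟩ := Fin.exists_succAbove_eq iu.symm
    obtain ⟨v, rfl⟩ := Fin.exists_succAbove_eq iv.symm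
    obtain ⟨w, rfl⟩ := Fin.exists_succAbove_eq iw.symm
    obtain ⟨x, rfl⟩ := Fin.exists_succAbove_eq ix.symm
    have ne : ∀ {a b : Fin 4}, i.succAbove a ≠ i.succAbove b → a ≠ b := fun h e => h (by rw [e])
    exact (h i).opp u v w x (ne uv) (ne uw) (ne ux) (ne vw) (ne vx) (ne wx)

variable {N : ℕ} [NeZero N] {d : ℂ → ℂ} {S : Finset (Fin 5)} {T T' : DecoratedTriangulation}
  {τ : S → T.cell 3} {τ' : (Sᶜ : Finset (Fin 5)) → T'.cell 3}
  {common : ∀ k, T.cell k → T'.cell k → Prop}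

/-- The parameters and charges on the edges of the 4-simplex of a ball move. -/
structure SimplexData (N : ℕ) [NeZero N] (d : ℂ → ℂ) (S : Finset (Fin 5))
    (T T' : DecoratedTriangulation) (τ : S → T.cell 3)
    (τ' : (Sᶜ : Finset (Fin 5)) → T'.cell 3) (E : (Fin 2 ↪o Fin 5) → T'.cell 1)
    (y : Fin 5 → Fin 5 → ℂ) (q : Fin 5 → Fin 5 → Fin 5 → ZMod N) : Prop where
  params : SimplexParams N y
  charges : SimplexCharges q
  root : ∀ i : S, T.tetRoot d (τ i) = fun k l => y (i.1.succAbove k) (i.1.succAbove l)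
  root' : ∀ i : (Sᶜ : Finset (Fin 5)),
    T'.tetRoot d (τ' i) = fun k l => y (i.1.succAbove k) (i.1.succAbove l)
  charge : ∀ i : S, T.tetCharge N (τ i) = fun k l => q i.1 (i.1.succAbove k) (i.1.succAbove l)
  charge' : ∀ i : (Sᶜ : Finset (Fin 5)),
    T'.tetCharge N (τ' i) = fun k l => q i.1 (i.1.succAbove k) (i.1.succAbove l)
  edge : ∀ {u v} {φ : Fin 2 ↪o Fin 5}, Set.range φ = {u, v} → y u v = d (T'.x (E φ))
  sum : ∀ {u v} {φ : Fin 2 ↪o Fin 5}, Set.range φ = {u, v} →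
    ∑ i ∈ S, facetCharge q i u v = (ballCharge T S τ φ : ZMod N) * half N
  sum' : ∀ {u v} {φ : Fin 2 ↪o Fin 5}, Set.range φ = {u, v} →
    ∑ i ∈ Sᶜ, facetCharge q i u v = (ballCharge T' Sᶜ τ' φ : ZMod N) * half N

theorem exists_simplexData
    (hm : IsBallMove T.toBranchedTriangulation T'.toBranchedTriangulation S τ τ' common)
    (ha : AgreeOnCommon T T' common) (hd : T.RootHolds N d) (hd' : T'.RootHolds N d)
    {E : (Fin 2 ↪o Fin 5) → T'.cell 1}
    (hE : ∀ φ, IsImage T'.toBranchedComplex Sᶜ τ' φ (E φ)) :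
    ∃ y q, SimplexData N d S T T' τ τ' E y q := by
  have r' : ∀ i : (Sᶜ : Finset (Fin 5)), T'.tetRoot d (τ' i) = fun k l =>
      edgeVal (fun φ => d (T'.x (E φ))) (i.1.succAbove k) (i.1.succAbove l) := by
    intro i
    ext k l
    rw [← opp_apply, ← opp_apply, edgeVal_trans]
    refine congrArg (fun f => edgeVal f k l) (funext fun ψ => ?_)
    rw [hm.ball'.wellDefined _ _ _ (isImage_trans i ψ) (hE _)]
  have r : ∀ i : S, T.tetRoot d (τ i) = fun k l =>
      edgeVal (fun φ => d (T'.x (E φ))) (i.1.succAbove k) (i.1.succAbove l) := by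
    intro i
    ext k l
    rw [← opp_apply, ← opp_apply, edgeVal_trans]
    refine congrArg (fun f => edgeVal f k l) (funext fun ψ => congrArg d ?_)
    have := ha.cocycle _ _ (hm.common_boundary _ _ _ (isImage_trans i ψ) (hE _))
    rw [DecoratedTriangulation.x, this, DecoratedTriangulation.x]
  classical
  set Q : Fin 5 → (Fin 2 ↪o Fin 5) → ℤ := fun i φ =>
    if h : i ∈ S then cornerCharge T (τ ⟨i, h⟩) i φ
    else cornerCharge T' (τ' ⟨i, Finset.mem_compl.2 h⟩) i φ with hQ
  have hQS : ∀ (i : S) φ, Q i φ = cornerCharge T (τ i) i φ := fun i φ => dif_pos i.2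
  have hQS' : ∀ (i : (Sᶜ : Finset (Fin 5))) φ, Q i φ = cornerCharge T' (τ' i) i φ :=
    fun i φ => dif_neg (Finset.mem_compl.1 i.2)
  set q : Fin 5 → Fin 5 → Fin 5 → ZMod N := fun i =>
    edgeVal fun φ => (Q i φ : ZMod N) * half N with hq
  have c : ∀ i : S, T.tetCharge N (τ i) = fun k l => q i (i.1.succAbove k) (i.1.succAbove l) := by
    intro i
    ext k l
    rw [← opp_apply, ← opp_apply]
    simp only [hq]
    rw [edgeVal_trans]
    refine congrArg (fun f => edgeVal f k l) (funext fun ψ => ?_)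
    rw [hQS, cornerCharge_trans]
  have c' : ∀ i : (Sᶜ : Finset (Fin 5)),
      T'.tetCharge N (τ' i) = fun k l => q i (i.1.succAbove k) (i.1.succAbove l) := by
    intro i
    ext k l
    rw [← opp_apply, ← opp_apply]
    simp only [hq]
    rw [edgeVal_trans]
    refine congrArg (fun f => edgeVal f k l) (funext fun ψ => ?_)
    rw [hQS', cornerCharge_trans]
  have hf : ∀ {i u v} {φ : Fin 2 ↪o Fin 5}, Set.range φ = {u, v} →
      facetCharge q i u v = (Q i φ : ZMod N) * half N := by
    intro i u v φ h
    rw [facetCharge]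
    split_ifs with hi
    · have hr : i ∈ Set.range φ := by
        rw [h]
        simpa using hi
      have : Q i φ = 0 := by
        simp only [hQ]
        split_ifs
        · exact cornerCharge_eq_zero _ _ hr
        · exact cornerCharge_eq_zero _ _ hr
      rw [this, Int.cast_zero, zero_mul]
    · exact edgeVal_eq _ h
  refine ⟨edgeVal fun φ => d (T'.x (E φ)), q, ⟨edgeVal_symm _, ?_, ?_⟩, ?_, r, r', c, c',
    fun h => edgeVal_eq _ h, ?_, ?_⟩
  · intro i j hij
    obtain ⟨φ, hφ⟩ := exists_edge hij
    rw [edgeVal_eq _ hφ]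
    exact T'.root_ne_zero hd' _
  · intro i
    by_cases hi : i ∈ S
    · have := (T.tetParams_tetRoot hd (τ ⟨i, hi⟩)).fermat
      rwa [r] at this
    · have := (T'.tetParams_tetRoot hd' (τ' ⟨i, Finset.mem_compl.2 hi⟩)).fermat
      rwa [r'] at this
  · refine simplexCharges_of_facets (fun i => edgeVal_symm _) fun i => ?_
    by_cases hi : i ∈ S
    · have := T.tetCharges_tetCharge N (τ ⟨i, hi⟩)
      rwa [c] at this
    · have := T'.tetCharges_tetCharge N (τ' ⟨i, Finset.mem_compl.2 hi⟩)
      rwa [c'] at this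
  · intro u v φ h
    rw [ballCharge_eq, Int.cast_sum, Finset.sum_mul, ← Finset.sum_coe_sort]
    exact Finset.sum_congr rfl fun i _ => by rw [hf h, hQS]
  · intro u v φ h
    rw [ballCharge_eq, Int.cast_sum, Finset.sum_mul, ← Finset.sum_coe_sort]
    exact Finset.sum_congr rfl fun i _ => by rw [hf h, hQS']

theorem res_not_innerCell'
    (hm : IsBallMove T.toBranchedTriangulation T'.toBranchedTriangulation S τ τ' common)
    {k : ℕ} (t : T'.cell 3) (ht : ¬ InnerCell T'.toBranchedComplex Sᶜ τ' t)
    (ψ : Fin (k + 1) ↪o Fin 4) : ¬ InnerCell T'.toBranchedComplex Sᶜ τ' (T'.res ψ t) := by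
  obtain ⟨c, hc, -⟩ := hm.common_right t ht
  exact (hm.common_inner _ _ (hm.common_res ψ _ _ hc)).2

theorem facetWeight_row {σ : ℤˣ} {y : Fin 5 → Fin 5 → ℂ} {q : Fin 5 → Fin 5 → ZMod N}
    {a b c d e : Fin 5} (hn : [a, b, c, d, e].Nodup) (f : Fin 5 → ZMod N) :
    facetWeight σ y q a f = facetWeight σ y q a (row b c d e (f b) (f c) (f d) (f e)) := by
  obtain ⟨ab, ac, ad, ae, bc, bd, be, cd, ce, de⟩ := ne_of_nodup_five hn
  unfold facetWeight
  congr 1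
  ext k
  rcases (eq_of_nodup_five hn (a.succAbove k)).resolve_left (Fin.succAbove_ne a k) with
    h | h | h | h <;> rw [h] <;> simp [row, bc.symm, bd.symm, be.symm, cd.symm, ce.symm, de.symm]

theorem edgeInd_eq {A : Type*} [Zero A] [One A] {a b u v : Fin 5} {φ ψ : Fin 2 ↪o Fin 5}
    (hφ : Set.range φ = {u, v}) (hψ : Set.range ψ = {a, b}) [Decidable (φ = ψ)] :
    (edgeInd a b u v : A) = if φ = ψ then 1 else 0 := by
  refine if_congr ⟨fun h => orderEmb_ext ?_, ?_⟩ rfl rfl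
  · rw [hφ, hψ]
    rcases h with ⟨rfl, rfl⟩ | ⟨rfl, rfl⟩
    · rfl
    · exact Set.pair_comm _ _
  · rintro rfl
    rw [hφ] at hψ
    exact Set.pair_eq_pair_iff.1 hψ

section EnumPairs

variable {α : Type*}

theorem enumPairs_singleton (i : α) : EnumPairs {i} (![] : Fin 0 → Sym2 α) where
  inj := fun a => a.elim0
  not_isDiag := fun a => a.elim0
  mem := fun a => a.elim0
  surj := by
    intro x hx y hy h
    rw [Finset.mem_singleton] at hx hy
    exact absurd (hx.trans hy.symm) h

variable [DecidableEq α]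

theorem enumPairs_pair {a b : α} (ab : a ≠ b) : EnumPairs {a, b} ![s(a, b)] where
  inj := Function.injective_of_subsingleton _
  not_isDiag := by simpa using ab
  mem := by simp
  surj := by
    simp only [Finset.mem_insert, Finset.mem_singleton, Fin.exists_fin_one]
    rintro x (rfl | rfl) y (rfl | rfl) h <;> simp_all

theorem enumPairs_three {c d e : α} (cd : c ≠ d) (ce : c ≠ e) (de : d ≠ e) :
    EnumPairs {c, d, e} ![s(c, d), s(c, e), s(d, e)] where
  inj := by
    intro n m
    fin_cases n <;> fin_cases m <;> simp [cd, ce, de, cd.symm, ce.symm, de.symm]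
  not_isDiag n := by fin_cases n <;> simp [cd, ce, de]
  mem n := by fin_cases n <;> simp
  surj := by
    simp only [Finset.mem_insert, Finset.mem_singleton]
    rintro x (rfl | rfl | rfl) y (rfl | rfl | rfl) h <;> first | exact absurd rfl h | skip
    exacts [⟨0, rfl⟩, ⟨1, rfl⟩, ⟨0, Sym2.eq_swap⟩, ⟨2, rfl⟩, ⟨1, Sym2.eq_swap⟩, ⟨2, Sym2.eq_swap⟩]

theorem enumPairs_four {j k l m : α} (jk : j ≠ k) (jl : j ≠ l) (jm : j ≠ m) (kl : k ≠ l)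
    (km : k ≠ m) (lm : l ≠ m) :
    EnumPairs {j, k, l, m} ![s(j, k), s(j, l), s(j, m), s(k, l), s(k, m), s(l, m)] where
  inj := by
    intro n n'
    fin_cases n <;> fin_cases n' <;> simp [jk, jl, jm, kl, km, lm, jk.symm, jl.symm, jm.symm,
      kl.symm,
      km.symm, lm.symm]
  not_isDiag n := by fin_cases n <;> simp [jk, jl, jm, kl, km, lm]
  mem n := by fin_cases n <;> simp
  surj := by
    simp only [Finset.mem_insert, Finset.mem_singleton]
    rintro x (rfl | rfl | rfl | rfl) y (rfl | rfl | rfl | rfl) h <;>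
      first | exact absurd rfl h | skip
    exacts [⟨0, rfl⟩, ⟨1, rfl⟩, ⟨2, rfl⟩, ⟨0, Sym2.eq_swap⟩, ⟨3, rfl⟩, ⟨4, rfl⟩,
      ⟨1, Sym2.eq_swap⟩, ⟨3, Sym2.eq_swap⟩, ⟨5, rfl⟩, ⟨2, Sym2.eq_swap⟩, ⟨4, Sym2.eq_swap⟩,
      ⟨5, Sym2.eq_swap⟩]

end EnumPairs

end BallData

section Assembly

namespace DecoratedTriangulation

open Classical in
/-- The factor of an edge in the state sum. -/
noncomputable def edgeFactor (T : DecoratedTriangulation) (N : ℕ) (d : ℂ → ℂ) (e : T.cell 1) : ℂ :=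
  if e ∈ T.H then 1 else (d (T.x e) ^ (2 * ((N - 1) / 2)))⁻¹

variable {N : ℕ} {d : ℂ → ℂ}

theorem edgeFactor_of_mem {T : DecoratedTriangulation} {e : T.cell 1} (h : e ∈ T.H) :
    T.edgeFactor N d e = 1 := if_pos h

theorem edgeFactor_of_notMem (hN : Odd N) {T : DecoratedTriangulation} {e : T.cell 1}
    (h : e ∉ T.H) : T.edgeFactor N d e = (d (T.x e) ^ (N - 1))⁻¹ := by
  obtain ⟨m, rfl⟩ := hN
  rw [edgeFactor, if_neg h]
  congr 3
  omega

theorem edgeFactor_congr {T T' : DecoratedTriangulation} {e : T.cell 1} {e' : T'.cell 1}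
    (hz : T.z e = T'.z e') (hH : e ∈ T.H ↔ e' ∈ T'.H) :
    T.edgeFactor N d e = T'.edgeFactor N d e' := by
  classical
  unfold edgeFactor
  refine if_congr hH rfl ?_
  rw [x, x, hz]

open Classical in
theorem stateSum_eq_stateSum [NeZero N] {T T' : DecoratedTriangulation} {w K Y : ℂ} (hw : w ≠ 0)
    (hV : (N : ℂ) ^ Fintype.card (T'.cell 0) = w * (N : ℂ) ^ Fintype.card (T.cell 0))
    (hZ : w * ∑ α : T.cell 2 → ZMod N, ∏ t, T.tetSymbol N d α t =
      K * ∑ α : T'.cell 2 → ZMod N, ∏ t, T'.tetSymbol N d α t)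
    (hE : ∏ e, T'.edgeFactor N d e = (∏ e, T.edgeFactor N d e) * Y⁻¹) (hK : (K * Y) ^ N = 1) :
    T.stateSum N d = T'.stateSum N d := by
  have hY : Y ≠ 0 := by
    rintro rfl
    rw [mul_zero, zero_pow (NeZero.ne N)] at hK
    exact zero_ne_one hK
  change ((_ : ℂ)⁻¹ * _ * ∏ e, T.edgeFactor N d e) ^ N =
    ((_ : ℂ)⁻¹ * _ * ∏ e, T'.edgeFactor N d e) ^ N
  rw [hE, hV]
  have e : ((N : ℂ) ^ Fintype.card (T.cell 0))⁻¹ *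
      (∑ α : T.cell 2 → ZMod N, ∏ t, T.tetSymbol N d α t) * ∏ e, T.edgeFactor N d e =
      K * Y * ((w * (N : ℂ) ^ Fintype.card (T.cell 0))⁻¹ *
        (∑ α : T'.cell 2 → ZMod N, ∏ t, T'.tetSymbol N d α t) *
        ((∏ e, T.edgeFactor N d e) * Y⁻¹)) := by
    have h1 : ∑ α : T.cell 2 → ZMod N, ∏ t, T.tetSymbol N d α t =
        w⁻¹ * (K * ∑ α : T'.cell 2 → ZMod N, ∏ t, T'.tetSymbol N d α t) := by
      rw [← hZ, inv_mul_cancel_left₀ hw]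
    rw [h1, mul_inv]
    field_simp
  rw [e, mul_pow, hK, one_mul]

end DecoratedTriangulation

variable {N : ℕ} [NeZero N] {d : ℂ → ℂ}

variable {S : Finset (Fin 5)} {T T' : DecoratedTriangulation}
  {τ : S → T.cell 3} {τ' : (Sᶜ : Finset (Fin 5)) → T'.cell 3}
  {common : ∀ k, T.cell k → T'.cell k → Prop}

theorem sum_relation_pentagon {a b c d e : Fin 5} (hn : [a, b, c, d, e].Nodup)
    {y : Fin 5 → Fin 5 → ℂ} {q : Fin 5 → Fin 5 → Fin 5 → ZMod N} {σ : Fin 5 → ℤˣ} {K : ℂ}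
    (hK : ∀ ac ad ae bc bd be : ZMod N,
      ∑ ab, facetWeight (σ a) y (q a) a (row b c d e ab ac ad ae) *
        facetWeight (σ b) y (q b) b (row a c d e ab bc bd be) =
      K * ∑ cd, ∑ ce, ∑ de, facetWeight (σ c) y (q c) c (row a b d e ac bc cd ce) *
        facetWeight (σ d) y (q d) d (row a b c e ad bd cd de) *
        facetWeight (σ e) y (q e) e (row a b c d ae be ce de))
    (g : Sym2 (Fin 5) → ZMod N) :
    ∑ v : Fin 1 → ZMod N, ∏ i ∈ {a, b}, facetWeight (σ i) y (q i) i
        (fun j => Function.extend ![s(a, b)] v g s(i, j)) =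
      K * ∑ v : Fin 3 → ZMod N, ∏ i ∈ ({a, b}ᶜ : Finset (Fin 5)), facetWeight (σ i) y (q i) i
        (fun j => Function.extend ![s(c, d), s(c, e), s(d, e)] v g s(i, j)) := by
  obtain ⟨ab, ac, ad, ae, bc, bd, be, cd, ce, de⟩ := ne_of_nodup_five hn
  have p₁ := enumPairs_pair ab
  have p₂ := enumPairs_three cd ce de
  have n1 : [b, a, c, d, e].Nodup := nodup_swap₁ hn
  have n2 : [c, a, b, d, e].Nodup := nodup_swap₁ (nodup_swap₂ hn)
  have n3 : [d, a, b, c, e].Nodup := nodup_swap₁ (nodup_swap₂ (nodup_swap₃ hn))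
  have n4 : [e, a, b, c, d].Nodup := nodup_swap₁ (nodup_swap₂ (nodup_swap₃ (nodup_swap₄ hn)))
  have e₁ : ∀ v : Fin 1 → ZMod N, Function.extend ![s(a, b)] v g s(a, b) = v 0 :=
    fun v => p₁.inj.extend_apply v g 0
  have e₂ : ∀ v : Fin 3 → ZMod N,
      Function.extend ![s(c, d), s(c, e), s(d, e)] v g s(c, d) = v 0 :=
    fun v => p₂.inj.extend_apply v g 0
  have e₃ : ∀ v : Fin 3 → ZMod N,
      Function.extend ![s(c, d), s(c, e), s(d, e)] v g s(c, e) = v 1 :=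
    fun v => p₂.inj.extend_apply v g 1
  have e₄ : ∀ v : Fin 3 → ZMod N,
      Function.extend ![s(c, d), s(c, e), s(d, e)] v g s(d, e) = v 2 :=
    fun v => p₂.inj.extend_apply v g 2
  have o₁ : ∀ (v : Fin 1 → ZMod N) (i j : Fin 5), j ≠ a → j ≠ b →
      Function.extend ![s(a, b)] v g s(i, j) = g s(i, j) :=
    fun v i j h h' => extend_of_notMem p₁ v g (by simp [h, h'])
  have o₂ : ∀ (v : Fin 3 → ZMod N) (i j : Fin 5), i ≠ c → i ≠ d → i ≠ e →
      Function.extend ![s(c, d), s(c, e), s(d, e)] v g s(i, j) = g s(i, j) := by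
    intro v i j h h' h''
    have hi : i ∉ ({c, d, e} : Finset (Fin 5)) := by simp [h, h', h'']
    rw [Sym2.eq_swap (a := i) (b := j)]
    exact extend_of_notMem p₂ v g hi
  have A : ∀ v : Fin 1 → ZMod N, facetWeight (σ a) y (q a) a
      (fun j => Function.extend ![s(a, b)] v g s(a, j)) = facetWeight (σ a) y (q a) a
        (row b c d e (v 0) (g s(a, c)) (g s(a, d)) (g s(a, e))) := by
    intro v
    rw [facetWeight_row hn]
    simp only [e₁, o₁ _ _ _ ac.symm bc.symm, o₁ _ _ _ ad.symm bd.symm, o₁ _ _ _ ae.symm be.symm]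
  have B : ∀ v : Fin 1 → ZMod N, facetWeight (σ b) y (q b) b
      (fun j => Function.extend ![s(a, b)] v g s(b, j)) = facetWeight (σ b) y (q b) b
        (row a c d e (v 0) (g s(b, c)) (g s(b, d)) (g s(b, e))) := by
    intro v
    rw [facetWeight_row n1]
    simp only [Sym2.eq_swap (a := b) (b := a), e₁, o₁ _ _ _ ac.symm bc.symm,
      o₁ _ _ _ ad.symm bd.symm, o₁ _ _ _ ae.symm be.symm]
  have C : ∀ v : Fin 3 → ZMod N, facetWeight (σ c) y (q c) c
      (fun j => Function.extend ![s(c, d), s(c, e), s(d, e)] v g s(c, j)) =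
        facetWeight (σ c) y (q c) c (row a b d e (g s(a, c)) (g s(b, c)) (v 0) (v 1)) := by
    intro v
    rw [facetWeight_row n2]
    simp only [e₂, e₃, o₂ _ _ _ ac ad ae, o₂ _ _ _ bc bd be, Sym2.eq_swap (a := c) (b := a),
      Sym2.eq_swap (a := c) (b := b)]
  have D : ∀ v : Fin 3 → ZMod N, facetWeight (σ d) y (q d) d
      (fun j => Function.extend ![s(c, d), s(c, e), s(d, e)] v g s(d, j)) =
        facetWeight (σ d) y (q d) d (row a b c e (g s(a, d)) (g s(b, d)) (v 0) (v 2)) := by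
    intro v
    rw [facetWeight_row n3]
    simp only [Sym2.eq_swap (a := d) (b := c), e₂, e₄, o₂ _ _ _ ac ad ae, o₂ _ _ _ bc bd be,
      Sym2.eq_swap (a := d) (b := a), Sym2.eq_swap (a := d) (b := b)]
  have E : ∀ v : Fin 3 → ZMod N, facetWeight (σ e) y (q e) e
      (fun j => Function.extend ![s(c, d), s(c, e), s(d, e)] v g s(e, j)) =
        facetWeight (σ e) y (q e) e (row a b c d (g s(a, e)) (g s(b, e)) (v 1) (v 2)) := by
    intro v
    rw [facetWeight_row n4]
    simp only [Sym2.eq_swap (a := e) (b := c), Sym2.eq_swap (a := e) (b := d), e₃, e₄,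
      o₂ _ _ _ ac ad ae, o₂ _ _ _ bc bd be, Sym2.eq_swap (a := e) (b := a),
      Sym2.eq_swap (a := e) (b := b)]
  rw [compl_pair hn, sum_fin_one, sum_fin_three]
  simp only [Finset.prod_pair ab, Finset.prod_insert (show c ∉ ({d, e} : Finset (Fin 5)) by
    simp [cd, ce]), Finset.prod_pair de, A, B, C, D, E]
  have := hK (g s(a, c)) (g s(a, d)) (g s(a, e)) (g s(b, c)) (g s(b, d)) (g s(b, e))
  simp only [mul_assoc] at this
  exact this

theorem compl_singleton_five {i j k l m : Fin 5} (hn : [i, j, k, l, m].Nodup) :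
    ({i}ᶜ : Finset (Fin 5)) = {j, k, l, m} := by
  obtain ⟨ij, ik, il, im, -⟩ := ne_of_nodup_five hn
  ext v
  simp only [Finset.mem_compl, Finset.mem_insert, Finset.mem_singleton]
  constructor
  · exact fun h => (eq_of_nodup_five hn v).resolve_left h
  · rintro (rfl | rfl | rfl | rfl)
    exacts [ij.symm, ik.symm, il.symm, im.symm]

theorem sum_relation_cone {i j k l m : Fin 5} (hn : [i, j, k, l, m].Nodup)
    {y : Fin 5 → Fin 5 → ℂ} {q : Fin 5 → Fin 5 → Fin 5 → ZMod N} {σ : Fin 5 → ℤˣ} {K : ℂ}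
    (hK : ∀ ij ik il im : ZMod N,
      (N : ℂ) * facetWeight (σ i) y (q i) i (row j k l m ij ik il im) =
      K * ∑ jk, ∑ jl, ∑ jm, ∑ kl, ∑ km, ∑ lm,
        facetWeight (σ j) y (q j) j (row i k l m ij jk jl jm) *
        facetWeight (σ k) y (q k) k (row i j l m ik jk kl km) *
        facetWeight (σ l) y (q l) l (row i j k m il jl kl lm) *
        facetWeight (σ m) y (q m) m (row i j k l im jm km lm))
    (g : Sym2 (Fin 5) → ZMod N) :
    (N : ℂ) * ∑ v : Fin 0 → ZMod N, ∏ i' ∈ {i}, facetWeight (σ i') y (q i') i'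
        (fun j' => Function.extend ![] v g s(i', j')) =
      K * ∑ v : Fin 6 → ZMod N, ∏ i' ∈ ({i}ᶜ : Finset (Fin 5)), facetWeight (σ i') y (q i') i'
        (fun j' => Function.extend
          ![s(j, k), s(j, l), s(j, m), s(k, l), s(k, m), s(l, m)] v g s(i', j')) := by
  obtain ⟨ij, ik, il, im, jk, jl, jm, kl, km, lm⟩ := ne_of_nodup_five hn
  have p₁ := enumPairs_singleton i
  have p₂ := enumPairs_four jk jl jm kl km lm
  have n1 : [j, i, k, l, m].Nodup := nodup_swap₁ hn
  have n2 : [k, i, j, l, m].Nodup := nodup_swap₁ (nodup_swap₂ hn)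
  have n3 : [l, i, j, k, m].Nodup := nodup_swap₁ (nodup_swap₂ (nodup_swap₃ hn))
  have n4 : [m, i, j, k, l].Nodup := nodup_swap₁ (nodup_swap₂ (nodup_swap₃ (nodup_swap₄ hn)))
  set P : Fin 6 → Sym2 (Fin 5) := ![s(j, k), s(j, l), s(j, m), s(k, l), s(k, m), s(l, m)] with hP
  have e0 : ∀ v : Fin 6 → ZMod N, Function.extend P v g s(j, k) = v 0 :=
    fun v => p₂.inj.extend_apply v g 0
  have e1 : ∀ v : Fin 6 → ZMod N, Function.extend P v g s(j, l) = v 1 :=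
    fun v => p₂.inj.extend_apply v g 1
  have e2 : ∀ v : Fin 6 → ZMod N, Function.extend P v g s(j, m) = v 2 :=
    fun v => p₂.inj.extend_apply v g 2
  have e3 : ∀ v : Fin 6 → ZMod N, Function.extend P v g s(k, l) = v 3 :=
    fun v => p₂.inj.extend_apply v g 3
  have e4 : ∀ v : Fin 6 → ZMod N, Function.extend P v g s(k, m) = v 4 :=
    fun v => p₂.inj.extend_apply v g 4
  have e5 : ∀ v : Fin 6 → ZMod N, Function.extend P v g s(l, m) = v 5 :=
    fun v => p₂.inj.extend_apply v g 5
  have o₁ : ∀ (v : Fin 0 → ZMod N) (i' j' : Fin 5), j' ≠ i →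
      Function.extend ![] v g s(i', j') = g s(i', j') :=
    fun v i' j' h => extend_of_notMem p₁ v g (by simpa using h)
  have o₂ : ∀ (v : Fin 6 → ZMod N) (j' : Fin 5),
      Function.extend P v g s(j', i) = g s(i, j') := by
    intro v j'
    have hi : i ∉ ({j, k, l, m} : Finset (Fin 5)) := by simp [ij, ik, il, im]
    rw [extend_of_notMem p₂ v g hi, Sym2.eq_swap]
  have I : ∀ v : Fin 0 → ZMod N, facetWeight (σ i) y (q i) i
      (fun j' => Function.extend ![] v g s(i, j')) = facetWeight (σ i) y (q i) i
        (row j k l m (g s(i, j)) (g s(i, k)) (g s(i, l)) (g s(i, m))) := by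
    intro v
    rw [facetWeight_row hn]
    simp only [o₁ _ _ _ ij.symm, o₁ _ _ _ ik.symm, o₁ _ _ _ il.symm, o₁ _ _ _ im.symm]
  have J : ∀ v : Fin 6 → ZMod N, facetWeight (σ j) y (q j) j
      (fun j' => Function.extend P v g s(j, j')) = facetWeight (σ j) y (q j) j
        (row i k l m (g s(i, j)) (v 0) (v 1) (v 2)) := by
    intro v
    rw [facetWeight_row n1]
    simp only [o₂, e0, e1, e2]
  have K' : ∀ v : Fin 6 → ZMod N, facetWeight (σ k) y (q k) k
      (fun j' => Function.extend P v g s(k, j')) = facetWeight (σ k) y (q k) k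
        (row i j l m (g s(i, k)) (v 0) (v 3) (v 4)) := by
    intro v
    rw [facetWeight_row n2]
    simp only [o₂, Sym2.eq_swap (a := k) (b := j), e0, e3, e4]
  have L : ∀ v : Fin 6 → ZMod N, facetWeight (σ l) y (q l) l
      (fun j' => Function.extend P v g s(l, j')) = facetWeight (σ l) y (q l) l
        (row i j k m (g s(i, l)) (v 1) (v 3) (v 5)) := by
    intro v
    rw [facetWeight_row n3]
    simp only [o₂, Sym2.eq_swap (a := l) (b := j), e1, Sym2.eq_swap (a := l) (b := k), e3, e5]
  have M : ∀ v : Fin 6 → ZMod N, facetWeight (σ m) y (q m) m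
      (fun j' => Function.extend P v g s(m, j')) = facetWeight (σ m) y (q m) m
        (row i j k l (g s(i, m)) (v 2) (v 4) (v 5)) := by
    intro v
    rw [facetWeight_row n4]
    simp only [o₂, Sym2.eq_swap (a := m) (b := j), e2, Sym2.eq_swap (a := m) (b := k), e4,
      Sym2.eq_swap (a := m) (b := l), e5]
  rw [compl_singleton_five hn, Fintype.sum_unique, sum_fin_six]
  simp only [Finset.prod_singleton,
    Finset.prod_insert (show j ∉ ({k, l, m} : Finset (Fin 5)) by simp [jk, jl, jm]),
    Finset.prod_insert (show k ∉ ({l, m} : Finset (Fin 5)) by simp [kl, km]),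
    Finset.prod_pair lm, I, J, K', L, M]
  have := hK (g s(i, j)) (g s(i, k)) (g s(i, l)) (g s(i, m))
  simp only [mul_assoc] at this
  exact this

end Assembly

section BallMoves

variable {N : ℕ} [NeZero N] {d : ℂ → ℂ} {S : Finset (Fin 5)} {T T' : DecoratedTriangulation}
  {τ : S → T.cell 3} {τ' : (Sᶜ : Finset (Fin 5)) → T'.cell 3}
  {common : ∀ k, T.cell k → T'.cell k → Prop}

theorem IsBall.covers_empty {X : BranchedComplex} {S : Finset (Fin 5)} {τ : S → X.cell 3}
    (hB : IsBall X S τ) {k : ℕ} (h : ∀ φ : Fin (k + 1) ↪o Fin 5, InBall Sᶜ φ) :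
    Covers (InnerCell X S τ (k := k)) (![] : Fin 0 → X.cell k) :=
  hB.covers (Φ := ![]) (Function.injective_of_subsingleton _)
    (fun φ => ⟨fun hφ => absurd (h φ) hφ.2, fun ⟨n, _⟩ => n.elim0⟩) fun n => n.elim0

theorem inBall_vertex {S : Finset (Fin 5)} (hS : 2 ≤ S.card) (φ : Fin 1 ↪o Fin 5) :
    InBall S φ := by
  obtain ⟨i, hi, hne⟩ := Finset.exists_mem_ne hS (φ 0)
  refine ⟨i, hi, ?_⟩
  rintro ⟨a, rfl⟩
  exact hne (congrArg φ (Subsingleton.elim _ _))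

open Classical in
theorem card_outer
    (hm : IsBallMove T.toBranchedTriangulation T'.toBranchedTriangulation S τ τ' common) (k : ℕ) :
    Fintype.card {c : T.cell k // ¬ InnerCell T.toBranchedComplex S τ c} =
      Fintype.card {c' : T'.cell k // ¬ InnerCell T'.toBranchedComplex Sᶜ τ' c'} := by
  obtain ⟨e, -⟩ := exists_commonEquiv hm k
  exact Fintype.card_congr e

theorem sideSign_index
    (hm : IsBallMove T.toBranchedTriangulation T'.toBranchedTriangulation S τ τ' common) :
    ∃ ε, (∀ i : S, T.index (τ i) = sideSign S ε i) ∧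
      ∀ i : (Sᶜ : Finset (Fin 5)), T'.index (τ' i) = sideSign S ε i := by
  obtain ⟨ε, h, h'⟩ := hm.ball_index
  refine ⟨ε, fun i => ?_, fun i => ?_⟩
  · rw [h, sideSign, if_pos i.2]
  · rw [h', sideSign, if_neg (Finset.mem_compl.1 i.2)]

theorem exists_nodup_pair {a b : Fin 5} (h : a ≠ b) : ∃ c d e, [a, b, c, d, e].Nodup := by
  revert a b
  decide

theorem stateSum_transit23 (hN : Odd N) (h : Transit23 T T') (hd : T.RootHolds N d)
    (hd' : T'.RootHolds N d) : T.stateSum N d = T'.stateSum N d := by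
  classical
  obtain ⟨S, τ, τ', common, hS, hm, ha, hH, hH', hc⟩ := h
  obtain ⟨a, b, hab, rfl⟩ := Finset.card_eq_two.1 hS
  obtain ⟨v₁, v₂, v₃, hn⟩ := exists_nodup_pair hab
  have hcard : ({a, b}ᶜ : Finset (Fin 5)).card = 3 := by
    rw [Finset.card_compl, hS]
    rfl
  have hE₀ : ∀ φ : Fin 2 ↪o Fin 5, ∃ c, IsImage T'.toBranchedComplex {a, b}ᶜ τ' φ c :=
    fun φ => exists_image (inBall_edge hcard.ge φ)
  choose E hE using hE₀
  obtain ⟨y, q, D⟩ := exists_simplexData hm ha hd hd' hE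
  obtain ⟨ε, hε, hε'⟩ := sideSign_index hm
  obtain ⟨φab, hφab⟩ := exists_edge hab
  have hinner : ∀ φ : Fin 2 ↪o Fin 5, IsInner ({a, b}ᶜ : Finset (Fin 5)) φ ↔ φab = φ := by
    intro φ
    rw [isInner_iff, and_iff_right (inBall_edge hcard.ge φ)]
    constructor
    · intro h
      refine orderEmb_ext (hφab.trans (range_eq_pair hab ?_ ?_).symm)
      · by_contra ha
        simpa using h a ha
      · by_contra hb
        simpa using h b hb
    · rintro rfl i hi
      rw [hφab] at hi
      simpa using hi
  have hCE : Covers (InnerCell T'.toBranchedComplex {a, b}ᶜ τ' (k := 1)) ![E φab] := by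
    refine hm.ball'.covers (Φ := ![φab]) (Function.injective_of_subsingleton _) (fun φ => ?_)
      (fun n => ?_)
    · rw [hinner, Fin.exists_fin_one]
      rfl
    · rw [Subsingleton.elim n 0]
      exact hE φab
  have hab' : E φab ∉ T'.H := hH' _ (hCE.mem 0)
  have hb : ChargeBalance {a, b} (edgeInd a b) q := by
    intro u v huv
    obtain ⟨φ, hφ⟩ := exists_edge huv
    rw [D.sum hφ, D.sum' hφ, edgeInd_eq hφ hφab]
    split_ifs with h
    · subst h
      rw [ballCharge_inner T' hm.ball' (res_not_innerCell' hm) ((hinner _).2 rfl) (hE _),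
        if_neg hab', ballCharge_eq_zero]
      · push_cast
        rw [two_mul_half hN, zero_mul, zero_add]
      · intro i hi
        rw [hφab]
        simpa using hi
    · have hi : InBall {a, b} φ := by
        by_contra hi
        exact h ((hinner φ).1 ⟨inBall_edge hcard.ge φ, by rwa [compl_compl]⟩).symm
      rw [hc φ hi (inBall_edge hcard.ge φ), add_zero]
  obtain ⟨K, hK, hrel⟩ := pentagonRel hN D.params ε hn q D.charges hb
  obtain ⟨n₁, n₂, n₃, n₄, n₅, n₆, n₇, n₈, n₉, n₁₀⟩ := ne_of_nodup_five hn
  have hZ := sum_prod_tetSymbol_ballMove hm ha ⟨a, by simp⟩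
    (Finset.card_pos.1 (by rw [hcard]; decide)) (enumPairs_pair hab)
    ((compl_pair hn) ▸ enumPairs_three n₈ n₉ n₁₀) hε hε' D.root D.charge D.root' D.charge' 1 K
    (fun g => by rw [one_mul]; convert sum_relation_pentagon hn hrel g)
  have hcE : Covers (InnerCell T.toBranchedComplex {a, b} τ (k := 1)) ![] :=
    hm.ball.covers_empty (inBall_edge hcard.ge)
  have hcV : Covers (InnerCell T.toBranchedComplex {a, b} τ (k := 0)) ![] :=
    hm.ball.covers_empty (inBall_vertex (by omega))
  have hcV' : Covers (InnerCell T'.toBranchedComplex {a, b}ᶜ τ' (k := 0)) ![] :=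
    hm.ball'.covers_empty (inBall_vertex (by rw [compl_compl, hS]))
  refine DecoratedTriangulation.stateSum_eq_stateSum (w := 1) (K := K) (Y := y a b ^ (N - 1))
    one_ne_zero ?_ hZ ?_ hK
  · rw [one_mul, hcV.card_eq, hcV'.card_eq, card_outer hm]
  · obtain ⟨e, he, -⟩ := exists_commonEquiv hm 1
    rw [hcE.prod_eq, hCE.prod_eq, Fin.prod_univ_one, Fin.prod_univ_zero, one_mul, mul_comm]
    congr 1
    · exact (Fintype.prod_equiv e _ _ fun c =>
        DecoratedTriangulation.edgeFactor_congr (ha.cocycle _ _ (he c)) (hH _ _ (he c))).symm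
    · rw [D.edge hφab]
      exact DecoratedTriangulation.edgeFactor_of_notMem hN hab'

theorem exists_nodup_cone {i j k : Fin 5} (ij : i ≠ j) (ik : i ≠ k) (jk : j ≠ k) :
    ∃ l m, [i, j, k, l, m].Nodup := by
  revert i j k
  decide

theorem stateSum_transit14 (hN : Odd N) (h : Transit14 T T') (hd : T.RootHolds N d)
    (hd' : T'.RootHolds N d) : T.stateSum N d = T'.stateSum N d := by
  classical
  obtain ⟨i, τ, τ', common, φ₀, e₀, hm, ha, he₀, he₀H, hH, hH', hc⟩ := h
  obtain ⟨j, k, jk, hφ₀⟩ := exists_range_eq φ₀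
  have hiφ₀ : i ∉ Set.range φ₀ := by
    obtain ⟨i', ψ, hψ, -⟩ := he₀
    have h := notMem_range_trans_opp (i := i'.1) ψ
    rwa [hψ, Finset.mem_singleton.1 i'.2] at h
  have hi' := hiφ₀
  rw [hφ₀, Set.mem_insert_iff, Set.mem_singleton_iff, not_or] at hi'
  obtain ⟨l, m, hn⟩ := exists_nodup_cone hi'.1 hi'.2 jk
  obtain ⟨ij, ik, il, im, -, jl, jm, kl, km, lm⟩ := ne_of_nodup_five hn
  have hcard : ({i}ᶜ : Finset (Fin 5)).card = 4 := by
    rw [Finset.card_compl, Finset.card_singleton]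
    rfl
  have hE₀ : ∀ φ : Fin 2 ↪o Fin 5, ∃ c, IsImage T'.toBranchedComplex {i}ᶜ τ' φ c :=
    fun φ => exists_image (inBall_edge (by omega) φ)
  choose E hE using hE₀
  obtain ⟨y, q, D⟩ := exists_simplexData hm ha hd hd' hE
  obtain ⟨ε, hε, hε'⟩ := sideSign_index hm
  have hinner : ∀ {n : ℕ} (φ : Fin (n + 1) ↪o Fin 5), InBall {i}ᶜ φ →
      (IsInner ({i}ᶜ : Finset (Fin 5)) φ ↔ i ∈ Set.range φ) := by
    intro n φ hφ
    rw [isInner_iff, and_iff_right hφ]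
    constructor
    · intro h
      by_contra hi
      simpa using h i hi
    · intro hi v hv
      rw [Finset.mem_compl, Finset.mem_singleton]
      rintro rfl
      exact hv hi
  set o : Fin 4 → Fin 5 := ![j, k, l, m] with ho
  have hio : ∀ n, i ≠ o n := by
    intro n
    fin_cases n
    exacts [ij, ik, il, im]
  have hoinj : Function.Injective o := by
    intro n n'
    fin_cases n <;> fin_cases n' <;>
      simp [ho, jk, jl, jm, kl, km, lm, jk.symm, jl.symm, jm.symm, kl.symm, km.symm, lm.symm]
  choose Φ hΦ using fun n => exists_edge (hio n)
  have hΦinj : Function.Injective Φ := by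
    intro n n' h
    have h1 : o n ∈ Set.range (Φ n') := by
      rw [← h, hΦ]
      simp
    rw [hΦ] at h1
    exact hoinj (by simpa [(hio n).symm] using h1)
  have hΦmem : ∀ φ : Fin 2 ↪o Fin 5, i ∈ Set.range φ → ∃ n, Φ n = φ := by
    intro φ hi
    obtain ⟨u, v, huv, hφ⟩ := exists_range_eq φ
    have key : ∀ v, i ≠ v → Set.range φ = {i, v} → ∃ n, Φ n = φ := by
      intro v hv hφ
      have : ∃ n, o n = v := by
        rcases (eq_of_nodup_five hn v).resolve_left hv.symm with rfl | rfl | rfl | rfl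
        exacts [⟨0, rfl⟩, ⟨1, rfl⟩, ⟨2, rfl⟩, ⟨3, rfl⟩]
      obtain ⟨n, rfl⟩ := this
      exact ⟨n, orderEmb_ext ((hΦ n).trans hφ.symm)⟩
    rw [hφ, Set.mem_insert_iff, Set.mem_singleton_iff] at hi
    rcases hi with rfl | rfl
    · exact key v huv hφ
    · exact key u huv.symm (hφ.trans (Set.pair_comm _ _))
  have hiΦ : ∀ n, i ∈ Set.range (Φ n) := fun n => by
    rw [hΦ]
    simp
  have hEH : ∀ n, E (Φ n) ∈ T'.H ↔ o n = j ∨ o n = k := by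
    intro n
    rw [hH' _ _ (hiΦ n) (hE _), hΦ, hφ₀]
    simp [(hio n).symm]
  have hCE : Covers (InnerCell T'.toBranchedComplex {i}ᶜ τ' (k := 1)) fun n => E (Φ n) := by
    refine hm.ball'.covers hΦinj (fun φ => ?_) (fun n => hE _)
    rw [hinner φ (inBall_edge (by omega) φ)]
    constructor
    · exact hΦmem φ
    · rintro ⟨n, rfl⟩
      exact hiΦ n
  have hb : ChargeBalance {i}
      (fun u v => edgeInd j k u v + edgeInd i l u v + edgeInd i m u v) q := by
    intro u v huv
    obtain ⟨φ, hφ⟩ := exists_edge huv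
    rw [D.sum hφ, D.sum' hφ]
    beta_reduce
    rw [edgeInd_eq hφ hφ₀,
      edgeInd_eq (a := i) (b := l) hφ (hΦ 2), edgeInd_eq (a := i) (b := m) hφ (hΦ 3)]
    by_cases hi : i ∈ Set.range φ
    · have h0 : φ ≠ φ₀ := by
        rintro rfl
        exact hiφ₀ hi
      rw [if_neg h0, ballCharge_eq_zero T τ (by simpa using hi)]
      obtain ⟨n, rfl⟩ := hΦmem φ hi
      rw [ballCharge_inner T' hm.ball' (res_not_innerCell' hm)
        ((hinner _ (inBall_edge (by omega) _)).2 hi) (hE _)]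
      simp only [hEH, hΦinj.eq_iff]
      fin_cases n
      · simp [ho]
      · simp [ho]
      · simp [ho, jl.symm, kl.symm, two_mul_half hN]
      · simp [ho, jm.symm, km.symm, two_mul_half hN]
    · have h2 : ∀ n, φ ≠ Φ n := by
        rintro n rfl
        exact hi (hiΦ n)
      rw [hc φ hi, if_neg (h2 2), if_neg (h2 3), add_zero, add_zero]
      split_ifs
      · push_cast
        rw [add_mul, two_mul_half hN]
      · push_cast
        ring
  obtain ⟨K, hK, hrel⟩ := exists_cone_relation hN D.params ε hn D.charges hb
  have hZ := sum_prod_tetSymbol_ballMove hm ha ⟨i, by simp⟩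
    (Finset.card_pos.1 (by rw [hcard]; decide)) (enumPairs_singleton i)
    ((compl_singleton_five hn) ▸ enumPairs_four jk jl jm kl km lm) hε hε' D.root D.charge D.root'
    D.charge' N K (fun g => by convert sum_relation_cone hn hrel g)
  have hcE : Covers (InnerCell T.toBranchedComplex {i} τ (k := 1)) ![] :=
    hm.ball.covers_empty (inBall_edge (by omega))
  have hcV : Covers (InnerCell T.toBranchedComplex {i} τ (k := 0)) ![] :=
    hm.ball.covers_empty (inBall_vertex (by omega))
  obtain ⟨φi, hφi⟩ : ∃ φ : Fin 1 ↪o Fin 5, Set.range φ = {i} :=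
    ⟨OrderEmbedding.ofStrictMono ![i] (Subsingleton.strictMono _), by
      ext v; simp [eq_comm]⟩
  obtain ⟨ci, hci⟩ := exists_image (X := T'.toBranchedComplex) (τ := τ')
    (inBall_vertex (S := {i}ᶜ) (by omega) φi)
  have hcV' : Covers (InnerCell T'.toBranchedComplex {i}ᶜ τ' (k := 0)) ![ci] := by
    refine hm.ball'.covers (Φ := ![φi]) (Function.injective_of_subsingleton _) (fun φ => ?_)
      (fun n => ?_)
    · rw [hinner φ (inBall_vertex (by omega) φ), Fin.exists_fin_one]
      constructor
      · rintro ⟨a, ha⟩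
        refine orderEmb_ext (hφi.trans ?_)
        ext v
        rw [Set.mem_singleton_iff, ← ha]
        constructor
        · rintro rfl
          exact ⟨a, rfl⟩
        · rintro ⟨b, rfl⟩
          exact congrArg φ (Fin.fin_one_eq_zero _ |>.trans (Fin.fin_one_eq_zero _).symm)
      · rintro rfl
        exact hφi ▸ rfl
    · rw [Subsingleton.elim n 0]
      exact hci
  refine DecoratedTriangulation.stateSum_eq_stateSum (w := N) (K := K)
    (Y := (y j k * y i l * y i m) ^ (N - 1)) (Nat.cast_ne_zero.2 (NeZero.ne N)) ?_ hZ ?_ hK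
  · rw [hcV.card_eq, hcV'.card_eq, card_outer hm, Fintype.card_fin, Fintype.card_fin, pow_add,
      pow_add]
    ring
  · obtain ⟨e, he, -⟩ := exists_commonEquiv hm 1
    have hne₀ : ¬ InnerCell T.toBranchedComplex {i} τ e₀ :=
      hm.ball.not_innerCell he₀ (inBall_edge (by omega) φ₀)
    have hx : T.x e₀ = T'.x (E φ₀) := by
      rw [DecoratedTriangulation.x, DecoratedTriangulation.x,
        ha.cocycle _ _ (hm.common_boundary φ₀ _ _ he₀ (hE φ₀))]
    have hout : ∀ c : {c : T.cell 1 // ¬ InnerCell T.toBranchedComplex {i} τ c},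
        T'.edgeFactor N d (e c).1 = T.edgeFactor N d c.1 *
          if c = ⟨e₀, hne₀⟩ then (y j k ^ (N - 1))⁻¹ else 1 := by
      intro c
      split_ifs with h
      · subst h
        have hH₀ : (e ⟨e₀, hne₀⟩).1 ∉ T'.H := fun h => ((hH _ _ (he ⟨e₀, hne₀⟩)).1 h).2 rfl
        rw [DecoratedTriangulation.edgeFactor_of_notMem hN hH₀,
          DecoratedTriangulation.edgeFactor_of_mem he₀H, one_mul, D.edge hφ₀, ← hx,
          DecoratedTriangulation.x, DecoratedTriangulation.x, ← ha.cocycle _ _ (he _)]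
      · rw [mul_one]
        refine (DecoratedTriangulation.edgeFactor_congr (ha.cocycle _ _ (he c)) ?_).symm
        rw [hH _ _ (he c), and_iff_left fun h' => h (Subtype.ext h')]
    rw [hcE.prod_eq, hCE.prod_eq, Fin.prod_univ_four, Fin.prod_univ_zero, one_mul,
      ← Fintype.prod_equiv e _ _ fun c => rfl]
    simp only [hout]
    rw [Finset.prod_mul_distrib, Finset.prod_ite_eq' , if_pos (Finset.mem_univ _),
      DecoratedTriangulation.edgeFactor_of_mem ((hEH 0).2 (Or.inl rfl)),
      DecoratedTriangulation.edgeFactor_of_mem ((hEH 1).2 (Or.inr rfl)),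
      DecoratedTriangulation.edgeFactor_of_notMem hN
        (fun h => ((hEH 2).1 h).elim (fun h => jl h.symm) fun h => kl h.symm),
      DecoratedTriangulation.edgeFactor_of_notMem hN
        (fun h => ((hEH 3).1 h).elim (fun h => jm h.symm) fun h => km h.symm),
      ← D.edge (hΦ 2), ← D.edge (hΦ 3)]
    change 1 * 1 * (y i l ^ (N - 1))⁻¹ * (y i m ^ (N - 1))⁻¹ * _ = _
    rw [mul_pow, mul_pow, mul_inv, mul_inv]
    ring

end BallMoves

section Lune

theorem orderEmb_eq_refl {n : ℕ} (φ : Fin n ↪o Fin n) : φ = RelEmbedding.refl _ :=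
  orderEmb_ext ((Finite.injective_iff_surjective.1 φ.injective).range_eq.trans
    Function.surjective_id.range_eq.symm)

theorem exists_eq_opp {n : ℕ} (φ : Fin n ↪o Fin (n + 1)) : ∃ m, φ = opp m := by
  have h : ∃ m, m ∉ Set.range φ := by
    by_contra h
    push Not at h
    have := Fintype.card_le_of_surjective φ h
    simp at this
  obtain ⟨m, hm⟩ := h
  obtain ⟨ψ, rfl⟩ := exists_trans_opp hm
  exact ⟨m, by rw [orderEmb_eq_refl ψ]; rfl⟩

theorem BranchedTriangulation.face_unique (X : BranchedTriangulation) {f : X.cell 2}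
    {p q r : X.cell 3 × Fin 4} (hp : X.res (opp p.2) p.1 = f) (hq : X.res (opp q.2) q.1 = f)
    (hr : X.res (opp r.2) r.1 = f) (hpq : p ≠ q) : r = p ∨ r = q := by
  have key : ∀ {p q : X.cell 3 × Fin 4}, X.res (opp p.2) p.1 = f → X.res (opp q.2) q.1 = f →
      X.index p.1 * (-1) ^ (p.2 : ℕ) = X.index q.1 * (-1) ^ (q.2 : ℕ) → p = q :=
    fun hp hq h => (X.closed f _).unique ⟨hp, rfl⟩ ⟨hq, h.symm⟩
  by_contra hne
  push Not at hne
  have h1 : X.index p.1 * (-1) ^ (p.2 : ℕ) ≠ X.index q.1 * (-1) ^ (q.2 : ℕ) :=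
    fun h => hpq (key hp hq h)
  have h2 : X.index r.1 * (-1) ^ (r.2 : ℕ) ≠ X.index p.1 * (-1) ^ (p.2 : ℕ) :=
    fun h => hne.1 (key hr hp h)
  have h3 : X.index r.1 * (-1) ^ (r.2 : ℕ) ≠ X.index q.1 * (-1) ^ (q.2 : ℕ) :=
    fun h => hne.2 (key hr hq h)
  generalize X.index p.1 * (-1) ^ (p.2 : ℕ) = a at *
  generalize X.index q.1 * (-1) ^ (q.2 : ℕ) = b at *
  generalize X.index r.1 * (-1) ^ (r.2 : ℕ) = c at *
  rcases Int.units_eq_one_or a with rfl | rfl <;> rcases Int.units_eq_one_or b with rfl | rfl <;>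
    rcases Int.units_eq_one_or c with rfl | rfl <;> simp_all

theorem exists_others {i j : Fin 4} (h : i ≠ j) : ∃ k l, i ≠ k ∧ i ≠ l ∧ j ≠ k ∧ j ≠ l ∧ k ≠ l := by
  revert i j
  decide

theorem eq_of_ne_four {i j k l : Fin 4} (hij : i ≠ j) (hik : i ≠ k) (hil : i ≠ l) (hjk : j ≠ k)
    (hjl : j ≠ l) (hkl : k ≠ l) (v : Fin 4) : v = i ∨ v = j ∨ v = k ∨ v = l := by
  omega

namespace IsLuneMove

variable {T T' : BranchedTriangulation} {i j : Fin 4} {t₁ t₂ : T'.cell 3}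
  {common : ∀ k, T.cell k → T'.cell k → Prop} {k l : Fin 4}

theorem index_eq (h : IsLuneMove T T' i j t₁ t₂ common) : T'.index t₂ = -T'.index t₁ := by
  have h1 : T'.index t₁ ≠ T'.index t₂ := by
    intro e
    have := (T'.closed (T'.res (opp i) t₁) (T'.index t₁ * (-1) ^ (i : ℕ))).unique
      (y₁ := (t₁, i)) (y₂ := (t₂, i)) ⟨rfl, rfl⟩ ⟨h.glue_i.symm, by rw [e]⟩
    exact h.ne (congrArg Prod.fst this)
  rcases Int.units_eq_one_or (T'.index t₁) with e | e <;>
    rcases Int.units_eq_one_or (T'.index t₂) with e' | e' <;> simp_all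

theorem eq_of_face (h : IsLuneMove T T' i j t₁ t₂ common) {v : Fin 4} (hv : v = i ∨ v = j)
    {t : T'.cell 3} {w : Fin 4} (e : T'.res (opp w) t = T'.res (opp v) t₁) :
    w = v ∧ (t = t₁ ∨ t = t₂) := by
  have hg : T'.res (opp v) t₁ = T'.res (opp v) t₂ := by
    rcases hv with rfl | rfl
    · exact h.glue_i
    · exact h.glue_j
  rcases T'.face_unique (p := (t₁, v)) (q := (t₂, v)) (r := (t, w)) rfl hg.symm e
    (fun e => h.ne (congrArg Prod.fst e)) with e | e
  · exact ⟨congrArg Prod.snd e, Or.inl (congrArg Prod.fst e)⟩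
  · exact ⟨congrArg Prod.snd e, Or.inr (congrArg Prod.fst e)⟩

theorem res_eq (h : IsLuneMove T T' i j t₁ t₂ common) {n : ℕ} {φ : Fin (n + 1) ↪o Fin 4}
    (hφ : i ∉ Set.range φ ∨ j ∉ Set.range φ) : T'.res φ t₁ = T'.res φ t₂ := by
  rcases hφ with hφ | hφ
  · obtain ⟨ψ, rfl⟩ := exists_trans_opp hφ
    rw [T'.res_comp, T'.res_comp]
    exact congrArg _ h.glue_i
  · obtain ⟨ψ, rfl⟩ := exists_trans_opp hφ
    rw [T'.res_comp, T'.res_comp]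
    exact congrArg _ h.glue_j

theorem covers_tet (h : IsLuneMove T T' i j t₁ t₂ common) :
    Covers (PillowInner T'.toBranchedComplex i j t₁ t₂ (k := 3)) ![t₁, t₂] where
  inj := by
    intro a b e
    fin_cases a <;> fin_cases b
    exacts [rfl, absurd e h.ne, absurd e h.ne.symm, rfl]
  iff c := by
    rw [Fin.exists_fin_two]
    constructor
    · rintro ⟨φ, -, hφ⟩
      rwa [orderEmb_eq_refl φ, T'.res_id, T'.res_id] at hφ
    · intro hc
      refine ⟨RelEmbedding.refl _, fun v _ _ => ⟨v, rfl⟩, ?_⟩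
      rwa [T'.res_id, T'.res_id]

theorem covers_face (h : IsLuneMove T T' i j t₁ t₂ common) :
    Covers (PillowInner T'.toBranchedComplex i j t₁ t₂ (k := 2))
      ![T'.res (opp i) t₁, T'.res (opp j) t₁] where
  inj := by
    intro a b e
    have hij := h.lt.ne
    fin_cases a <;> fin_cases b
    exacts [rfl, absurd (h.eq_of_face (Or.inr rfl) e).1 hij,
      absurd (h.eq_of_face (Or.inl rfl) e).1 hij.symm, rfl]
  iff c := by
    rw [Fin.exists_fin_two]
    constructor
    · rintro ⟨φ, hφ, hc⟩
      obtain ⟨m, rfl⟩ := exists_eq_opp φ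
      by_cases hi : m = i
      · subst hi
        exact Or.inl (hc.elim id h.glue_i.trans)
      · by_cases hj : m = j
        · subst hj
          exact Or.inr (hc.elim id h.glue_j.trans)
        · have := hφ m hi hj
          rw [range_opp] at this
          exact absurd rfl this
    · rintro (hc | hc)
      · exact ⟨opp i, fun v hv _ => by rw [range_opp]; exact hv, Or.inl hc⟩
      · exact ⟨opp j, fun v _ hv => by rw [range_opp]; exact hv, Or.inl hc⟩

theorem covers_edge (h : IsLuneMove T T' i j t₁ t₂ common) (hik : i ≠ k) (hil : i ≠ l) (hjk : j ≠ k)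
    (hjl : j ≠ l) (hkl : k ≠ l) {φ : Fin 2 ↪o Fin 4} (hφ : Set.range φ = {k, l}) :
    Covers (PillowInner T'.toBranchedComplex i j t₁ t₂ (k := 1)) ![T'.res φ t₁] where
  inj := Function.injective_of_subsingleton _
  iff c := by
    rw [Fin.exists_fin_one]
    have hi : i ∉ Set.range φ := by
      rw [hφ]
      simp [hik, hil]
    constructor
    · rintro ⟨ψ, hψ, hc⟩
      have : ψ = φ := orderEmb_ext ((range_eq_pair hkl (hψ k hik.symm hjk.symm)
        (hψ l hil.symm hjl.symm)).trans hφ.symm)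
      subst this
      exact hc.elim id (h.res_eq (Or.inl hi)).trans
    · intro hc
      refine ⟨φ, fun v hv hv' => ?_, Or.inl hc⟩
      rw [hφ]
      simpa [hv, hv'] using eq_of_ne_four h.lt.ne hik hil hjk hjl hkl v

theorem not_pillowInner_vertex (hik : i ≠ k) (hil : i ≠ l) (hjk : j ≠ k)
    (hjl : j ≠ l) (hkl : k ≠ l) (c : T'.cell 0) :
    ¬ PillowInner T'.toBranchedComplex i j t₁ t₂ c := by
  rintro ⟨φ, hφ, -⟩
  obtain ⟨a, ha⟩ := hφ k hik.symm hjk.symm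
  obtain ⟨b, hb⟩ := hφ l hil.symm hjl.symm
  rw [Fin.fin_one_eq_zero a] at ha
  rw [Fin.fin_one_eq_zero b, ha] at hb
  exact hkl hb

theorem not_pillowInner_face (h : IsLuneMove T T' i j t₁ t₂ common) {v : Fin 4} (hi : i ≠ v)
    (hj : j ≠ v) {t : T'.cell 3} :
    ¬ PillowInner T'.toBranchedComplex i j t₁ t₂ (T'.res (opp v) t) := by
  rw [h.covers_face.iff, Fin.exists_fin_two]
  rintro (e | e)
  · exact hi (h.eq_of_face (Or.inl rfl) e.symm).1.symm
  · exact hj (h.eq_of_face (Or.inr rfl) e.symm).1.symm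

theorem edge_ne_link (h : IsLuneMove T T' i j t₁ t₂ common) {φ ψ : Fin 2 ↪o Fin 4}
    (hφ : ∀ v, v ∉ Set.range φ → v = i ∨ v = j) {t : T'.cell 3} (hψ : ψ ≠ φ) :
    T'.res ψ t ≠ T'.res φ t₁ := by
  intro e
  have key : ∀ p q : T'.toBranchedComplex.Corner (T'.res φ t₁), T'.CornerAdj _ p q →
      (p.1.2 = φ ∧ (p.1.1 = t₁ ∨ p.1.1 = t₂)) → q.1.2 = φ ∧ (q.1.1 = t₁ ∨ q.1.1 = t₂) := by
    rintro ⟨⟨t, χ⟩, hp⟩ ⟨⟨t', χ'⟩, hq⟩ ⟨θ, η, η', h1, h2, h3⟩ ⟨h4, h5⟩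
    dsimp only at *
    obtain ⟨m, rfl⟩ := exists_eq_opp η
    obtain ⟨m', rfl⟩ := exists_eq_opp η'
    have hm : m = i ∨ m = j := hφ m (by rw [← h4, ← h1]; exact notMem_range_trans_opp θ)
    have hg : T'.res (opp m) t = T'.res (opp m) t₁ := by
      rcases h5 with rfl | rfl
      · rfl
      · rcases hm with rfl | rfl
        · exact h.glue_i.symm
        · exact h.glue_j.symm
    obtain ⟨rfl, ht'⟩ := h.eq_of_face hm (h3.symm.trans hg)
    exact ⟨by rw [← h2, h1, h4], ht'⟩
  have key' : ∀ p q : T'.toBranchedComplex.Corner (T'.res φ t₁),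
      Relation.EqvGen (T'.CornerAdj _) p q →
      ((p.1.2 = φ ∧ (p.1.1 = t₁ ∨ p.1.1 = t₂)) ↔ q.1.2 = φ ∧ (q.1.1 = t₁ ∨ q.1.1 = t₂)) := by
    intro p q hpq
    induction hpq with
    | rel p q hpq =>
      refine ⟨key p q hpq, key q p ?_⟩
      obtain ⟨θ, η, η', h1, h2, h3⟩ := hpq
      exact ⟨θ, η', η, h2, h1, h3.symm⟩
    | refl => rfl
    | symm _ _ _ ih => exact ih.symm
    | trans _ _ _ _ _ ih ih' => exact ih.trans ih'
  exact hψ ((key' ⟨(t₁, φ), rfl⟩ ⟨(t, ψ), e⟩ (T'.edge_link _ _ _)).1 ⟨rfl, Or.inl rfl⟩).1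

theorem common_unique (h : IsLuneMove T T' i j t₁ t₂ common) {n : ℕ} {c c₁ : T.cell n}
    {c' : T'.cell n} (hc : common n c c') (hc₁ : common n c₁ c') : c = c₁ :=
  (h.common_right c' (h.common_inner _ _ hc)).unique hc hc₁

theorem eqvGen_congr {n : ℕ} {A : Type*} {f : T'.cell n → A}
    (hf : ∀ φ : Fin (n + 1) ↪o Fin 4, f (T'.res φ t₁) = f (T'.res φ t₂)) {c c' : T'.cell n}
    (hc : Relation.EqvGen (fun a b => ∃ φ : Fin (n + 1) ↪o Fin 4,
      T'.res φ t₁ = a ∧ T'.res φ t₂ = b) c c') : f c = f c' := by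
  induction hc with
  | rel _ _ hab =>
    obtain ⟨φ, rfl, rfl⟩ := hab
    exact hf φ
  | refl => rfl
  | symm _ _ _ ih => exact ih.symm
  | trans _ _ _ _ _ ih ih' => exact ih.trans ih'

theorem eq_of_common (h : IsLuneMove T T' i j t₁ t₂ common) {n : ℕ} {A : Type*} {f : T'.cell n → A}
    (hf : ∀ φ : Fin (n + 1) ↪o Fin 4, f (T'.res φ t₁) = f (T'.res φ t₂)) {c : T.cell n}
    {c' c'' : T'.cell n} (hc : common n c c') (hc' : common n c c'') : f c' = f c'' :=
  eqvGen_congr hf ((h.common_fibre c c' c'' hc).1 hc').2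

theorem common_res_two (h : IsLuneMove T T' i j t₁ t₂ common) {n : ℕ} {c : T.cell n}
    {φ : Fin (n + 1) ↪o Fin 4} (hc : common n c (T'.res φ t₁))
    (h₂ : ¬ PillowInner T'.toBranchedComplex i j t₁ t₂ (T'.res φ t₂)) :
    common n c (T'.res φ t₂) :=
  (h.common_fibre c _ _ hc).2 ⟨h₂, Relation.EqvGen.rel _ _ ⟨φ, rfl, rfl⟩⟩

/-- The projection of the outer cells of the pillow which flattens it. -/
theorem exists_projection (h : IsLuneMove T T' i j t₁ t₂ common) (n : ℕ) :
    ∃ π : {c' : T'.cell n // ¬ PillowInner T'.toBranchedComplex i j t₁ t₂ c'} → T.cell n,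
      (∀ c', common n (π c') c'.1) ∧ Function.Surjective π ∧
        ∀ c c', common n c c'.1 → π c' = c := by
  choose π hπ using fun c' : {c' : T'.cell n // ¬ PillowInner T'.toBranchedComplex i j t₁ t₂ c'} =>
    (h.common_right c'.1 c'.2).exists
  refine ⟨π, hπ, fun c => ?_, fun c c' hc => h.common_unique (hπ c') hc⟩
  obtain ⟨c', hc'⟩ := h.common_left c
  exact ⟨⟨c', h.common_inner _ _ hc'⟩, h.common_unique (hπ _) hc'⟩

theorem card_vertex (h : IsLuneMove T T' i j t₁ t₂ common) :
    Fintype.card (T.cell 0) = Fintype.card (T'.cell 0) := by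
  obtain ⟨k, l, hik, hil, hjk, hjl, hkl⟩ := exists_others h.lt.ne
  obtain ⟨π, hπ, hs, -⟩ := h.exists_projection 0
  have hf : ∀ φ : Fin (0 + 1) ↪o Fin 4, T'.res φ t₁ = T'.res φ t₂ := by
    intro φ
    refine h.res_eq ?_
    by_contra hc
    push Not at hc
    obtain ⟨⟨a, ha⟩, ⟨b, hb⟩⟩ := hc
    rw [Fin.fin_one_eq_zero a] at ha
    rw [Fin.fin_one_eq_zero b, ha] at hb
    exact h.lt.ne hb
  have hinj : Function.Injective π := by
    intro a b hab
    refine Subtype.ext (h.eq_of_common (f := id) hf (hπ a) ?_)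
    rw [hab]
    exact hπ b
  refine (Fintype.card_of_bijective (f := fun c' : T'.cell 0 =>
    π ⟨c', not_pillowInner_vertex hik hil hjk hjl hkl c'⟩) ⟨fun a b hab => ?_, fun c => ?_⟩).symm
  · exact congrArg Subtype.val (hinj hab)
  · obtain ⟨c', rfl⟩ := hs c
    exact ⟨c'.1, rfl⟩

theorem exists_tetEquiv (h : IsLuneMove T T' i j t₁ t₂ common) :
    ∃ e : {c' : T'.cell 3 // ¬ PillowInner T'.toBranchedComplex i j t₁ t₂ c'} ≃ T.cell 3,
      ∀ c', common 3 (e c') c'.1 := by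
  classical
  obtain ⟨π, hπ, hs, -⟩ := h.exists_projection 3
  refine ⟨Equiv.ofBijective π ⟨fun a b hab => ?_, hs⟩, hπ⟩
  have hout : ∀ c : {c' : T'.cell 3 // ¬ PillowInner T'.toBranchedComplex i j t₁ t₂ c'},
      c.1 ≠ t₁ ∧ c.1 ≠ t₂ := by
    intro c
    have := c.2
    rw [h.covers_tet.iff, Fin.exists_fin_two, not_or] at this
    exact ⟨Ne.symm this.1, Ne.symm this.2⟩
  have h1 := h.eq_of_common (f := fun c => if c = t₁ then t₂ else c) ?_ (hπ a) (hab ▸ hπ b)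
  · rw [if_neg (hout a).1, if_neg (hout b).1] at h1
    exact Subtype.ext h1
  · intro φ
    rw [orderEmb_eq_refl φ, T'.res_id, T'.res_id, if_pos rfl, if_neg h.ne.symm]

end IsLuneMove

end Lune

section LuneSum

variable {N : ℕ} [NeZero N] {d : ℂ → ℂ} {T T' : DecoratedTriangulation} {i j : Fin 4}
  {t₁ t₂ : T'.cell 3} {common : ∀ k, T.cell k → T'.cell k → Prop} {k l : Fin 4}

theorem IsLuneMove.edge_congr {T T' : BranchedTriangulation} {i j : Fin 4} {t₁ t₂ : T'.cell 3}
    {common : ∀ k, T.cell k → T'.cell k → Prop} (h : IsLuneMove T T' i j t₁ t₂ common) {A : Type*}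
    {f : T'.cell 1 → A} (hf : f (T'.res (pair i j h.lt) t₁) = f (T'.res (pair i j h.lt) t₂))
    (φ : Fin 2 ↪o Fin 4) : f (T'.res φ t₁) = f (T'.res φ t₂) := by
  by_cases hi : i ∈ Set.range φ
  · by_cases hj : j ∈ Set.range φ
    · rwa [orderEmb_ext ((range_eq_pair h.lt.ne hi hj).trans (range_pair h.lt).symm)]
    · rw [h.res_eq (Or.inr hj)]
  · rw [h.res_eq (Or.inl hi)]

theorem tetSymbol_pillow
    (h : IsLuneMove T.toBranchedTriangulation T'.toBranchedTriangulation i j t₁ t₂ common)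
    (hik : i ≠ k) (hil : i ≠ l) (hjk : j ≠ k) (hjl : j ≠ l) (hkl : k ≠ l) {t : T'.cell 3}
    (hi : T'.res (opp i) t = T'.res (opp i) t₁) (hj : T'.res (opp j) t = T'.res (opp j) t₁)
    (β : {c : T'.cell 2 // ¬ PillowInner T'.toBranchedComplex i j t₁ t₂ c} → ZMod N)
    (u v : ZMod N) :
    T'.tetSymbol N d (h.covers_face.glue β ![u, v]) t =
      tetWeight (T'.index t) (T'.tetRoot d t) (T'.tetCharge N t)
        (Function.update (Function.update
          (fun m => h.covers_face.glue β 0 (T'.res (opp m) t)) i u) j v) := by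
  have hij := h.lt.ne
  rw [T'.tetSymbol_eq]
  congr 1
  ext m
  have hout : ∀ {m}, i ≠ m → j ≠ m → h.covers_face.glue β ![u, v] (T'.res (opp m) t) =
      h.covers_face.glue β 0 (T'.res (opp m) t) := by
    intro m hi hj
    rw [Covers.glue_out _ _ _ (h.not_pillowInner_face hi hj),
      Covers.glue_out _ _ _ (h.not_pillowInner_face hi hj)]
  rcases eq_of_ne_four hij hik hil hjk hjl hkl m with rfl | rfl | rfl | rfl
  · rw [Function.update_of_ne hij, Function.update_self, hi]
    exact h.covers_face.glue_apply β ![u, v] 0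
  · rw [Function.update_self, hj]
    exact h.covers_face.glue_apply β ![u, v] 1
  · rw [Function.update_of_ne hjk.symm, Function.update_of_ne hik.symm, hout hik hjk]
  · rw [Function.update_of_ne hjl.symm, Function.update_of_ne hil.symm, hout hil hjl]

theorem tetCharge_add_of_intCharge_add (hN : Odd N) {a b : Fin 4} {n : ℤ}
    (h : T'.intCharge t₁ a b + T'.intCharge t₂ a b = 2 * n) :
    T'.tetCharge N t₁ a b + T'.tetCharge N t₂ a b = n := by
  rw [T'.tetCharge_eq, T'.tetCharge_eq, ← add_mul, ← Int.cast_add, h]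
  push_cast
  rw [mul_right_comm, two_mul_half hN, one_mul]

open Classical in
theorem sum_prod_tetSymbol_lune (hN : Odd N)
    (h : IsLuneMove T.toBranchedTriangulation T'.toBranchedTriangulation i j t₁ t₂ common)
    (ha : AgreeOnCommon T T' common) (hd' : T'.RootHolds N d)
    (hz : T'.tetRoot d t₁ = T'.tetRoot d t₂)
    (hc : ∀ φ : Fin 2 ↪o Fin 4, (i ∈ Set.range φ ↔ j ∉ Set.range φ) →
      T'.charge t₁ φ + T'.charge t₂ φ = 0)
    (hik : i ≠ k) (hil : i ≠ l) (hjk : j ≠ k) (hjl : j ≠ l) (hkl : k ≠ l) :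
    ∃ K : ℂ, K ^ N = ((T'.tetRoot d t₁ i j * T'.tetRoot d t₁ k l) ^ (N - 1)) ^ N ∧
      ∑ α : T'.cell 2 → ZMod N, ∏ t, T'.tetSymbol N d α t =
        K * ∑ α : T.cell 2 → ZMod N, ∏ t, T.tetSymbol N d α t := by
  have hij := h.lt.ne
  have c₀ : ∀ {a b}, a ≠ b →
      (i ∈ ({a, b} : Set (Fin 4)) ↔ j ∉ ({a, b} : Set (Fin 4))) →
      T'.intCharge t₁ a b + T'.intCharge t₂ a b = 0 := by
    intro a b hab hcond
    obtain ⟨φ, hφ⟩ := exists_edge hab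
    rw [DecoratedTriangulation.intCharge, DecoratedTriangulation.intCharge, edgeVal_eq _ hφ,
      edgeVal_eq _ hφ]
    exact hc φ (by rwa [hφ])
  have cik := c₀ hik (by simp [hij.symm, hjk])
  have cil := c₀ hil (by simp [hij.symm, hjl])
  have cjk := c₀ hjk (by simp [hij, hik])
  have cij : T'.intCharge t₁ i j + T'.intCharge t₂ i j = 2 := by
    have h1 := (T'.intCharge_sums t₁ hij hik hil hjk hjl hkl).2
    have h2 := (T'.intCharge_sums t₂ hij hik hil hjk hjl hkl).2
    linarith
  obtain ⟨K, hK, hI⟩ := tetWeight_inverse hN (T'.index t₁) (T'.tetParams_tetRoot hd' t₁)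
    (T'.tetCharges_tetCharge N t₁) (T'.tetCharges_tetCharge N t₂) hij hik hil hjk hjl hkl
    (by simpa using tetCharge_add_of_intCharge_add hN (n := 1) (cij.trans (by norm_num)))
    (by simpa using tetCharge_add_of_intCharge_add hN (n := 0) (cik.trans (by norm_num)))
    (by simpa using tetCharge_add_of_intCharge_add hN (n := 0) (cil.trans (by norm_num)))
  refine ⟨K, hK, ?_⟩
  have hcf := h.covers_face
  obtain ⟨π, hπ, hs, hπ'⟩ := h.exists_projection 2
  obtain ⟨e, he⟩ := h.exists_tetEquiv
  have hZ : ∑ α : T'.cell 2 → ZMod N, ∏ t, T'.tetSymbol N d α t =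
      ∑ β : {c : T'.cell 2 // ¬ PillowInner T'.toBranchedComplex i j t₁ t₂ c} → ZMod N,
        (if hcf.glue β 0 (T'.res (opp k) t₁) = hcf.glue β 0 (T'.res (opp k) t₂) ∧
          hcf.glue β 0 (T'.res (opp l) t₁) = hcf.glue β 0 (T'.res (opp l) t₂) then K else 0) *
        ∏ t : {t : T'.cell 3 // ¬ PillowInner T'.toBranchedComplex i j t₁ t₂ t},
          T'.tetSymbol N d (hcf.glue β 0) t := by
    rw [hcf.sum_glue]
    refine Finset.sum_congr rfl fun β _ => ?_
    have h1 := hI (fun m => hcf.glue β 0 (T'.res (opp m) t₁))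
      fun m => hcf.glue β 0 (T'.res (opp m) t₂)
    have h2 : (if hcf.glue β 0 (T'.res (opp k) t₁) = hcf.glue β 0 (T'.res (opp k) t₂) ∧
          hcf.glue β 0 (T'.res (opp l) t₁) = hcf.glue β 0 (T'.res (opp l) t₂) then K else 0) =
        ∑ v : Fin 2 → ZMod N, T'.tetSymbol N d (hcf.glue β v) t₁ *
          T'.tetSymbol N d (hcf.glue β v) t₂ := by
      refine Eq.trans (if_congr Iff.rfl rfl rfl) (h1.symm.trans ?_)
      rw [sum_fin_two]
      refine Finset.sum_congr rfl fun u _ => Finset.sum_congr rfl fun v _ => ?_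
      rw [tetSymbol_pillow h hik hil hjk hjl hkl rfl rfl,
        tetSymbol_pillow h hik hil hjk hjl hkl h.glue_i.symm h.glue_j.symm, h.index_eq, hz]
    rw [h2, Finset.sum_mul]
    refine Finset.sum_congr rfl fun v _ => ?_
    rw [h.covers_tet.prod_eq, Fin.prod_univ_two]
    congr 1
    refine Finset.prod_congr rfl fun t _ => ?_
    refine DecoratedTriangulation.tetSymbol_congr N d rfl (fun _ => rfl) rfl fun m => ?_
    have hm : ¬ PillowInner T'.toBranchedComplex i j t₁ t₂ (T'.res (opp m) t.1) := by
      obtain ⟨c, hc, -⟩ := h.common_right t.1 t.2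
      exact h.common_inner _ _ (h.common_res (opp m) _ _ hc)
    rw [hcf.glue_out _ _ hm, Covers.glue_out _ _ _ hm]
  rw [hZ, Finset.mul_sum]
  symm
  have hglue : ∀ (β : T.cell 2 → ZMod N) {c c'}, common 2 c c' →
      hcf.glue (fun x => β (π x)) 0 c' = β c := by
    intro β c c' hc
    rw [hcf.glue_out _ _ (h.common_inner _ _ hc), hπ' c ⟨c', h.common_inner _ _ hc⟩ hc]
  refine Fintype.sum_of_injective (fun (β : T.cell 2 → ZMod N) x => β (π x)) ?_ _ _ ?_ ?_
  · intro β β' hβ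
    ext c
    obtain ⟨c', rfl⟩ := hs c
    exact congrFun hβ c'
  · intro β hβ
    rw [if_neg, zero_mul]
    rintro ⟨hk, hl⟩
    refine hβ ⟨fun c => β (hs c).choose, funext fun c' => ?_⟩
    have h1 := h.eq_of_common (f := hcf.glue β 0) ?_ (hπ (hs (π c')).choose)
      ((hs (π c')).choose_spec.symm ▸ hπ c')
    · rwa [hcf.glue_out _ _ (hs (π c')).choose.2, hcf.glue_out _ _ c'.2] at h1
    · intro φ
      obtain ⟨m, rfl⟩ := exists_eq_opp φ
      rcases eq_of_ne_four hij hik hil hjk hjl hkl m with rfl | rfl | rfl | rfl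
      · exact congrArg _ h.glue_i
      · exact congrArg _ h.glue_j
      · exact hk
      · exact hl
  · intro β
    have hface : ∀ {m}, i ≠ m → j ≠ m → hcf.glue (fun x => β (π x)) 0 (T'.res (opp m) t₁) =
        hcf.glue (fun x => β (π x)) 0 (T'.res (opp m) t₂) := by
      intro m hi hj
      have h1 := hπ ⟨_, h.not_pillowInner_face hi hj (t := t₁)⟩
      rw [hglue β h1, hglue β (h.common_res_two h1 (h.not_pillowInner_face hi hj))]
    rw [if_pos ⟨hface hik hjk, hface hil hjl⟩]
    congr 1
    refine (Fintype.prod_equiv e _ _ fun t => ?_).symm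
    refine (DecoratedTriangulation.tetSymbol_congr N d (h.common_index _ _ (he t))
      (fun φ => ha.cocycle _ _ (h.common_res φ _ _ (he t))) (ha.charge _ _ (he t)) fun m => ?_).symm
    exact (hglue β (h.common_res (opp m) _ _ (he t))).symm

end LuneSum

section LuneTransit

variable {N : ℕ} {d : ℂ → ℂ} {T T' : DecoratedTriangulation}

theorem edgeFactor_mul_eq (hN : Odd N) {e : T.cell 1} {e₁ e₂ : T'.cell 1}
    (h₁ : T.z e = T'.z e₁) (h₂ : T.z e = T'.z e₂)
    (hH : e₁ ∈ T'.H ∨ e₂ ∈ T'.H → e ∈ T.H) (hH' : e ∈ T.H → (e₁ ∈ T'.H ↔ e₂ ∉ T'.H)) :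
    T'.edgeFactor N d e₁ * T'.edgeFactor N d e₂ =
      T.edgeFactor N d e * (d (T'.x e₁) ^ (N - 1))⁻¹ := by
  have hx : T'.x e₁ = T.x e := by rw [DecoratedTriangulation.x, ← h₁, DecoratedTriangulation.x]
  have hx' : T'.x e₂ = T.x e := by rw [DecoratedTriangulation.x, ← h₂, DecoratedTriangulation.x]
  by_cases he : e ∈ T.H
  · rw [DecoratedTriangulation.edgeFactor_of_mem he]
    by_cases h : e₁ ∈ T'.H
    · rw [DecoratedTriangulation.edgeFactor_of_mem h,
        DecoratedTriangulation.edgeFactor_of_notMem hN ((hH' he).1 h), hx, hx']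
    · rw [DecoratedTriangulation.edgeFactor_of_mem (not_not.1 fun h' => h ((hH' he).2 h')),
        DecoratedTriangulation.edgeFactor_of_notMem hN h, mul_comm]
  · rw [DecoratedTriangulation.edgeFactor_of_notMem hN fun h => he (hH (Or.inl h)),
      DecoratedTriangulation.edgeFactor_of_notMem hN fun h => he (hH (Or.inr h)),
      DecoratedTriangulation.edgeFactor_of_notMem hN he, hx, hx']

theorem stateSum_transit02 [NeZero N] (hN : Odd N) (h : Transit02 T T') (hd' : T'.RootHolds N d) :
    T.stateSum N d = T'.stateSum N d := by
  classical
  obtain ⟨i, j, t₁, t₂, common, h, ha, hH, hH', hHM, hc⟩ := h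
  have hij := h.lt.ne
  obtain ⟨k, l, hik, hil, hjk, hjl, hkl⟩ := exists_others hij
  obtain ⟨φM, hφM⟩ := exists_edge hkl
  have hM := h.covers_edge hik hil hjk hjl hkl hφM
  set M := T'.res φM t₁ with hMdef
  set E₁ := T'.res (pair i j h.lt) t₁ with hE₁
  set E₂ := T'.res (pair i j h.lt) t₂ with hE₂
  have hE : E₁ ≠ E₂ := h.edge_ne
  have hpair : pair i j h.lt ≠ φM := by
    intro e
    have : i ∈ Set.range φM := by
      rw [← e, range_pair]
      simp
    rw [hφM] at this
    simp [hik, hil] at this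
  have hMc : ∀ v, v ∉ Set.range φM → v = i ∨ v = j := by
    intro v hv
    rw [hφM] at hv
    simp only [Set.mem_insert_iff, Set.mem_singleton_iff, not_or] at hv
    rcases eq_of_ne_four hij hik hil hjk hjl hkl v with rfl | rfl | rfl | rfl
    exacts [Or.inl rfl, Or.inr rfl, absurd rfl hv.1, absurd rfl hv.2]
  have hE₁M : E₁ ≠ M := h.edge_ne_link hMc hpair
  have hE₂M : E₂ ≠ M := h.edge_ne_link hMc hpair
  have hin : ∀ {c : T'.cell 1}, PillowInner T'.toBranchedComplex i j t₁ t₂ c ↔ c = M := by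
    intro c
    rw [hM.iff, Fin.exists_fin_one]
    exact eq_comm
  obtain ⟨c₀, hc₁, -⟩ := h.common_right E₁ fun h => hE₁M (hin.1 h)
  have hc₂ : common 1 c₀ E₂ := h.common_res_two hc₁ fun h => hE₂M (hin.1 h)
  have hz : T'.tetRoot d t₁ = T'.tetRoot d t₂ := by
    refine congrArg edgeVal (funext fun φ => h.edge_congr (f := fun e => d (T'.x e)) ?_ φ)
    change d (T'.z E₁ 0 1) = d (T'.z E₂ 0 1)
    rw [← ha.cocycle _ _ hc₁, ← ha.cocycle _ _ hc₂]
  obtain ⟨K, hK, hZ⟩ := sum_prod_tetSymbol_lune hN h ha hd' hz hc hik hil hjk hjl hkl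
  have hcov : Covers (fun c : T'.cell 1 => c = M ∨ c = E₂) ![M, E₂] :=
    ⟨by
      intro a b e
      fin_cases a <;> fin_cases b
      exacts [rfl, absurd e hE₂M.symm, absurd e hE₂M, rfl],
    fun c => by
      rw [Fin.exists_fin_two]
      exact or_congr eq_comm eq_comm⟩
  obtain ⟨e, he⟩ : ∃ e : {c : T'.cell 1 // ¬ (c = M ∨ c = E₂)} ≃ T.cell 1,
      ∀ c, common 1 (e c) c.1 := by
    obtain ⟨π, hπ, hs, hπ'⟩ := h.exists_projection 1
    have hout : ∀ c : {c : T'.cell 1 // ¬ (c = M ∨ c = E₂)},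
        ¬ PillowInner T'.toBranchedComplex i j t₁ t₂ c.1 :=
      fun c hc => c.2 (Or.inl (hin.1 hc))
    refine ⟨Equiv.ofBijective (fun c => π ⟨c.1, hout c⟩) ⟨fun a b hab => ?_, fun c => ?_⟩,
      fun c => hπ _⟩
    · have hf : (if E₁ = E₂ then E₁ else E₁) = if E₂ = E₂ then E₁ else E₂ := by
        rw [if_neg hE, if_pos rfl]
      have h1 := h.eq_of_common (f := fun c => if c = E₂ then E₁ else c)
        (h.edge_congr (f := fun c => if c = E₂ then E₁ else c) hf) (hπ ⟨a.1, hout a⟩)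
        (show common 1 (π ⟨a.1, hout a⟩) b.1 by
          rw [show π ⟨a.1, hout a⟩ = π ⟨b.1, hout b⟩ from hab]
          exact hπ _)
      rw [if_neg fun e => a.2 (Or.inr e), if_neg fun e => b.2 (Or.inr e)] at h1
      exact Subtype.ext h1
    · obtain ⟨c', rfl⟩ := hs c
      by_cases hc' : c'.1 = E₂
      · refine ⟨⟨E₁, fun hE' => hE'.elim hE₁M hE⟩, hπ' _ ⟨E₁, _⟩ ?_⟩
        have : π c' = c₀ := h.common_unique (hπ c') (hc' ▸ hc₂)
        rw [this]
        exact hc₁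
      · exact ⟨⟨c'.1, fun hE' => hE'.elim (fun e => c'.2 (hin.2 e)) hc'⟩, rfl⟩
  set x₁ : {c : T'.cell 1 // ¬ (c = M ∨ c = E₂)} := ⟨E₁, fun hE' => hE'.elim hE₁M hE⟩ with hx₁
  have hex₁ : e x₁ = c₀ := h.common_unique (he x₁) hc₁
  have hother : ∀ c, c ≠ x₁ → T.edgeFactor N d (e c) = T'.edgeFactor N d c.1 := by
    intro c hcx
    refine DecoratedTriangulation.edgeFactor_congr (ha.cocycle _ _ (he c))
      ⟨fun hcH => ?_, hH _ _ (he c)⟩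
    obtain ⟨c', ⟨hc', hc'H⟩, -⟩ := hH' _ hcH
    have hc'M : c' ≠ M := fun e => h.common_inner _ _ hc' (hin.2 e)
    have hc'E : c' ≠ E₂ := by
      rintro rfl
      exact hcx (e.injective ((h.common_unique hc' hc₂).trans hex₁.symm))
    have : e ⟨c', fun hE' => hE'.elim hc'M hc'E⟩ = e c := h.common_unique (he _) hc'
    rw [← e.injective this]
    exact hc'H
  have hfac : T'.edgeFactor N d E₁ * T'.edgeFactor N d E₂ =
      T.edgeFactor N d c₀ * (d (T'.x E₁) ^ (N - 1))⁻¹ := by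
    refine edgeFactor_mul_eq hN (ha.cocycle _ _ hc₁) (ha.cocycle _ _ hc₂)
      (fun hor => hor.elim (hH _ _ hc₁) (hH _ _ hc₂)) fun hcH => ?_
    obtain ⟨c', ⟨hc', hc'H⟩, huniq⟩ := hH' _ hcH
    constructor
    · exact fun h1 h2 => hE ((huniq E₁ ⟨hc₁, h1⟩).trans (huniq E₂ ⟨hc₂, h2⟩).symm)
    · intro h2
      have hc'E : c' ≠ E₂ := by
        rintro rfl
        exact h2 hc'H
      have hc'M : c' ≠ M := fun e => h.common_inner _ _ hc' (hin.2 e)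
      have : e ⟨c', fun hE' => hE'.elim hc'M hc'E⟩ = e x₁ :=
        (h.common_unique (he _) hc').trans hex₁.symm
      have h3 : c' = E₁ := congrArg Subtype.val (e.injective this)
      exact h3 ▸ hc'H
  have hy₁ : T'.tetRoot d t₁ i j = d (T'.x E₁) := edgeVal_eq _ (range_pair h.lt)
  have hy₂ : T'.tetRoot d t₁ k l = d (T'.x M) := edgeVal_eq _ hφM
  have hY : T'.tetRoot d t₁ i j * T'.tetRoot d t₁ k l ≠ 0 := by
    rw [hy₁, hy₂]
    exact mul_ne_zero (T'.root_ne_zero hd' _) (T'.root_ne_zero hd' _)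
  have hK0 : K ≠ 0 := by
    rintro rfl
    rw [zero_pow (NeZero.ne N)] at hK
    exact pow_ne_zero _ (pow_ne_zero _ hY) hK.symm
  refine DecoratedTriangulation.stateSum_eq_stateSum (w := 1) (K := K⁻¹)
    (Y := (T'.tetRoot d t₁ i j * T'.tetRoot d t₁ k l) ^ (N - 1)) one_ne_zero ?_ ?_ ?_ ?_
  · rw [one_mul, h.card_vertex]
  · rw [hZ, one_mul, inv_mul_cancel_left₀ hK0]
  · have hprod : ∏ c, T'.edgeFactor N d c = T'.edgeFactor N d M * T'.edgeFactor N d E₂ *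
        ∏ c : {c : T'.cell 1 // ¬ (c = M ∨ c = E₂)}, T'.edgeFactor N d c := by
      have := hcov.prod_eq (T'.edgeFactor N d)
      rw [Fin.prod_univ_two] at this
      convert this <;> rfl
    rw [hprod, ← Equiv.prod_comp e,
      Fintype.prod_eq_mul_prod_compl x₁, Fintype.prod_eq_mul_prod_compl x₁,
      Finset.prod_congr rfl fun c hc => hother c (by simpa using hc), hex₁]
    change T'.edgeFactor N d M * T'.edgeFactor N d E₂ * (T'.edgeFactor N d E₁ * _) = _
    rw [DecoratedTriangulation.edgeFactor_of_notMem hN (hHM _ (hin.2 rfl)), mul_pow, mul_inv, hy₁,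
      hy₂]
    linear_combination ((d (T'.x M) ^ (N - 1))⁻¹ *
      ∏ c ∈ {x₁}ᶜ, T'.edgeFactor N d c.1) * hfac
  · rw [mul_pow, inv_pow, hK, inv_mul_cancel₀ (pow_ne_zero _ (pow_ne_zero _ hY))]

end LuneTransit

end QHyp

theorem proposition3p1 (N : ℕ) [NeZero N] (hN : Odd N) (T T' : QHyp.DecoratedTriangulation)
    (hT : QHyp.Transit T T') (d : ℂ → ℂ) (hd : T.RootHolds N d) (hd' : T'.RootHolds N d) :
    T.stateSum N d = T'.stateSum N d := by
  rcases hT with h | h | h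
  · exact QHyp.stateSum_transit23 hN h hd hd'
  · exact QHyp.stateSum_transit02 hN h hd'
  · exact QHyp.stateSum_transit14 hN h hd hd'
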